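/- **Definitions.** Let $P=\{z\in\mathbb{R}^n : Az=b,\ Bz\le d\}$ be a polyhedron with integer matrices $A$, $B$ and real right-hand sides. A *circuit* is a vector $g\in\ker(A)\setminus\{0\}$ with coprime integer components such that $Bg$ is support-minimal in $\{Bz : z\in\ker(A)\setminus\{0\}\}$. For vertices $u,v$ of $P$, a *circuit walk* of length $\ell$ from $u$ to $v$ is a sequence $u=y^{(0)},\dots,y^{(\ell)}=v$ with $y^{(i+1)}-y^{(i)}=\alpha_i g^i$ for circuits $g^i$ and reals $\alpha_i>0$. It may have the following properties: (e) *edge walk*: all $y^{(i)},y^{(i+1)}$ are neighboring vertices of $P$, i.e. joined by an edge; (f) *feasible*: all $y^{(i)}\in P$; (m) *maximal*: $y^{(i)}+\alpha g^i\notin P$ for all $i$ and all $\alpha>\alpha_i$; (r) *non-repetitive*: no circuit is used twice; (b) *non-backwards*: no pair $g,-g$ of circuits is used; (s) *sign-compatible*: the circuits used are pairwise sign-compatible and sign-compatible with $v-u$, where $x,y$ are sign-compatible if $(Bx)_i(By)_i\ge 0$ for all $i$. For a set of these letters as subscript, $\mathcal{CD}_{\ldots}(u,v)$ denotes the minimum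 length of a circuit walk from $u$ to $v$ with these properties ($\infty$ if there is none), and $\mathcal{CD}$ is the distance without restrictions. In (2) and (4), polygons are given without equations and with exactly one inequality for each edge. **Theorem.** Let $n=2$. (1) *(Hierarchy.)* For every polyhedron in $\mathbb{R}^2$ and every pair of distinct vertices, $$\mathcal{CD}_{efm}=\mathcal{CD}_{efmr},\qquad \mathcal{CD}_{f}=\mathcal{CD}_{fr}=\mathcal{CD}_{fb}=\mathcal{CD}_{fbr}=\mathcal{CD}_{fs}=\mathcal{CD}\in\{1,2\},$$ and $$\mathcal{CD}_{efmb}\ge\mathcal{CD}_{efm},\quad \mathcal{CD}_{efmb}\ge\mathcal{CD}_{fmb},\quad \mathcal{CD}_{efm}\ge\mathcal{CD}_{fm},\quad \mathcal{CD}_{efm}\ge\mathcal{CD}_{fmr},\quad \mathcal{CD}_{fmb}\ge\mathcal{CD}_{fm},\quad \mathcal{CD}_{fmr}\ge\mathcal{CD}_{fm},\quad \mathcal{CD}_{fm}\ge\mathcal{CD}.$$ (2) *(Strictness.)* For each of the seven inequalities in the last display there is a polygon with a pair of distinct vertices for which it is strict. (3) *(Ranges.)* For every polygon on $k$ vertices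 (two-dimensional and bounded, with any description as above) and every pair of distinct vertices, $$\mathcal{CD}_{efmb}\in\{1,\dots,k-3\}\ (k\ge 5),\qquad \mathcal{CD}_{efm},\ \mathcal{CD}_{fm},\ \mathcal{CD}_{fmb},\ \mathcal{CD}_{fmr},\ \mathcal{CD}_{fmbr}\in\{1,\dots,\lfloor k/2\rfloor\}.$$ (4) *(Maxima are attained.)* For every $k\ge5$ there is a polygon on $k$ vertices with a pair of vertices such that $\mathcal{CD}_{efmb}=k-3$. For every $k\ge3$ there is a polygon on $k$ vertices with a pair of distinct vertices such that $\mathcal{CD}_{efm}=\mathcal{CD}_{fm}=\mathcal{CD}_{fmb}=\mathcal{CD}_{fmr}=\mathcal{CD}_{fmbr}=\lfloor k/2\rfloor$. For every $k\ge4$ there is a polygon on $k$ vertices with a pair of vertices such that $\mathcal{CD}=2$. -/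

import Mathlib

open scoped Matrix

/-- A polyhedron `{z ∈ ℝⁿ : A z = b, B z ≤ d}` given by integer matrices `A`, `B` and real
right-hand sides `b`, `d`. -/
structure HPolyhedron (n : ℕ) where
  mA : ℕ
  mB : ℕ
  A : Matrix (Fin mA) (Fin n) ℤ
  B : Matrix (Fin mB) (Fin n) ℤ
  b : Fin mA → ℝ
  d : Fin mB → ℝ

namespace HPolyhedron

variable {n : ℕ}

/-- The vector `A z`. -/
def eqs (Q : HPolyhedron n) (z : Fin n → ℝ) : Fin Q.mA → ℝ :=
  (Q.A.map (fun t : ℤ => (t : ℝ))) *ᵥ z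

/-- The vector `B z`. -/
def ineqs (Q : HPolyhedron n) (z : Fin n → ℝ) : Fin Q.mB → ℝ :=
  (Q.B.map (fun t : ℤ => (t : ℝ))) *ᵥ z

/-- The point set of the polyhedron. -/
def carrier (Q : HPolyhedron n) : Set (Fin n → ℝ) :=
  {z | Q.eqs z = Q.b ∧ ∀ i, Q.ineqs z i ≤ Q.d i}

/-- The vertices (zero-dimensional faces). -/
def vertices (Q : HPolyhedron n) : Set (Fin n → ℝ) :=
  Q.carrier.extremePoints ℝ

/-- Two vertices are neighbors if they are distinct and the segment between them is a face,
that is, an edge. -/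
def Neighbors (Q : HPolyhedron n) (x y : Fin n → ℝ) : Prop :=
  x ∈ Q.vertices ∧ y ∈ Q.vertices ∧ x ≠ y ∧ IsExtreme ℝ Q.carrier (segment ℝ x y)

/-- An integer vector seen as a real vector. -/
def toReal (g : Fin n → ℤ) : Fin n → ℝ := fun i => (g i : ℝ)

/-- Circuits: nonzero vectors `g ∈ ker A` with coprime integer components such that `B g` is
support-minimal in `{B z : z ∈ ker A \ {0}}`. -/
def IsCircuit (Q : HPolyhedron n) (g : Fin n → ℤ) : Prop :=
  Q.eqs (toReal g) = 0 ∧ g ≠ 0 ∧ Finset.univ.gcd g = 1 ∧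
    ∀ z : Fin n → ℝ, Q.eqs z = 0 → z ≠ 0 →
      Function.support (Q.ineqs z) ⊆ Function.support (Q.ineqs (toReal g)) →
      Function.support (Q.ineqs z) = Function.support (Q.ineqs (toReal g))

/-- `x` and `y` are sign-compatible with respect to `B`. -/
def SignCompatible (Q : HPolyhedron n) (x y : Fin n → ℝ) : Prop :=
  ∀ i, 0 ≤ Q.ineqs x i * Q.ineqs y i

/-- A circuit walk `u = y 0, y 1, …, y length = v`, where `y (i+1) - y i = α i • g i` for a
circuit `g i` and `α i > 0`. -/
structure CircuitWalk (Q : HPolyhedron n) (u v : Fin n → ℝ) where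
  length : ℕ
  y : Fin (length + 1) → Fin n → ℝ
  g : Fin length → Fin n → ℤ
  α : Fin length → ℝ
  start_eq : y 0 = u
  end_eq : y (Fin.last length) = v
  circuit : ∀ i, Q.IsCircuit (g i)
  α_pos : ∀ i, 0 < α i
  step : ∀ i : Fin length, y i.succ - y i.castSucc = α i • toReal (g i)

namespace CircuitWalk

variable {Q : HPolyhedron n} {u v : Fin n → ℝ}

/-- (e) edge walk -/
def IsEdge (W : CircuitWalk Q u v) : Prop :=
  ∀ i : Fin W.length, Q.Neighbors (W.y i.castSucc) (W.y i.succ)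

/-- (f) feasible -/
def IsFeasible (W : CircuitWalk Q u v) : Prop :=
  ∀ i : Fin W.length, W.y i.castSucc ∈ Q.carrier

/-- (m) maximal -/
def IsMaximal (W : CircuitWalk Q u v) : Prop :=
  ∀ i : Fin W.length, ∀ a : ℝ, W.α i < a → W.y i.castSucc + a • toReal (W.g i) ∉ Q.carrier

/-- (r) non-repetitive -/
def NonRepetitive (W : CircuitWalk Q u v) : Prop :=
  ∀ i j : Fin W.length, i ≠ j → W.g i ≠ W.g j

/-- (b) non-backwards -/
def NonBackwards (W : CircuitWalk Q u v) : Prop :=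
  ∀ i j : Fin W.length, W.g i ≠ -W.g j

/-- (s) sign-compatible -/
def IsSignCompatible (W : CircuitWalk Q u v) : Prop :=
  (∀ i j : Fin W.length, Q.SignCompatible (toReal (W.g i)) (toReal (W.g j))) ∧
    ∀ i : Fin W.length, Q.SignCompatible (toReal (W.g i)) (v - u)

end CircuitWalk

/-- The minimum length of a circuit walk from `u` to `v` with the property `p`
(it is `⊤` if there is no such walk). -/
noncomputable def circuitDist (Q : HPolyhedron n) (u v : Fin n → ℝ)
    (p : CircuitWalk Q u v → Prop) : ℕ∞ :=
  ⨅ (W : CircuitWalk Q u v) (_ : p W), (W.length : ℕ∞)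

/-- soft circuit distance -/
noncomputable def CD (Q : HPolyhedron n) (u v : Fin n → ℝ) : ℕ∞ :=
  Q.circuitDist u v fun _ => True

/-- weak circuit distance -/
noncomputable def CDf (Q : HPolyhedron n) (u v : Fin n → ℝ) : ℕ∞ :=
  Q.circuitDist u v fun W => W.IsFeasible

noncomputable def CDfb (Q : HPolyhedron n) (u v : Fin n → ℝ) : ℕ∞ :=
  Q.circuitDist u v fun W => W.IsFeasible ∧ W.NonBackwards

noncomputable def CDfr (Q : HPolyhedron n) (u v : Fin n → ℝ) : ℕ∞ :=
  Q.circuitDist u v fun W => W.IsFeasible ∧ W.NonRepetitive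

noncomputable def CDfbr (Q : HPolyhedron n) (u v : Fin n → ℝ) : ℕ∞ :=
  Q.circuitDist u v fun W => W.IsFeasible ∧ W.NonBackwards ∧ W.NonRepetitive

noncomputable def CDfs (Q : HPolyhedron n) (u v : Fin n → ℝ) : ℕ∞ :=
  Q.circuitDist u v fun W => W.IsFeasible ∧ W.IsSignCompatible

noncomputable def CDfm (Q : HPolyhedron n) (u v : Fin n → ℝ) : ℕ∞ :=
  Q.circuitDist u v fun W => W.IsFeasible ∧ W.IsMaximal

noncomputable def CDfmb (Q : HPolyhedron n) (u v : Fin n → ℝ) : ℕ∞ :=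
  Q.circuitDist u v fun W => W.IsFeasible ∧ W.IsMaximal ∧ W.NonBackwards

noncomputable def CDfmr (Q : HPolyhedron n) (u v : Fin n → ℝ) : ℕ∞ :=
  Q.circuitDist u v fun W => W.IsFeasible ∧ W.IsMaximal ∧ W.NonRepetitive

noncomputable def CDfmbr (Q : HPolyhedron n) (u v : Fin n → ℝ) : ℕ∞ :=
  Q.circuitDist u v fun W =>
    W.IsFeasible ∧ W.IsMaximal ∧ W.NonBackwards ∧ W.NonRepetitive

/-- graph distance -/
noncomputable def CDefm (Q : HPolyhedron n) (u v : Fin n → ℝ) : ℕ∞ :=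
  Q.circuitDist u v fun W => W.IsEdge ∧ W.IsFeasible ∧ W.IsMaximal

noncomputable def CDefmb (Q : HPolyhedron n) (u v : Fin n → ℝ) : ℕ∞ :=
  Q.circuitDist u v fun W => W.IsEdge ∧ W.IsFeasible ∧ W.IsMaximal ∧ W.NonBackwards

noncomputable def CDefmr (Q : HPolyhedron n) (u v : Fin n → ℝ) : ℕ∞ :=
  Q.circuitDist u v fun W => W.IsEdge ∧ W.IsFeasible ∧ W.IsMaximal ∧ W.NonRepetitive

/-- A (two-dimensional, bounded) polygon on `k` vertices. The description may contain
redundant constraints. -/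
def IsPolygon (Q : HPolyhedron 2) (k : ℕ) : Prop :=
  Bornology.IsBounded Q.carrier ∧ (interior Q.carrier).Nonempty ∧ Q.vertices.ncard = k

/-- A polygon on `k` vertices that is described without equations by exactly `k` inequalities,
so that every inequality defines an edge and the circuits are exactly the primitive
directions (both signs) of the edges. -/
def IsIrredundantPolygon (Q : HPolyhedron 2) (k : ℕ) : Prop :=
  Q.IsPolygon k ∧ Q.mA = 0 ∧ Q.mB = k

end HPolyhedron

/-!
# Circuit distances in the plane

In the plane the kernel of a nonzero row is a line, so (as soon as the polyhedron has a vertex) the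
circuits are exactly the primitive integer vectors that are orthogonal to some nonzero row:
`isCircuit_of_aligned`, `IsCircuit.aligned`. Every edge direction is one of them
(`Neighbors.aligned`).

**Hierarchy.** The vectors sign-compatible with `v - u` form a pointed cone of dimension at most
two, so `v - u` is a circuit direction or a sum of two sign-compatible ones
(`exists_conformal_decomposition`). The resulting walk of length at most two is feasible,
sign-compatible, non-backwards and non-repetitive, and a single step from vertex to vertex has all
properties except perhaps that of being an edge walk; hence all these distances collapse
(`circuitDist_eq_CD`). A shortest edge walk visits no vertex twice, and an edge path using two edges
in the same direction would have to cross the segment between the midpoints of these edges, which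
is impossible (`edge_path_directions`); this gives `CDefm_eq_CDefmr`. The inequalities compare
distances with more and with fewer conditions.

**Ranges.** A polygon on `k` vertices has two edge chains between `u` and `v`, one on each side of
the line through them, with `k` edges in total (`IsChain`, `ncard_sides`); the shorter one has at
most `k / 2` edges. A chain is non-backwards if a linear function is strictly smallest at its start
and largest at its end among its vertices, and this can be arranged for one of the two chains, which
gives the bound `k - 3` (`CDefmb_le`). For the other distances one follows the shorter chain
where it is non-backwards; where it is not, a first maximal step parallel to the edge at `v` on the
other side cuts off enough of the polygon that the rest of the chain is non-backwards and no longer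
than before (`exists_fmbr_walk`).

**Sharpness.** Explicit polygons are given by cyclic lists of edges (`PolygonData`). The bowl is a
polygon whose chain from `(0, 0)` to `(m, 0)` over the top uses both `(0, 1)` and `(0, -1)`, so that
a non-backwards edge walk needs all `k - 3` edges at the bottom, while the straight step between
the two vertices is a circuit step. For the value `k / 2`, the lowest vertex of a polygon is
repeatedly cut off by two edges that meet just above it (`eventually_exists_cut`). Only finitely
many points are reached from `u` by a given number of maximal steps, and small cuts do not disturb
the walks that stay away from the vertex cut off; as the apex moves it avoids all lines of
non-vertical circuit directions through these points. So each cut costs two vertices and one further step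
(`eventually_apex_notMem_reach`, `exists_polygon_notMem_reach`). Starting from a triangle or a
quadrilateral this reaches `k / 2`, and it also gives pairs with `CD = 2`, and pairs with
`CD < CDfm`.

The remaining strict inequalities come from two such cuts on suitable polygons with a vertical edge:
the new lowest vertex is then reached in three steps only by a walk that is vertical in its first
and its last step. On the trapezoid both steps go down, so the short walks are repetitive; on the
hexagon the first one goes up and the last one goes down, so they are backwards.
-/

namespace HPolyhedron

variable {Q : HPolyhedron 2}

/-! ### Linear algebra in the plane -/

theorem ineqs_apply (Q : HPolyhedron 2) (z : Fin 2 → ℝ) (i : Fin Q.mB) :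
    Q.ineqs z i = (Q.B i 0 : ℝ) * z 0 + (Q.B i 1 : ℝ) * z 1 := by
  simp [ineqs, Matrix.mulVec, dotProduct, Fin.sum_univ_two]

theorem eqs_apply (Q : HPolyhedron 2) (z : Fin 2 → ℝ) (i : Fin Q.mA) :
    Q.eqs z i = (Q.A i 0 : ℝ) * z 0 + (Q.A i 1 : ℝ) * z 1 := by
  simp [eqs, Matrix.mulVec, dotProduct, Fin.sum_univ_two]

theorem plane_ext {x y : Fin 2 → ℝ} (h0 : x 0 = y 0) (h1 : x 1 = y 1) : x = y := by
  funext i; fin_cases i <;> simpa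

/-- Two vectors orthogonal to the same nonzero vector of the plane are parallel. -/
theorem exists_smul_of_orthogonal {a b : ℝ} (hab : a ≠ 0 ∨ b ≠ 0) {x y : Fin 2 → ℝ}
    (hx : x ≠ 0) (h1 : a * x 0 + b * x 1 = 0) (h2 : a * y 0 + b * y 1 = 0) :
    ∃ c : ℝ, y = c • x := by
  have hdet : x 0 * y 1 = x 1 * y 0 := by
    rcases hab with h | h
    · apply mul_left_cancel₀ h; linear_combination y 1 * h1 - x 1 * h2
    · apply mul_left_cancel₀ h; linear_combination x 0 * h2 - y 0 * h1
  by_cases h0 : x 0 = 0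
  · have h1' : x 1 ≠ 0 := fun h => hx (plane_ext h0 h)
    refine ⟨y 1 / x 1, plane_ext ?_ ?_⟩
    · simp only [Pi.smul_apply, smul_eq_mul]
      have : x 1 * y 0 = 0 := by rw [← hdet, h0, zero_mul]
      rcases mul_eq_zero.1 this with h | h
      · exact absurd h h1'
      · rw [h, h0, mul_zero]
    · simp only [Pi.smul_apply, smul_eq_mul]; field_simp
  · refine ⟨y 0 / x 0, plane_ext ?_ ?_⟩
    · simp only [Pi.smul_apply, smul_eq_mul]; field_simp
    · simp only [Pi.smul_apply, smul_eq_mul]; field_simp; linarith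

theorem univ_gcd_fin_two (g : Fin 2 → ℤ) : Finset.univ.gcd g = gcd (g 0) (g 1) := by
  have : (Finset.univ : Finset (Fin 2)) = {0, 1} := rfl
  rw [this, Finset.gcd_insert, Finset.gcd_singleton]
  apply dvd_antisymm_of_normalize_eq
  · simp
  · simp
  · exact gcd_dvd_gcd dvd_rfl (by simp)
  · exact gcd_dvd_gcd dvd_rfl (by simp)

theorem univ_gcd_eq_one_iff (g : Fin 2 → ℤ) :
    Finset.univ.gcd g = 1 ↔ IsCoprime (g 0) (g 1) := by
  rw [univ_gcd_fin_two, Int.isCoprime_iff_gcd_eq_one, ← Int.coe_gcd]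
  exact_mod_cast Iff.rfl

theorem toReal_neg (g : Fin 2 → ℤ) : toReal (-g) = -toReal g := by
  funext i; simp [toReal]

theorem toReal_ne_zero {g : Fin 2 → ℤ} (hg : g ≠ 0) : toReal g ≠ 0 := by
  intro h; apply hg; funext i
  have := congrFun h i
  simpa [toReal] using this

/-- Every nonzero integer vector of the plane has a primitive integer vector orthogonal to it. -/
theorem exists_primitive_orthogonal {a b : ℤ} (hab : a ≠ 0 ∨ b ≠ 0) :
    ∃ g : Fin 2 → ℤ, g ≠ 0 ∧ Finset.univ.gcd g = 1 ∧ a * g 0 + b * g 1 = 0 := by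
  have hd : gcd b a ≠ 0 := by
    intro h
    rw [gcd_eq_zero_iff] at h
    omega
  obtain ⟨x, hx⟩ := gcd_dvd_left b a
  obtain ⟨y, hy⟩ := gcd_dvd_right b a
  have hxy : gcd x y = 1 := by
    have h := gcd_mul_left (gcd b a) x y
    rw [← hx, ← hy, normalize_gcd] at h
    exact (mul_left_cancel₀ hd (by rw [mul_one]; exact h)).symm
  have hg : gcd (-x) y = 1 := by
    rw [← hxy]
    apply dvd_antisymm_of_normalize_eq
    · simp
    · simp
    · exact gcd_dvd_gcd (by simp) dvd_rfl
    · exact gcd_dvd_gcd (by simp) dvd_rfl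
  refine ⟨![-x, y], ?_, ?_, ?_⟩
  · intro h
    have h0 := congrFun h 0
    have h1 := congrFun h 1
    simp at h0 h1
    simp [h0, h1] at hxy
  · rw [univ_gcd_fin_two]; simpa using hg
  · simp only [Matrix.cons_val_zero, Matrix.cons_val_one]
    rw [mul_comm a, mul_comm b]
    linear_combination -x * hy + y * hx

/-- Primitive integer vectors on the same open ray coincide. -/
theorem primitive_eq_of_smul_eq {g h : Fin 2 → ℤ} (hg : Finset.univ.gcd g = 1)
    (hh : Finset.univ.gcd h = 1) {α β : ℝ} (hα : 0 < α) (hβ : 0 < β)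
    (H : α • toReal g = β • toReal h) : g = h := by
  rw [univ_gcd_eq_one_iff] at hg hh
  have e0 : α * g 0 = β * h 0 := by simpa [toReal] using congrFun H 0
  have e1 : α * g 1 = β * h 1 := by simpa [toReal] using congrFun H 1
  have hdet : g 0 * h 1 = g 1 * h 0 := by
    have : (g 0 : ℝ) * h 1 = g 1 * h 0 := by
      apply mul_left_cancel₀ hα.ne'
      apply mul_left_cancel₀ hβ.ne'
      linear_combination β * h 1 * e0 - β * h 0 * e1
    exact_mod_cast this
  have a0 : g 0 ∣ h 0 := hg.dvd_of_dvd_mul_left (Dvd.intro _ hdet)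
  have b0 : h 0 ∣ g 0 := hh.dvd_of_dvd_mul_right (Dvd.intro_left _ hdet.symm)
  have a1 : g 1 ∣ h 1 := hg.symm.dvd_of_dvd_mul_left (Dvd.intro _ hdet.symm)
  have b1 : h 1 ∣ g 1 := hh.symm.dvd_of_dvd_mul_right (Dvd.intro_left _ hdet)
  have key : ∀ x y : ℤ, x ∣ y → y ∣ x → α * x = β * y → x = y := by
    intro x y hxy hyx e
    rcases Int.natAbs_eq_natAbs_iff.1 (Int.natAbs_eq_of_dvd_dvd hxy hyx) with h | h
    · exact h
    · subst h
      have : (α + β) * (y : ℝ) = 0 := by push_cast at e; linarith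
      rcases mul_eq_zero.1 this with h | h
      · linarith
      · have : y = 0 := by exact_mod_cast h
        simp [this]
  funext i
  fin_cases i
  · exact key _ _ a0 b0 e0
  · exact key _ _ a1 b1 e1

/-! ### Circuits in the plane -/

section circuits

theorem ineqs_add (z w : Fin 2 → ℝ) (i : Fin Q.mB) :
    Q.ineqs (z + w) i = Q.ineqs z i + Q.ineqs w i := by
  simp only [ineqs_apply, Pi.add_apply]; ring

theorem ineqs_sub (z w : Fin 2 → ℝ) (i : Fin Q.mB) :
    Q.ineqs (z - w) i = Q.ineqs z i - Q.ineqs w i := by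
  simp only [ineqs_apply, Pi.sub_apply]; ring

theorem ineqs_smul (c : ℝ) (z : Fin 2 → ℝ) (i : Fin Q.mB) :
    Q.ineqs (c • z) i = c * Q.ineqs z i := by
  simp only [ineqs_apply, Pi.smul_apply, smul_eq_mul]; ring

theorem eqs_add (z w : Fin 2 → ℝ) : Q.eqs (z + w) = Q.eqs z + Q.eqs w := by
  funext i; simp only [eqs_apply, Pi.add_apply]; ring

theorem eqs_sub (z w : Fin 2 → ℝ) : Q.eqs (z - w) = Q.eqs z - Q.eqs w := by
  funext i; simp only [eqs_apply, Pi.sub_apply]; ring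

theorem eqs_smul (c : ℝ) (z : Fin 2 → ℝ) : Q.eqs (c • z) = c • Q.eqs z := by
  funext i; simp only [eqs_apply, Pi.smul_apply, smul_eq_mul]; ring

/-- A nonzero vector of `ker A` is *aligned* if it is orthogonal to some nonzero row of `A` or
of `B`; the directions of the circuits are exactly the aligned vectors of integer direction. -/
def Aligned (Q : HPolyhedron 2) (z : Fin 2 → ℝ) : Prop :=
  Q.eqs z = 0 ∧ ((∃ i, Q.A i 0 ≠ 0 ∨ Q.A i 1 ≠ 0) ∨
    ∃ i, (Q.B i 0 ≠ 0 ∨ Q.B i 1 ≠ 0) ∧ Q.ineqs z i = 0)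

theorem Aligned.smul {z : Fin 2 → ℝ} (h : Q.Aligned z) (c : ℝ) : Q.Aligned (c • z) := by
  refine ⟨by rw [eqs_smul, h.1, smul_zero], h.2.imp id ?_⟩
  rintro ⟨i, hi, h0⟩
  exact ⟨i, hi, by rw [ineqs_smul, h0, mul_zero]⟩

theorem Aligned.neg {z : Fin 2 → ℝ} (h : Q.Aligned z) : Q.Aligned (-z) := by
  simpa using h.smul (-1)

theorem isCircuit_of_aligned {g : Fin 2 → ℤ} (hg : Finset.univ.gcd g = 1)
    (h : Q.Aligned (toReal g)) : Q.IsCircuit g := by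
  have hne : g ≠ 0 := by
    rintro rfl
    simp [univ_gcd_fin_two] at hg
  refine ⟨h.1, hne, hg, fun z hz hz0 hsupp => ?_⟩
  have key : ∃ c : ℝ, z = c • toReal g := by
    rcases h.2 with ⟨i, hi⟩ | ⟨i, hi, h0⟩
    · have h1 := congrFun h.1 i
      have h2 := congrFun hz i
      rw [eqs_apply] at h1 h2
      exact exists_smul_of_orthogonal (by exact_mod_cast hi) (toReal_ne_zero hne) h1 h2
    · have h2 : Q.ineqs z i = 0 := by
        by_contra hc
        exact hsupp (Function.mem_support.2 hc) h0
      rw [ineqs_apply] at h0 h2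
      exact exists_smul_of_orthogonal (by exact_mod_cast hi) (toReal_ne_zero hne) h0 h2
  obtain ⟨c, rfl⟩ := key
  have hc : c ≠ 0 := by rintro rfl; simp at hz0
  ext i
  simp [ineqs_smul, hc]

/-- The direction of an aligned vector is a circuit. -/
theorem Aligned.exists_isCircuit {z : Fin 2 → ℝ} (h : Q.Aligned z) (hz : z ≠ 0) :
    ∃ (g : Fin 2 → ℤ) (α : ℝ), Q.IsCircuit g ∧ 0 < α ∧ z = α • toReal g := by
  have key : ∃ g : Fin 2 → ℤ, g ≠ 0 ∧ Finset.univ.gcd g = 1 ∧ ∃ c : ℝ, z = c • toReal g := by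
    rcases h.2 with ⟨i, hi⟩ | ⟨i, hi, h0⟩
    · obtain ⟨g, hg0, hg, ho⟩ := exists_primitive_orthogonal hi
      refine ⟨g, hg0, hg, exists_smul_of_orthogonal (a := Q.A i 0) (b := Q.A i 1)
        (by exact_mod_cast hi) (toReal_ne_zero hg0) (by simp only [toReal]; exact_mod_cast ho) ?_⟩
      rw [← eqs_apply, h.1]; rfl
    · obtain ⟨g, hg0, hg, ho⟩ := exists_primitive_orthogonal hi
      refine ⟨g, hg0, hg, exists_smul_of_orthogonal (a := Q.B i 0) (b := Q.B i 1)
        (by exact_mod_cast hi) (toReal_ne_zero hg0) (by simp only [toReal]; exact_mod_cast ho) ?_⟩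
      rw [← ineqs_apply, h0]
  obtain ⟨g, hg0, hg, c, rfl⟩ := key
  have hc : c ≠ 0 := by rintro rfl; simp at hz
  have hgal : Q.Aligned (toReal g) := by
    have := h.smul c⁻¹
    rwa [smul_smul, inv_mul_cancel₀ hc, one_smul] at this
  rcases lt_or_gt_of_ne hc with hneg | hpos
  · refine ⟨-g, -c, isCircuit_of_aligned ?_ ?_, by linarith, by simp [toReal_neg]⟩
    · rw [univ_gcd_eq_one_iff] at hg ⊢
      exact (IsCoprime.neg_neg_iff _ _).2 hg
    · rw [toReal_neg]; exact hgal.neg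
  · exact ⟨g, c, isCircuit_of_aligned hg hgal, hpos, rfl⟩

/-- The converse of `isCircuit_of_aligned`, valid as soon as some row is nonzero. -/
theorem IsCircuit.aligned {g : Fin 2 → ℤ} (hg : Q.IsCircuit g)
    (hrow : ∃ i, Q.B i 0 ≠ 0 ∨ Q.B i 1 ≠ 0) : Q.Aligned (toReal g) := by
  obtain ⟨h0, hne, hgcd, hmin⟩ := hg
  refine ⟨h0, ?_⟩
  by_contra hcon
  push Not at hcon
  obtain ⟨hA, hB⟩ := hcon
  obtain ⟨i, hi⟩ := hrow
  -- A vector orthogonal to the nonzero row `i` has smaller support than `g`.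
  set z : Fin 2 → ℝ := ![-(Q.B i 1 : ℝ), Q.B i 0] with hz
  have hz0 : Q.ineqs z i = 0 := by rw [ineqs_apply]; simp [hz]; ring
  have hzne : z ≠ 0 := by
    intro h
    have a := congrFun h 0
    have b := congrFun h 1
    simp [hz] at a b
    omega
  have hzA : Q.eqs z = 0 := by
    funext j; rw [eqs_apply]; simp [(hA j).1, (hA j).2]
  have hs := hmin z hzA hzne (by
    intro j hj
    have : Q.B j 0 ≠ 0 ∨ Q.B j 1 ≠ 0 := by
      by_contra hc
      push Not at hc
      apply hj
      simp [ineqs_apply, hc.1, hc.2]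
    exact hB j this)
  have : i ∈ Function.support (Q.ineqs z) := by
    rw [hs]; exact hB i hi
  exact this hz0

end circuits

/-! ### The carrier and its extreme points -/

section carrier

theorem convex_carrier (Q : HPolyhedron 2) : Convex ℝ Q.carrier := by
  intro x hx y hy a b ha hb hab
  refine ⟨?_, fun i => ?_⟩
  · rw [eqs_add, eqs_smul, eqs_smul, hx.1, hy.1, ← add_smul, hab, one_smul]
  · rw [ineqs_add, ineqs_smul, ineqs_smul]
    have h1 := mul_le_mul_of_nonneg_left (hx.2 i) ha
    have h2 := mul_le_mul_of_nonneg_left (hy.2 i) hb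
    calc _ ≤ a * Q.d i + b * Q.d i := add_le_add h1 h2
      _ = Q.d i := by rw [← add_mul, hab, one_mul]

theorem isClosed_carrier (Q : HPolyhedron 2) : IsClosed Q.carrier := by
  have h1 : Continuous Q.eqs := by unfold eqs; fun_prop
  have h2 : Continuous Q.ineqs := by unfold ineqs; fun_prop
  have : Q.carrier = {z | Q.eqs z = Q.b} ∩ ⋂ i, {z | Q.ineqs z i ≤ Q.d i} := by
    ext z; simp [carrier]
  rw [this]
  refine (isClosed_eq h1 continuous_const).inter (isClosed_iInter fun i => ?_)
  exact isClosed_le ((continuous_apply i).comp h2) continuous_const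

theorem eq_zero_of_mem_extremePoints {P : Set (Fin 2 → ℝ)} {v w : Fin 2 → ℝ}
    (hv : v ∈ P.extremePoints ℝ) {s t : ℝ} (hs : 0 < s) (ht : 0 < t)
    (h1 : v + s • w ∈ P) (h2 : v - t • w ∈ P) : w = 0 := by
  have hmem : v ∈ openSegment ℝ (v + s • w) (v - t • w) := by
    refine ⟨t / (s + t), s / (s + t), by positivity, by positivity, by field_simp; ring, ?_⟩
    apply plane_ext <;>
    · simp only [Pi.add_apply, Pi.smul_apply, Pi.sub_apply, smul_eq_mul]; field_simp; ring
  have h := (mem_extremePoints.1 hv).2 _ h1 _ h2 hmem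
  have h3 : s • w = 0 := by simpa using h.1
  exact (smul_eq_zero.1 h3).resolve_left hs.ne'

/-- A step that ends in an extreme point cannot be prolonged. -/
theorem notMem_of_end_extreme {P : Set (Fin 2 → ℝ)} {x y d : Fin 2 → ℝ} {α a : ℝ}
    (hx : x ∈ P) (hy : y ∈ P.extremePoints ℝ) (hd : d ≠ 0) (hα : 0 < α) (hxy : y - x = α • d)
    (ha : α < a) : x + a • d ∉ P := by
  intro hmem
  apply hd
  refine eq_zero_of_mem_extremePoints hy (s := a - α) (t := α) (by linarith) hα ?_ ?_
  · have : y + (a - α) • d = x + a • d := by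
      rw [← sub_add_cancel y x, hxy, sub_smul]; abel
    rwa [this]
  · have : y - α • d = x := by rw [← hxy]; abel
    rwa [this]

/-- A direction along which no tight inequality increases is feasible for a while. -/
theorem feasible_near {Q : HPolyhedron 2} {x w : Fin 2 → ℝ} (hx : x ∈ Q.carrier)
    (hA : Q.eqs w = 0) (hB : ∀ i, Q.ineqs x i = Q.d i → Q.ineqs w i ≤ 0) :
    ∃ s : ℝ, 0 < s ∧ x + s • w ∈ Q.carrier := by
  have : ∀ i, ∀ᶠ s in nhdsWithin (0 : ℝ) (Set.Ioi 0), Q.ineqs (x + s • w) i ≤ Q.d i := by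
    intro i
    rcases (hx.2 i).eq_or_lt with h | h
    · filter_upwards [self_mem_nhdsWithin] with s hs
      rw [ineqs_add, ineqs_smul, h]
      have := mul_nonpos_of_nonneg_of_nonpos (le_of_lt hs) (hB i h)
      linarith
    · have hc : Filter.Tendsto (fun s : ℝ => Q.ineqs x i + s * Q.ineqs w i)
          (nhdsWithin 0 (Set.Ioi 0)) (nhds (Q.ineqs x i + 0 * Q.ineqs w i)) :=
        (Continuous.tendsto (by fun_prop) 0).mono_left nhdsWithin_le_nhds
      filter_upwards [hc.eventually_lt_const (by simpa using h)] with s hs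
      rw [ineqs_add, ineqs_smul]; exact hs.le
  obtain ⟨s, hs, hs0⟩ := ((Filter.eventually_all.2 this).and self_mem_nhdsWithin).exists
  refine ⟨s, hs0, ?_, hs⟩
  rw [eqs_add, eqs_smul, hA, smul_zero, add_zero, hx.1]

/-- Only the zero vector is orthogonal to all rows, if there is a vertex. -/
theorem eq_zero_of_rows_orthogonal {v w : Fin 2 → ℝ} (hv : v ∈ Q.vertices) (hA : Q.eqs w = 0)
    (hB : ∀ i, Q.ineqs v i = Q.d i → Q.ineqs w i = 0) : w = 0 := by
  obtain ⟨s, hs, hs'⟩ := feasible_near hv.1 hA (fun i hi => (hB i hi).le)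
  obtain ⟨t, ht, ht'⟩ := feasible_near (w := -w) hv.1
    (by rw [← neg_one_smul ℝ, eqs_smul, hA, smul_zero])
    (fun i hi => by rw [← neg_one_smul ℝ, ineqs_smul, hB i hi, mul_zero])
  refine eq_zero_of_mem_extremePoints hv hs ht hs' ?_
  rwa [smul_neg, ← sub_eq_add_neg] at ht'

theorem finite_vertices (Q : HPolyhedron 2) : Q.vertices.Finite := by
  classical
  -- A vertex is determined by the set of rows that are tight at it.
  refine Set.Finite.of_finite_image (f := fun v => {i | Q.ineqs v i = Q.d i}) (Set.toFinite _) ?_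
  intro v hv w hw hvw
  have hvw : {i | Q.ineqs v i = Q.d i} = {i | Q.ineqs w i = Q.d i} := hvw
  have : w - v = 0 := by
    refine eq_zero_of_rows_orthogonal hv (by rw [eqs_sub, hv.1.1, hw.1.1, sub_self]) ?_
    intro i hi
    have hi' : i ∈ {i | Q.ineqs w i = Q.d i} := hvw ▸ hi
    have hi'' : Q.ineqs w i = Q.d i := hi'
    rw [ineqs_sub, hi, hi'', sub_self]
  exact (sub_eq_zero.1 this).symm

/-- The direction of an edge is aligned: otherwise the midpoint of the edge could be moved
transversally to the edge inside the polyhedron. -/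
theorem Neighbors.aligned {x y : Fin 2 → ℝ} (h : Q.Neighbors x y) : Q.Aligned (y - x) := by
  obtain ⟨hx, hy, hne, hext⟩ := h
  have hA0 : Q.eqs (y - x) = 0 := by rw [eqs_sub, hx.1.1, hy.1.1, sub_self]
  refine ⟨hA0, ?_⟩
  by_contra hcon
  push Not at hcon
  obtain ⟨hA, hB⟩ := hcon
  set m : Fin 2 → ℝ := (1 / 2 : ℝ) • x + (1 / 2 : ℝ) • y with hm
  have hmseg : m ∈ segment ℝ x y := ⟨1 / 2, 1 / 2, by norm_num, by norm_num, by norm_num, rfl⟩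
  have hmP : m ∈ Q.carrier := hext.1 hmseg
  set p : Fin 2 → ℝ := ![-(y 1 - x 1), y 0 - x 0] with hp
  have htight : ∀ i, Q.ineqs m i = Q.d i → Q.B i 0 = 0 ∧ Q.B i 1 = 0 := by
    intro i hi
    by_contra hc
    have hc' : Q.B i 0 ≠ 0 ∨ Q.B i 1 ≠ 0 := by
      by_contra h'; push Not at h'; exact hc h'
    apply hB i hc'
    have h1 := hx.1.2 i
    have h2 := hy.1.2 i
    rw [hm, ineqs_add, ineqs_smul, ineqs_smul] at hi
    rw [ineqs_sub]
    linarith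
  have hz : ∀ w : Fin 2 → ℝ, Q.eqs w = 0 := by
    intro w; funext j; rw [eqs_apply]; simp [(hA j).1, (hA j).2]
  have hz' : ∀ w : Fin 2 → ℝ, ∀ i, Q.ineqs m i = Q.d i → Q.ineqs w i ≤ 0 := by
    intro w i hi; rw [ineqs_apply]; simp [(htight i hi).1, (htight i hi).2]
  obtain ⟨s, hs, hs'⟩ := feasible_near (w := p) hmP (hz _) (hz' _)
  obtain ⟨t, ht, ht'⟩ := feasible_near (w := -p) hmP (hz _) (hz' _)
  have hmo : m ∈ openSegment ℝ (m + s • p) (m + t • -p) := by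
    refine ⟨t / (s + t), s / (s + t), by positivity, by positivity, by field_simp; ring, ?_⟩
    apply plane_ext <;>
    · simp only [Pi.add_apply, Pi.smul_apply, Pi.neg_apply, smul_eq_mul]; field_simp; ring
  have h1 := hext.2 hs' ht' hmseg hmo
  obtain ⟨a, b, ha, hb, hab, he⟩ := h1
  have e0 := congrFun he 0
  have e1 := congrFun he 1
  simp only [hm, hp, Pi.add_apply, Pi.smul_apply, smul_eq_mul, Matrix.cons_val_zero,
    Matrix.cons_val_one] at e0 e1
  have hb' : b = 1 - a := by linarith
  subst hb'
  have : s * ((y 0 - x 0) ^ 2 + (y 1 - x 1) ^ 2) = 0 := by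
    linear_combination (y 1 - x 1) * e0 - (y 0 - x 0) * e1
  have h2 : (y 0 - x 0) ^ 2 + (y 1 - x 1) ^ 2 = 0 := (mul_eq_zero.1 this).resolve_left hs.ne'
  apply hne
  apply plane_ext
  · nlinarith [sq_nonneg (y 0 - x 0), sq_nonneg (y 1 - x 1)]
  · nlinarith [sq_nonneg (y 0 - x 0), sq_nonneg (y 1 - x 1)]

theorem Neighbors.symm {x y : Fin 2 → ℝ} (h : Q.Neighbors x y) : Q.Neighbors y x :=
  ⟨h.2.1, h.1, h.2.2.1.symm, by rw [segment_symm]; exact h.2.2.2⟩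

end carrier

/-! ### Constructing and comparing circuit walks -/

theorem circuitDist_le {n : ℕ} {Q : HPolyhedron n} {u v : Fin n → ℝ}
    {p : CircuitWalk Q u v → Prop} (W : CircuitWalk Q u v) (hW : p W) :
    Q.circuitDist u v p ≤ W.length :=
  iInf₂_le W hW

theorem le_circuitDist {n : ℕ} {Q : HPolyhedron n} {u v : Fin n → ℝ}
    {p : CircuitWalk Q u v → Prop} {m : ℕ∞} (h : ∀ W : CircuitWalk Q u v, p W → m ≤ W.length) :
    m ≤ Q.circuitDist u v p :=
  le_iInf₂ h

theorem circuitDist_mono {n : ℕ} {Q : HPolyhedron n} {u v : Fin n → ℝ}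
    {p q : CircuitWalk Q u v → Prop} (h : ∀ W, p W → q W) :
    Q.circuitDist u v q ≤ Q.circuitDist u v p :=
  le_circuitDist fun W hW => circuitDist_le W (h W hW)

theorem CircuitWalk.y_eq_start {n : ℕ} {Q : HPolyhedron n} {u v : Fin n → ℝ}
    (W : CircuitWalk Q u v) {i : Fin (W.length + 1)} (hi : (i : ℕ) = 0) : W.y i = u := by
  have : i = 0 := Fin.ext hi
  exact this ▸ W.start_eq

theorem CircuitWalk.y_eq_end {n : ℕ} {Q : HPolyhedron n} {u v : Fin n → ℝ}
    (W : CircuitWalk Q u v) {i : Fin (W.length + 1)} (hi : (i : ℕ) = W.length) : W.y i = v := by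
  have : i = Fin.last _ := Fin.ext hi
  exact this ▸ W.end_eq

theorem CircuitWalk.length_pos {n : ℕ} {Q : HPolyhedron n} {u v : Fin n → ℝ} (huv : u ≠ v)
    (W : CircuitWalk Q u v) : 0 < W.length := by
  rcases Nat.eq_zero_or_pos W.length with h | h
  · exfalso; apply huv
    exact W.start_eq.symm.trans (W.y_eq_end (by simp [h]))
  · exact h

theorem one_le_circuitDist {n : ℕ} {Q : HPolyhedron n} {u v : Fin n → ℝ} (huv : u ≠ v)
    (p : CircuitWalk Q u v → Prop) : 1 ≤ Q.circuitDist u v p :=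
  le_circuitDist fun W _ => by exact_mod_cast W.length_pos huv

/-- The circuit walk along a sequence of points with prescribed directions and step lengths. -/
def CircuitWalk.ofSeq {n : ℕ} {Q : HPolyhedron n} {u v : Fin n → ℝ} (m : ℕ) (c : ℕ → Fin n → ℝ)
    (g : ℕ → Fin n → ℤ) (α : ℕ → ℝ) (h0 : c 0 = u) (hm : c m = v)
    (hg : ∀ i < m, Q.IsCircuit (g i)) (hα : ∀ i < m, 0 < α i)
    (hs : ∀ i < m, c (i + 1) - c i = α i • toReal (g i)) : CircuitWalk Q u v where
  length := m
  y i := c i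
  g i := g i
  α i := α i
  start_eq := by simpa using h0
  end_eq := by simpa using hm
  circuit i := hg i i.2
  α_pos i := hα i i.2
  step i := by simpa using hs i i.2

theorem IsCircuit.ne_neg {n : ℕ} {Q : HPolyhedron n} {g : Fin n → ℤ} (hg : Q.IsCircuit g) :
    g ≠ -g := by
  intro h
  apply hg.2.1
  funext i
  have := congrFun h i
  simp only [Pi.neg_apply] at this
  simp only [Pi.zero_apply]; omega

/-! ### Walks of length at most two -/

/-- If the difference of two vertices is the direction of a circuit, then the step along it is
a circuit walk with every property other than being an edge walk. -/
theorem circuitDist_le_one {u v : Fin 2 → ℝ} (hu : u ∈ Q.vertices) (hv : v ∈ Q.vertices)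
    (h : ∃ (g : Fin 2 → ℤ) (α : ℝ), Q.IsCircuit g ∧ 0 < α ∧ v - u = α • toReal g)
    (p : CircuitWalk Q u v → Prop)
    (hp : ∀ W : CircuitWalk Q u v, W.length = 1 → W.IsFeasible → W.IsMaximal → W.NonBackwards →
      W.NonRepetitive → W.IsSignCompatible → p W) : Q.circuitDist u v p ≤ 1 := by
  obtain ⟨g, α, hg, hα, hgv⟩ := h
  have hsub : ∀ i < 1, i = 0 := by omega
  let W : CircuitWalk Q u v := CircuitWalk.ofSeq 1 (fun i => if i = 0 then u else v)
    (fun _ => g) (fun _ => α) (by simp) (by simp) (fun _ _ => hg) (fun _ _ => hα)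
    (by intro i hi; obtain rfl := hsub i hi; simpa using hgv)
  have hi0 : ∀ i : Fin W.length, (i : ℕ) = 0 := fun i => hsub i i.2
  have hW : p W := by
    apply hp W rfl
    · intro i
      have : W.y i.castSucc = u := by
        change (if (i : ℕ) = 0 then u else v) = u
        rw [if_pos (hi0 i)]
      rw [this]; exact hu.1
    · intro i a ha
      have : W.y i.castSucc = u := by
        change (if (i : ℕ) = 0 then u else v) = u
        rw [if_pos (hi0 i)]
      rw [this]
      exact notMem_of_end_extreme hu.1 hv (toReal_ne_zero hg.2.1) hα hgv ha
    · intro i j; exact hg.ne_neg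
    · intro i j hij; exact absurd (Fin.ext ((hi0 i).trans (hi0 j).symm)) hij
    · refine ⟨fun i j k => mul_self_nonneg _, fun i k => ?_⟩
      change 0 ≤ Q.ineqs (toReal g) k * Q.ineqs (v - u) k
      rw [hgv, ineqs_smul]
      have := mul_nonneg hα.le (mul_self_nonneg (Q.ineqs (toReal g) k))
      linarith
  exact circuitDist_le W hW

/-- The conformal decomposition in the plane: `w` is a sum of two sign-compatible aligned
vectors, or aligned itself. The vectors sign-compatible with `w` form a pointed cone; cut it by
the line through `w` on which the sum of the normalized rows is constant and follow this line in
both directions until a row vanishes. -/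
theorem exists_conformal_decomposition {u w : Fin 2 → ℝ} (hu : u ∈ Q.vertices)
    (hw0 : w ≠ 0) (hw : Q.eqs w = 0) (hal : ¬ Q.Aligned w) :
    ∃ x y : Fin 2 → ℝ, w = x + y ∧ Q.Aligned x ∧ Q.Aligned y ∧ x ≠ 0 ∧ y ≠ 0 ∧
      ∀ i, 0 ≤ Q.ineqs x i * Q.ineqs y i := by
  classical
  have hal' := hal
  unfold Aligned at hal'
  push Not at hal'
  obtain ⟨hA, hB⟩ := hal' hw
  have hAz : ∀ z : Fin 2 → ℝ, Q.eqs z = 0 := by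
    intro z; funext j; rw [eqs_apply]; simp [(hA j).1, (hA j).2]
  -- `r i` is row `i` with the sign that makes it nonnegative on `w`
  set σ : Fin Q.mB → ℝ := fun i => Q.ineqs w i with hσ
  set r : Fin Q.mB → (Fin 2 → ℝ) → ℝ := fun i z => σ i * Q.ineqs z i with hr
  have radd : ∀ i x y, r i (x + y) = r i x + r i y := by
    intro i x y; simp only [hr, ineqs_add]; ring
  have rsmul : ∀ i (c : ℝ) x, r i (c • x) = c * r i x := by
    intro i c x; simp only [hr, ineqs_smul]; ring
  have hrow : ∀ i, (Q.B i 0 = 0 ∧ Q.B i 1 = 0) ∨ 0 < r i w := by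
    intro i
    by_cases h : Q.B i 0 ≠ 0 ∨ Q.B i 1 ≠ 0
    · right; exact mul_self_pos.2 (hB i h)
    · left; push Not at h; exact h
  have hzero : ∀ i, Q.B i 0 = 0 ∧ Q.B i 1 = 0 → ∀ z, Q.ineqs z i = 0 := by
    intro i hi z; rw [ineqs_apply]; simp [hi.1, hi.2]
  have hrw : ∀ i, 0 ≤ r i w := fun i => mul_self_nonneg _
  -- the direction `p` of the slice
  obtain ⟨p, hp0, hpsum⟩ : ∃ p : Fin 2 → ℝ, p ≠ 0 ∧ ∑ i, r i p = 0 := by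
    set a : ℝ := ∑ i, σ i * Q.B i 0
    set b : ℝ := ∑ i, σ i * Q.B i 1
    have hform : ∀ z : Fin 2 → ℝ, ∑ i, r i z = a * z 0 + b * z 1 := by
      intro z
      simp only [hr, ineqs_apply, a, b, Finset.sum_mul, ← Finset.sum_add_distrib]
      exact Finset.sum_congr rfl fun i _ => by ring
    by_cases hab : a = 0 ∧ b = 0
    · exact ⟨w, hw0, by rw [hform, hab.1, hab.2]; ring⟩
    · refine ⟨![-b, a], ?_, by rw [hform]; simp; ring⟩
      intro h
      apply hab
      have h0 := congrFun h 0
      have h1 := congrFun h 1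
      simp at h0 h1
      exact ⟨h1, h0⟩
  have hpne : ∃ i, r i p ≠ 0 := by
    by_contra hcon
    push Not at hcon
    apply hp0
    refine eq_zero_of_rows_orthogonal hu (hAz p) fun i _ => ?_
    rcases hrow i with h | h
    · exact hzero i h p
    · have hs : σ i ≠ 0 := by rintro h0; simp [hr, h0] at h
      exact (mul_eq_zero.1 (hcon i)).resolve_left hs
  -- following the slice in a direction in which some row decreases
  have key : ∀ q : Fin 2 → ℝ, (∃ i, r i q < 0) → ∃ t : ℝ, 0 < t ∧ (∀ i, 0 ≤ r i (w + t • q)) ∧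
      Q.Aligned (w + t • q) := by
    intro q hq
    set S : Finset (Fin Q.mB) := Finset.univ.filter fun i => r i q < 0 with hS
    have hSne : S.Nonempty := by
      obtain ⟨i, hi⟩ := hq
      exact ⟨i, by simp [hS, hi]⟩
    obtain ⟨i, hiS, hmin⟩ := S.exists_min_image (fun i => r i w / -(r i q)) hSne
    have hi : r i q < 0 := by simpa [hS] using hiS
    have hrwpos : 0 < r i w := by
      rcases hrow i with h | h
      · exfalso
        have : r i q = 0 := by simp [hr, hzero i h q]
        linarith
      · exact h
    refine ⟨r i w / -(r i q), div_pos hrwpos (by linarith), fun j => ?_, hAz _, Or.inr ⟨i, ?_, ?_⟩⟩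
    · rw [radd, rsmul]
      rcases lt_or_ge (r j q) 0 with hj | hj
      · have h1 := hmin j (by simp [hS, hj])
        rw [le_div_iff₀ (by linarith)] at h1
        linarith
      · have : 0 ≤ r i w / -(r i q) * r j q :=
          mul_nonneg (div_nonneg hrwpos.le (by linarith)) hj
        linarith [hrw j]
    · by_contra hc
      push Not at hc
      have : r i q = 0 := by simp [hr, hzero i hc q]
      linarith
    · have h1 : r i (w + (r i w / -(r i q)) • q) = 0 := by
        rw [radd, rsmul]
        have : r i q ≠ 0 := hi.ne
        field_simp; ring
      have hs : σ i ≠ 0 := by rintro h0; simp [hr, h0] at hi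
      exact (mul_eq_zero.1 h1).resolve_left hs
  have hneg : ∃ i, r i p < 0 := by
    by_contra hcon
    push Not at hcon
    obtain ⟨i, hi⟩ := hpne
    exact hi ((Finset.sum_eq_zero_iff_of_nonneg fun i _ => hcon i).1 hpsum i (Finset.mem_univ i))
  have hpos : ∃ i, r i (-p) < 0 := by
    by_contra hcon
    push Not at hcon
    have hnegp : ∀ i, r i (-p) = -r i p := by
      intro i
      rw [← neg_one_smul ℝ, rsmul]; ring
    obtain ⟨i, hi⟩ := hpne
    have hs : ∑ i, r i (-p) = 0 := by
      simp only [hnegp, Finset.sum_neg_distrib, hpsum, neg_zero]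
    have := (Finset.sum_eq_zero_iff_of_nonneg fun i _ => hcon i).1 hs i (Finset.mem_univ i)
    rw [hnegp] at this
    exact hi (by linarith)
  obtain ⟨s, hs, hs1, hs2⟩ := key p hneg
  obtain ⟨t, ht, ht1, ht2⟩ := key (-p) hpos
  have hsum : w = (t / (s + t)) • (w + s • p) + (s / (s + t)) • (w + t • -p) := by
    apply plane_ext <;>
    · simp only [Pi.add_apply, Pi.smul_apply, Pi.neg_apply, smul_eq_mul]; field_simp; ring
  refine ⟨_, _, hsum, hs2.smul _, ht2.smul _, ?_, ?_, ?_⟩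
  · intro h0
    apply hal
    rw [h0, zero_add] at hsum
    rw [hsum]; exact ht2.smul _
  · intro h0
    apply hal
    rw [h0, add_zero] at hsum
    rw [hsum]; exact hs2.smul _
  · intro i
    rcases hrow i with h | h
    · rw [hzero i h, zero_mul]
    · have hσi : 0 < σ i ^ 2 := by
        have : r i w = σ i ^ 2 := by simp only [hr, hσ]; ring
        rwa [this] at h
      have h1 := mul_nonneg (hs1 i) (ht1 i)
      have h2 : r i (w + s • p) * r i (w + t • -p) =
          σ i ^ 2 * (Q.ineqs (w + s • p) i * Q.ineqs (w + t • -p) i) := by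
        simp only [hr]; ring
      rw [h2] at h1
      have h3 := nonneg_of_mul_nonneg_right h1 hσi
      rw [ineqs_smul, ineqs_smul]
      have h4 : 0 ≤ t / (s + t) * (s / (s + t)) := by positivity
      have := mul_nonneg h4 h3
      linarith

/-- If the difference of two vertices is not the direction of a circuit, a conformal
decomposition of it gives a circuit walk of length two. -/
theorem circuitDist_le_two {u v : Fin 2 → ℝ} (hu : u ∈ Q.vertices) (hv : v ∈ Q.vertices)
    (huv : u ≠ v)
    (h : ¬ ∃ (g : Fin 2 → ℤ) (α : ℝ), Q.IsCircuit g ∧ 0 < α ∧ v - u = α • toReal g)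
    (p : CircuitWalk Q u v → Prop)
    (hp : ∀ W : CircuitWalk Q u v, W.IsFeasible → W.NonBackwards →
      W.NonRepetitive → W.IsSignCompatible → p W) : Q.circuitDist u v p ≤ 2 := by
  have hw0 : v - u ≠ 0 := fun h => huv (sub_eq_zero.1 h).symm
  have hw : Q.eqs (v - u) = 0 := by rw [eqs_sub, hv.1.1, hu.1.1, sub_self]
  have hal : ¬ Q.Aligned (v - u) := fun hal => h (hal.exists_isCircuit hw0)
  obtain ⟨x, y, hxy, hx, hy, hx0, hy0, hsc⟩ := exists_conformal_decomposition hu hw0 hw hal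
  obtain ⟨g, α, hg, hα, rfl⟩ := hx.exists_isCircuit hx0
  obtain ⟨g', β, hg', hβ, rfl⟩ := hy.exists_isCircuit hy0
  have hgg : ∀ c : ℝ, toReal g' ≠ c • toReal g := by
    rintro c hc
    apply hal
    rw [hxy, hc, smul_smul, ← add_smul]
    have := hx.smul (α⁻¹ * (α + β * c))
    rw [smul_smul] at this
    convert this using 2
    field_simp
  have hsc' : ∀ i, 0 ≤ Q.ineqs (toReal g) i * Q.ineqs (toReal g') i := by
    intro i
    have h1 := hsc i
    rw [ineqs_smul, ineqs_smul] at h1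
    have h2 : 0 ≤ (α * β) * (Q.ineqs (toReal g) i * Q.ineqs (toReal g') i) := by linarith
    exact nonneg_of_mul_nonneg_right h2 (by positivity)
  have h12 : ∀ i < 2, i = 0 ∨ i = 1 := by omega
  let W : CircuitWalk Q u v := CircuitWalk.ofSeq 2
    (fun i => if i = 0 then u else if i = 1 then u + α • toReal g else v)
    (fun i => if i = 0 then g else g') (fun i => if i = 0 then α else β) (by simp) (by simp)
    (by intro i hi; rcases h12 i hi with rfl | rfl <;> simpa)
    (by intro i hi; rcases h12 i hi with rfl | rfl <;> simpa)
    (by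
      intro i hi
      rcases h12 i hi with rfl | rfl
      · simp
      · simp only [one_add_one_eq_two, if_true, OfNat.ofNat_ne_zero, OfNat.ofNat_ne_one,
          one_ne_zero, if_false]
        rw [← sub_sub, hxy]
        abel)
  have hi01 : ∀ i : Fin W.length, ((i : ℕ) = 0 ∧ W.g i = g) ∨ ((i : ℕ) = 1 ∧ W.g i = g') := by
    intro i
    rcases h12 i i.2 with h | h
    · left; refine ⟨h, ?_⟩
      change (if (i : ℕ) = 0 then g else g') = g
      rw [if_pos h]
    · right; refine ⟨h, ?_⟩
      change (if (i : ℕ) = 0 then g else g') = g'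
      rw [if_neg (by omega)]
  have hmid : u + α • toReal g ∈ Q.carrier := by
    refine ⟨by rw [eqs_add, hu.1.1, hx.1, add_zero], fun i => ?_⟩
    have h1 := hsc i
    have h2 : Q.ineqs v i = Q.ineqs u i + Q.ineqs (α • toReal g) i + Q.ineqs (β • toReal g') i := by
      rw [add_assoc, ← ineqs_add, ← hxy, ← ineqs_add, add_sub_cancel]
    rw [ineqs_add]
    rcases le_or_gt (Q.ineqs (α • toReal g) i) 0 with h3 | h3
    · linarith [hu.1.2 i]
    · have : 0 ≤ Q.ineqs (β • toReal g') i := by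
        by_contra hc
        push Not at hc
        nlinarith
      linarith [hv.1.2 i]
  have hW : p W := by
    apply hp W
    · intro i
      rcases h12 i i.2 with h | h
      · have : W.y i.castSucc = u := by
          change (if (i : ℕ) = 0 then u else if (i : ℕ) = 1 then u + α • toReal g else v) = u
          rw [if_pos h]
        rw [this]; exact hu.1
      · have : W.y i.castSucc = u + α • toReal g := by
          change (if (i : ℕ) = 0 then u else if (i : ℕ) = 1 then u + α • toReal g else v) = _
          rw [if_neg (by omega), if_pos h]
        rw [this]; exact hmid
    · intro i j
      rcases hi01 i with ⟨_, h1⟩ | ⟨_, h1⟩ <;> rcases hi01 j with ⟨_, h2⟩ | ⟨_, h2⟩ <;> rw [h1, h2]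
      · exact hg.ne_neg
      · intro hc
        apply hgg (-1)
        rw [hc, toReal_neg]; simp
      · intro hc
        apply hgg (-1)
        rw [hc, toReal_neg]; simp
      · exact hg'.ne_neg
    · intro i j hij
      rcases hi01 i with ⟨h1', h1⟩ | ⟨h1', h1⟩ <;> rcases hi01 j with ⟨h2', h2⟩ | ⟨h2', h2⟩ <;>
        rw [h1, h2]
      · exact absurd (Fin.ext (h1'.trans h2'.symm)) hij
      · intro hc
        exact hgg 1 (by rw [one_smul, hc])
      · intro hc
        exact hgg 1 (by rw [one_smul, hc])
      · exact absurd (Fin.ext (h1'.trans h2'.symm)) hij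
    · constructor
      · intro i j k
        rcases hi01 i with ⟨_, h1⟩ | ⟨_, h1⟩ <;> rcases hi01 j with ⟨_, h2⟩ | ⟨_, h2⟩ <;>
          rw [h1, h2]
        · exact mul_self_nonneg _
        · exact hsc' k
        · rw [mul_comm]; exact hsc' k
        · exact mul_self_nonneg _
      · intro i k
        have e : Q.ineqs (v - u) k = α * Q.ineqs (toReal g) k + β * Q.ineqs (toReal g') k := by
          rw [hxy, ineqs_add, ineqs_smul, ineqs_smul]
        have e1 := mul_nonneg hα.le (mul_self_nonneg (Q.ineqs (toReal g) k))
        have e2 := mul_nonneg hβ.le (mul_self_nonneg (Q.ineqs (toReal g') k))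
        have e3 := mul_nonneg hα.le (hsc' k)
        have e4 := mul_nonneg hβ.le (hsc' k)
        rcases hi01 i with ⟨_, h1⟩ | ⟨_, h1⟩ <;> rw [h1, e] <;> linarith
  exact circuitDist_le W hW

/-- All distances below the soft distance in the hierarchy that admit short conformal walks agree
with the soft distance. -/
theorem circuitDist_eq_CD {u v : Fin 2 → ℝ} (hu : u ∈ Q.vertices) (hv : v ∈ Q.vertices)
    (huv : u ≠ v) (p : CircuitWalk Q u v → Prop)
    (hp : ∀ W : CircuitWalk Q u v, W.IsFeasible → W.NonBackwards →
      W.NonRepetitive → W.IsSignCompatible → p W) :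
    Q.circuitDist u v p = Q.CD u v ∧ Q.CD u v ∈ ({1, 2} : Set ℕ∞) := by
  have hle : Q.CD u v ≤ Q.circuitDist u v p := circuitDist_mono fun _ _ => trivial
  by_cases h : ∃ (g : Fin 2 → ℤ) (α : ℝ), Q.IsCircuit g ∧ 0 < α ∧ v - u = α • toReal g
  · have h1 : Q.circuitDist u v p ≤ 1 :=
      circuitDist_le_one hu hv h p fun W _ hf _ hb hr hs => hp W hf hb hr hs
    have h2 : (1 : ℕ∞) ≤ Q.CD u v := one_le_circuitDist huv _
    have h3 : Q.CD u v = 1 := le_antisymm (hle.trans h1) h2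
    exact ⟨le_antisymm (h1.trans h2) hle, Or.inl h3⟩
  · have h1 : Q.circuitDist u v p ≤ 2 := circuitDist_le_two hu hv huv h p hp
    have h2 : (2 : ℕ∞) ≤ Q.CD u v := by
      refine le_circuitDist fun W _ => ?_
      have hpos := W.length_pos huv
      have hne : W.length ≠ 1 := by
        intro h1
        apply h
        refine ⟨W.g ⟨0, hpos⟩, W.α ⟨0, hpos⟩, W.circuit _, W.α_pos _, ?_⟩
        rw [← W.step ⟨0, hpos⟩, W.y_eq_end (by simp [h1]), W.y_eq_start (by simp)]
      have : 2 ≤ W.length := by omega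
      exact_mod_cast this
    have h3 : Q.CD u v = 2 := le_antisymm (hle.trans h1) h2
    exact ⟨le_antisymm (h1.trans h2) hle, Or.inr h3⟩

/-! ### Circuit walks along sequences of points -/

/-- A sequence of points with aligned differences carries a circuit walk, whose properties can be
read off the sequence. -/
theorem exists_circuitWalk_of_seq {u v : Fin 2 → ℝ} (n : ℕ) (c : ℕ → Fin 2 → ℝ) (h0 : c 0 = u)
    (hn : c n = v) (hal : ∀ i < n, Q.Aligned (c (i + 1) - c i)) (hne : ∀ i < n, c i ≠ c (i + 1)) :
    ∃ W : CircuitWalk Q u v, W.length = n ∧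
      ((∀ i < n, Q.Neighbors (c i) (c (i + 1))) → W.IsEdge) ∧
      ((∀ i < n, c i ∈ Q.carrier) → W.IsFeasible) ∧
      ((∀ i < n, ∀ a : ℝ, 1 < a → c i + a • (c (i + 1) - c i) ∉ Q.carrier) → W.IsMaximal) ∧
      ((∀ i j, i < j → j < n → ∀ s t : ℝ, 0 < s → 0 < t →
        s • (c (i + 1) - c i) ≠ t • (c (j + 1) - c j)) → W.NonRepetitive) ∧
      ((∀ i j, i < j → j < n → ∀ s t : ℝ, 0 < s → 0 < t →
        s • (c (i + 1) - c i) ≠ -(t • (c (j + 1) - c j))) → W.NonBackwards) := by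
  have hex : ∀ i, ∃ (g : Fin 2 → ℤ) (α : ℝ), i < n →
      Q.IsCircuit g ∧ 0 < α ∧ c (i + 1) - c i = α • toReal g := by
    intro i
    by_cases hi : i < n
    · obtain ⟨g, α, h⟩ := (hal i hi).exists_isCircuit (sub_ne_zero.2 (hne i hi).symm)
      exact ⟨g, α, fun _ => h⟩
    · exact ⟨0, 0, fun h => absurd h hi⟩
  choose g α hg using hex
  have hdir : ∀ i < n, toReal (g i) = (α i)⁻¹ • (c (i + 1) - c i) := by
    intro i hi
    rw [(hg i hi).2.2, smul_smul, inv_mul_cancel₀ (hg i hi).2.1.ne', one_smul]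
  refine ⟨CircuitWalk.ofSeq n c g α h0 hn (fun i hi => (hg i hi).1) (fun i hi => (hg i hi).2.1)
    (fun i hi => (hg i hi).2.2), rfl, fun h i => h i i.2, fun h i => h i i.2, ?_, ?_, ?_⟩
  · intro h i a ha
    change c i + a • toReal (g i) ∉ Q.carrier
    have hα := (hg i i.2).2.1
    rw [hdir i i.2, smul_smul]
    apply h i i.2
    rw [← div_eq_mul_inv, one_lt_div hα]
    exact ha
  · intro h
    have key : ∀ i j, i < j → j < n → g i ≠ g j := by
      intro i j hij hj he
      apply h i j hij hj (α i)⁻¹ (α j)⁻¹ (inv_pos.2 (hg i (hij.trans hj)).2.1)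
        (inv_pos.2 (hg j hj).2.1)
      rw [← hdir i (hij.trans hj), ← hdir j hj, he]
    intro i j hij
    rcases lt_or_gt_of_ne (fun he => hij (Fin.ext he)) with h' | h'
    · exact key i j h' j.2
    · exact (key j i h' i.2).symm
  · intro h
    have key : ∀ i j, i < j → j < n → g i ≠ -g j := by
      intro i j hij hj he
      apply h i j hij hj (α i)⁻¹ (α j)⁻¹ (inv_pos.2 (hg i (hij.trans hj)).2.1)
        (inv_pos.2 (hg j hj).2.1)
      rw [← hdir i (hij.trans hj), ← hdir j hj, he, toReal_neg]
    intro i j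
    rcases lt_trichotomy (i : ℕ) (j : ℕ) with h' | h' | h'
    · exact key i j h' j.2
    · have : i = j := Fin.ext h'
      subst this
      exact (hg i i.2).1.ne_neg
    · intro he
      exact key j i h' i.2 (by change g i = -g j at he; rw [he, neg_neg])

/-! ### Orientation of triples of points -/

/-- Twice the signed area of the triangle `x y z`: positive if and only if `z` is strictly to the
left of the oriented line from `x` to `y`. -/
def cross (x y z : Fin 2 → ℝ) : ℝ :=
  (y 0 - x 0) * (z 1 - x 1) - (y 1 - x 1) * (z 0 - x 0)

theorem exists_eq_add_smul_of_cross_eq_zero {x y z : Fin 2 → ℝ} (hxy : x ≠ y)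
    (h : cross x y z = 0) : ∃ c : ℝ, z = x + c • (y - x) := by
  have hne : y - x ≠ 0 := sub_ne_zero.2 hxy.symm
  have h' : -(y 1 - x 1) ≠ 0 ∨ y 0 - x 0 ≠ 0 := by
    by_contra hc
    push Not at hc
    exact hne (plane_ext (by simpa using hc.2) (by
      have := hc.1; simp only [Pi.sub_apply, Pi.zero_apply]; linarith))
  obtain ⟨c, hc⟩ := exists_smul_of_orthogonal (y := z - x) h' hne
    (by simp only [Pi.sub_apply]; ring)
    (by simp only [Pi.sub_apply]; unfold cross at h; linarith)
  exact ⟨c, by rw [← hc]; abel⟩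

/-- No three extreme points of a set are collinear. -/
theorem cross_ne_zero_of_extreme {P : Set (Fin 2 → ℝ)} {x y z : Fin 2 → ℝ}
    (hx : x ∈ P.extremePoints ℝ) (hy : y ∈ P.extremePoints ℝ) (hz : z ∈ P.extremePoints ℝ)
    (hxy : x ≠ y) (hxz : x ≠ z) (hyz : y ≠ z) : cross x y z ≠ 0 := by
  intro h
  have hne : y - x ≠ 0 := sub_ne_zero.2 hxy.symm
  obtain ⟨c, rfl⟩ := exists_eq_add_smul_of_cross_eq_zero hxy h
  rcases lt_trichotomy c 0 with h1 | h1 | h1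
  · refine hne (eq_zero_of_mem_extremePoints hx (s := 1) (t := -c) one_pos (by linarith) ?_ ?_)
    · simpa using hy.1
    · simpa using hz.1
  · apply hxz; simp [h1]
  · rcases lt_trichotomy c 1 with h2 | h2 | h2
    · refine hne (eq_zero_of_mem_extremePoints hz (s := 1 - c) (t := c) (by linarith) h1 ?_ ?_)
      · have : x + c • (y - x) + (1 - c) • (y - x) = y := by module
        rw [this]; exact hy.1
      · simpa using hx.1
    · apply hyz; simp [h2]
    · refine hne (eq_zero_of_mem_extremePoints hy (s := c - 1) (t := 1) (by linarith) one_pos ?_ ?_)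
      · have : y + (c - 1) • (y - x) = x + c • (y - x) := by module
        rw [this]; exact hz.1
      · simpa using hx.1

/-! ### Edge paths do not repeat a direction -/

theorem eq_or_eq_of_extreme_mem_segment {P : Set (Fin 2 → ℝ)} {x y a : Fin 2 → ℝ}
    (ha : a ∈ P.extremePoints ℝ) (hx : x ∈ P) (hy : y ∈ P) (h : a ∈ segment ℝ x y) :
    a = x ∨ a = y := by
  by_cases hax : x = a
  · exact Or.inl hax.symm
  · by_cases hay : y = a
    · exact Or.inr hay.symm
    · have := (mem_extremePoints.1 ha).2 x hx y hy (mem_openSegment_of_ne_left_right hax hay h)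
      exact absurd this.1 hax

/-- An edge path without repeated vertices does not use two edges in the same direction. If it
did, then between the two edges it would have to cross the segment joining their midpoints `p`
and `q`, which is only possible along one of the two edges themselves. -/
theorem edge_path_directions {n : ℕ} {c : ℕ → Fin 2 → ℝ}
    (hN : ∀ i < n, Q.Neighbors (c i) (c (i + 1)))
    (hinj : ∀ i j, i ≤ n → j ≤ n → c i = c j → i = j) {i j : ℕ} (hij : i < j) (hj : j < n)
    {s t : ℝ} (hs : 0 < s) (ht : 0 < t) :
    s • (c (i + 1) - c i) ≠ t • (c (j + 1) - c j) := by
  intro hst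
  have hi : i < n := hij.trans hj
  have e0 := congrFun hst 0
  have e1 := congrFun hst 1
  simp only [Pi.smul_apply, Pi.sub_apply, smul_eq_mul] at e0 e1
  obtain ⟨ha, ha', hane, hF1⟩ := hN i hi
  obtain ⟨hb, hb', hbne, hF2⟩ := hN j hj
  set a := c i with hadef
  set a' := c (i + 1) with ha'def
  set b := c j with hbdef
  set b' := c (j + 1) with hb'def
  set p : Fin 2 → ℝ := (1 / 2 : ℝ) • a + (1 / 2 : ℝ) • a' with hp
  set q : Fin 2 → ℝ := (1 / 2 : ℝ) • b + (1 / 2 : ℝ) • b' with hq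
  have hpo : p ∈ openSegment ℝ a a' := ⟨1 / 2, 1 / 2, by norm_num, by norm_num, by norm_num, rfl⟩
  have hqo : q ∈ openSegment ℝ b b' := ⟨1 / 2, 1 / 2, by norm_num, by norm_num, by norm_num, rfl⟩
  have hpP : p ∈ Q.carrier := hF1.1 (openSegment_subset_segment _ _ _ hpo)
  have hqP : q ∈ Q.carrier := hF2.1 (openSegment_subset_segment _ _ _ hqo)
  have hab' : a ≠ b' := fun h => by
    have := hinj i (j + 1) hi.le hj h; omega
  have ha'b' : a' ≠ b' := fun h => by
    have := hinj (i + 1) (j + 1) hi hj h; omega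
  have hcol := cross_ne_zero_of_extreme ha ha' hb' hane hab' ha'b'
  -- points of the line through `p` and `q` have `cross p q = 0`
  have hD : cross p q a' ≠ 0 := by
    intro h0
    apply hcol
    have : t * cross a a' b' = -2 * t * cross p q a' := by
      unfold cross
      simp only [hp, hq, Pi.add_apply, Pi.smul_apply, smul_eq_mul]
      linear_combination (a' 1 - a 1) / 2 * e0 - (a' 0 - a 0) / 2 * e1
    rw [h0, mul_zero] at this
    exact (mul_eq_zero.1 this).resolve_left ht.ne'
  have hpq : p ≠ q := by
    intro h
    apply hD
    simp [cross, h]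
  have hDb : t * cross p q b = - (s * cross p q a') := by
    unfold cross
    simp only [hp, hq, Pi.add_apply, Pi.smul_apply, smul_eq_mul]
    linear_combination (b 0 + b' 0 - a 0 - a' 0) / 4 * e1 -
      (b 1 + b' 1 - a 1 - a' 1) / 4 * e0
  set D := cross p q a' with hDdef
  have hpos : 0 < D * cross p q (c (i + 1)) := mul_self_pos.2 hD
  have hneg : ¬ 0 < D * cross p q (c j) := by
    intro h
    have h1 : t * (D * cross p q b) = -(s * (D * D)) := by linear_combination D * hDb
    have h2 : 0 < D * D := hpos
    nlinarith [mul_pos ht h, mul_pos hs h2]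
  obtain ⟨l, hl1, hl2, hl3, hl4⟩ : ∃ l, i + 1 ≤ l ∧ l < j ∧ 0 < D * cross p q (c l) ∧
      ¬ 0 < D * cross p q (c (l + 1)) := by
    by_contra hcon
    push Not at hcon
    apply hneg
    have : ∀ m, i + 1 ≤ m → m ≤ j → 0 < D * cross p q (c m) := by
      intro m hm
      induction m, hm using Nat.le_induction with
      | base => intro _; exact hpos
      | succ m hm ih => intro hmj; exact hcon m hm (by omega) (ih (by omega))
    exact this j hij le_rfl
  push Not at hl4
  obtain ⟨hx, hy, hxy, hE⟩ := hN l (by omega)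
  set X := D * cross p q (c l) with hX
  set Y := D * cross p q (c (l + 1)) with hY
  -- the crossing point
  obtain ⟨z, hzE, hz0⟩ : ∃ z ∈ segment ℝ (c l) (c (l + 1)), cross p q z = 0 := by
    refine ⟨(-Y / (X - Y)) • c l + (X / (X - Y)) • c (l + 1), ⟨_, _, ?_, ?_, ?_, rfl⟩, ?_⟩
    · apply div_nonneg <;> linarith
    · apply div_nonneg <;> linarith
    · have : X - Y ≠ 0 := by linarith
      field_simp; ring
    · have hXY : X - Y ≠ 0 := by linarith
      apply mul_left_cancel₀ hD
      have h1 : -Y / (X - Y) + X / (X - Y) = 1 := by field_simp; ring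
      have h2 : D * cross p q ((-Y / (X - Y)) • c l + (X / (X - Y)) • c (l + 1)) =
          (-Y / (X - Y)) * X + (X / (X - Y)) * Y +
            (1 - (-Y / (X - Y) + X / (X - Y))) * (D * cross p q 0) := by
        rw [hX, hY]
        unfold cross
        simp only [Pi.add_apply, Pi.smul_apply, smul_eq_mul, Pi.zero_apply]
        ring
      rw [h2, h1]
      field_simp; ring
  have hzP : z ∈ Q.carrier := hE.1 hzE
  obtain ⟨τ, rfl⟩ := exists_eq_add_smul_of_cross_eq_zero hpq hz0
  have hmem : ∀ k, k ≤ n → c k ∈ Q.vertices → c k ∈ segment ℝ (c l) (c (l + 1)) →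
      k = l ∨ k = l + 1 := by
    intro k hk hkv hkE
    rcases eq_or_eq_of_extreme_mem_segment hkv hx.1 hy.1 hkE with h | h
    · exact Or.inl (hinj k l hk (by omega) h)
    · exact Or.inr (hinj k (l + 1) hk (by omega) h)
  have hpE : p ∉ segment ℝ (c l) (c (l + 1)) := by
    intro h
    have := hmem i hi.le ha (hE.2 ha.1 ha'.1 h hpo)
    omega
  have hqE : q ∉ segment ℝ (c l) (c (l + 1)) := by
    intro h
    have h2 := hE.2 hb'.1 hb.1 h (by rw [openSegment_symm]; exact hqo)
    have := hmem (j + 1) hj hb' h2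
    omega
  -- the line through `p` and `q` contains no further point of the two edges
  have hDne1 : q ∉ segment ℝ a a' := by
    rintro ⟨r, r', _, _, hr, h⟩
    apply hD
    have hr' : r' = 1 - r := by linarith
    rw [hDdef, ← h, hr']
    unfold cross
    simp only [hp, Pi.add_apply, Pi.smul_apply, smul_eq_mul]; ring
  have hDne2 : p ∉ segment ℝ b b' := by
    rintro ⟨r, r', _, _, hr, h⟩
    have : cross p q b = 0 := by
      have hr' : r' = 1 - r := by linarith
      rw [← h, hr']
      unfold cross
      simp only [hq, Pi.add_apply, Pi.smul_apply, smul_eq_mul]; ring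
    rw [this, mul_zero] at hDb
    have : s * D = 0 := by linarith
    exact hD ((mul_eq_zero.1 this).resolve_left hs.ne')
  rcases lt_trichotomy τ 0 with h1 | h1 | h1
  · apply hDne1
    have ho : p ∈ openSegment ℝ q (p + τ • (q - p)) := by
      refine ⟨-τ / (1 - τ), 1 / (1 - τ), div_pos (by linarith) (by linarith),
        div_pos one_pos (by linarith), by
          have : 1 - τ ≠ 0 := by linarith
          field_simp; ring, ?_⟩
      have : 1 - τ ≠ 0 := by linarith
      apply plane_ext <;>
      · simp only [Pi.add_apply, Pi.smul_apply, Pi.sub_apply, smul_eq_mul]; field_simp; ring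
    exact hF1.2 hqP hzP (openSegment_subset_segment _ _ _ hpo) ho
  · apply hpE; simpa [h1] using hzE
  · rcases lt_trichotomy τ 1 with h2 | h2 | h2
    · apply hpE
      refine hE.2 hpP hqP hzE ⟨1 - τ, τ, by linarith, h1, by ring, ?_⟩
      module
    · apply hqE; simpa [h2] using hzE
    · apply hDne2
      have ho : q ∈ openSegment ℝ p (p + τ • (q - p)) := by
        refine ⟨(τ - 1) / τ, 1 / τ, div_pos (by linarith) h1, div_pos one_pos h1, by
          field_simp; ring, ?_⟩
        apply plane_ext <;>
        · simp only [Pi.add_apply, Pi.smul_apply, Pi.sub_apply, smul_eq_mul]; field_simp; ring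
      exact hF2.2 hpP hzP (openSegment_subset_segment _ _ _ hqo) ho

/-- An edge path without repeated vertices carries a circuit walk. -/
theorem exists_circuitWalk_of_edge_path {u v : Fin 2 → ℝ} {n : ℕ} {c : ℕ → Fin 2 → ℝ}
    (h0 : c 0 = u) (hn : c n = v) (hN : ∀ i < n, Q.Neighbors (c i) (c (i + 1)))
    (hinj : ∀ i j, i ≤ n → j ≤ n → c i = c j → i = j) :
    ∃ W : CircuitWalk Q u v, W.length = n ∧ W.IsEdge ∧ W.IsFeasible ∧ W.IsMaximal ∧
      W.NonRepetitive ∧ ((∀ i j, i < j → j < n → ∀ s t : ℝ, 0 < s → 0 < t →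
        s • (c (i + 1) - c i) ≠ -(t • (c (j + 1) - c j))) → W.NonBackwards) := by
  obtain ⟨W, h1, h2, h3, h4, h5, h6⟩ := exists_circuitWalk_of_seq n c h0 hn
    (fun i hi => (hN i hi).aligned) (fun i hi => (hN i hi).2.2.1)
  refine ⟨W, h1, h2 hN, h3 fun i hi => (hN i hi).1.1, h4 fun i hi a ha => ?_,
    h5 fun i j hij hj s t hs ht => edge_path_directions hN hinj hij hj hs ht, h6⟩
  exact notMem_of_end_extreme (hN i hi).1.1 (hN i hi).2.1 (sub_ne_zero.2 (hN i hi).2.2.1.symm)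
    one_pos (one_smul ℝ _).symm ha

/-- The vertex-edge graph of a polyhedron in the plane. -/
def edgeGraph (Q : HPolyhedron 2) : SimpleGraph (Fin 2 → ℝ) where
  Adj := Q.Neighbors
  symm := ⟨fun _ _ h => h.symm⟩
  loopless := ⟨fun _ h => h.2.2.1 rfl⟩

theorem exists_walk_of_seq {n : ℕ} {c : ℕ → Fin 2 → ℝ}
    (hN : ∀ i < n, Q.Neighbors (c i) (c (i + 1))) :
    ∃ p : Q.edgeGraph.Walk (c 0) (c n), p.length = n := by
  induction n with
  | zero => exact ⟨SimpleGraph.Walk.nil, rfl⟩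
  | succ n ih =>
    obtain ⟨p, hp⟩ := ih fun i hi => hN i (by omega)
    have hadj : Q.edgeGraph.Adj (c n) (c (n + 1)) := hN n (by omega)
    exact ⟨p.concat hadj, by rw [SimpleGraph.Walk.length_concat, hp]⟩

/-- A shortest edge walk has no repeated vertices, hence no repeated directions. -/
theorem CDefm_eq_CDefmr (Q : HPolyhedron 2) (u v : Fin 2 → ℝ) : Q.CDefm u v = Q.CDefmr u v := by
  classical
  refine le_antisymm (circuitDist_mono fun W hW => ⟨hW.1, hW.2.1, hW.2.2.1⟩) ?_
  refine le_circuitDist fun W hW => ?_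
  set c : ℕ → Fin 2 → ℝ := fun i => W.y ⟨min i W.length, by omega⟩ with hc
  have hN : ∀ i < W.length, Q.Neighbors (c i) (c (i + 1)) := by
    intro i hi
    have := hW.1 ⟨i, hi⟩
    have e1 : c i = W.y (Fin.castSucc ⟨i, hi⟩) := by
      simp only [hc]; congr 1; apply Fin.ext; simp; omega
    have e2 : c (i + 1) = W.y (Fin.succ ⟨i, hi⟩) := by
      simp only [hc]; congr 1; apply Fin.ext; simp; omega
    rwa [e1, e2]
  obtain ⟨p, hp⟩ := exists_walk_of_seq hN
  have hpath := p.bypass_isPath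
  obtain ⟨W', hl, he, hf, hm, hr, _⟩ := exists_circuitWalk_of_edge_path (u := u) (v := v)
    (n := p.bypass.length) (c := p.bypass.getVert)
    (by rw [SimpleGraph.Walk.getVert_zero]; exact W.y_eq_start (by simp))
    (by rw [SimpleGraph.Walk.getVert_length]; exact W.y_eq_end (by simp))
    (fun i hi => p.bypass.adj_getVert_succ hi)
    (fun i j hi hj hij => hpath.getVert_injOn hi hj hij)
  calc Q.CDefmr u v ≤ W'.length := circuitDist_le W' ⟨he, hf, hm, hr⟩
    _ ≤ W.length := by
      rw [hl]
      have := p.length_bypass_le_length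
      rw [hp] at this
      exact_mod_cast this

/-! ### Compact polyhedra as convex hulls of their vertices -/

theorem isCompact_carrier (hb : Bornology.IsBounded Q.carrier) : IsCompact Q.carrier :=
  Metric.isCompact_of_isClosed_isBounded (isClosed_carrier Q) hb

theorem carrier_eq_convexHull (hb : Bornology.IsBounded Q.carrier) :
    Q.carrier = convexHull ℝ Q.vertices := by
  have h := closure_convexHull_extremePoints (isCompact_carrier hb) (convex_carrier Q)
  rw [← h]
  exact ((finite_vertices Q).isClosed_convexHull ℝ).closure_eq

/-- A point of a convex hull at which a nonpositive affine function vanishes lies in the convex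
hull of the generators at which it vanishes. -/
theorem mem_convexHull_of_affine_eq_zero {V : Set (Fin 2 → ℝ)} {f : (Fin 2 → ℝ) → ℝ}
    (hf : ∀ x y : Fin 2 → ℝ, ∀ s t : ℝ, s + t = 1 → f (s • x + t • y) = s * f x + t * f y)
    (hV : ∀ w ∈ V, f w ≤ 0) {x : Fin 2 → ℝ} (hx : x ∈ convexHull ℝ V) :
    f x ≤ 0 ∧ (f x = 0 → x ∈ convexHull ℝ {w ∈ V | f w = 0}) := by
  set S : Set (Fin 2 → ℝ) := {x | f x < 0 ∨ f x = 0 ∧ x ∈ convexHull ℝ {w ∈ V | f w = 0}}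
  have hS : Convex ℝ S := by
    intro y hy z hz a b ha hb hab
    have hle : ∀ y ∈ S, f y ≤ 0 := by
      rintro y (h | h)
      · exact h.le
      · exact h.1.le
    rcases ha.eq_or_lt with rfl | ha
    · have : b = 1 := by linarith
      simpa [this] using hz
    rcases hb.eq_or_lt with rfl | hb
    · have : a = 1 := by linarith
      simpa [this] using hy
    have e := hf y z a b hab
    have h1 := hle y hy
    have h2 := hle z hz
    rcases hy with hy | hy
    · left; rw [e]; nlinarith
    · rcases hz with hz | hz
      · left; rw [e]; nlinarith
      · right
        refine ⟨by rw [e, hy.1, hz.1]; ring, ?_⟩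
        exact convex_convexHull ℝ _ hy.2 hz.2 ha.le hb.le hab
  have hVS : V ⊆ S := by
    intro w hw
    rcases (hV w hw).lt_or_eq with h | h
    · exact Or.inl h
    · exact Or.inr ⟨h, subset_convexHull ℝ _ ⟨hw, h⟩⟩
  rcases convexHull_min hVS hS hx with h | h
  · exact ⟨h.le, fun h0 => absurd h0 h.ne⟩
  · exact ⟨h.1.le, fun _ => h.2⟩

theorem cross_affine (ε : ℝ) (x y p q : Fin 2 → ℝ) (s t : ℝ) (hst : s + t = 1) :
    ε * cross x y (s • p + t • q) = s * (ε * cross x y p) + t * (ε * cross x y q) := by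
  have : t = 1 - s := by linarith
  subst this
  unfold cross
  simp only [Pi.add_apply, Pi.smul_apply, smul_eq_mul]; ring

/-- Two vertices such that all other vertices lie strictly on one side of the line through them
are neighbors. -/
theorem neighbors_of_side (hb : Bornology.IsBounded Q.carrier) {ε : ℝ} {z z' : Fin 2 → ℝ}
    (hz : z ∈ Q.vertices) (hz' : z' ∈ Q.vertices) (hne : z ≠ z')
    (h : ∀ w ∈ Q.vertices, w ≠ z → w ≠ z' → ε * cross z z' w < 0) : Q.Neighbors z z' := by
  refine ⟨hz, hz', hne, (convex_carrier Q).segment_subset hz.1 hz'.1, ?_⟩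
  have hz0 : ε * cross z z' z = 0 := by unfold cross; ring
  have hz0' : ε * cross z z' z' = 0 := by unfold cross; ring
  have hle : ∀ w ∈ Q.vertices, ε * cross z z' w ≤ 0 := by
    intro w hw
    by_cases h1 : w = z
    · rw [h1, hz0]
    · by_cases h2 : w = z'
      · rw [h2, hz0']
      · exact (h w hw h1 h2).le
  have hsub : {w ∈ Q.vertices | ε * cross z z' w = 0} ⊆ {z, z'} := by
    rintro w ⟨hw, h0⟩
    by_contra hcon
    simp only [Set.mem_insert_iff, Set.mem_singleton_iff, not_or] at hcon
    exact (h w hw hcon.1 hcon.2).ne h0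
  intro x hx y hy p hp hpo
  have hfp : ε * cross z z' p = 0 := by
    obtain ⟨s, t, _, _, hst, rfl⟩ := hp
    rw [cross_affine _ _ _ _ _ _ _ hst, hz0, hz0']; ring
  rw [carrier_eq_convexHull hb] at hx hy
  have h1 := mem_convexHull_of_affine_eq_zero (cross_affine ε z z') hle hx
  have h2 := mem_convexHull_of_affine_eq_zero (cross_affine ε z z') hle hy
  obtain ⟨s, t, hs, ht, hst, rfl⟩ := hpo
  rw [cross_affine _ _ _ _ _ _ _ hst] at hfp
  have hfx : ε * cross z z' x = 0 := by
    have e1 := mul_nonpos_of_nonneg_of_nonpos hs.le h1.1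
    have e2 := mul_nonpos_of_nonneg_of_nonpos ht.le h2.1
    have : s * (ε * cross z z' x) = 0 := by linarith
    exact (mul_eq_zero.1 this).resolve_left hs.ne'
  have := convexHull_mono hsub (h1.2 hfx)
  rwa [convexHull_pair] at this

/-! ### The chain of edges on one side of a pair of vertices -/

/-- The *successor* of a vertex: a vertex `z'` such that all other vertices lie strictly on one
side of the oriented line from `z` to `z'`. It is found by maximizing the slope in coordinates in
which all other vertices lie to the same side of `z`. -/
theorem exists_successor {ε : ℝ} (hε : ε ≠ 0) {z v : Fin 2 → ℝ} (hz : z ∈ Q.vertices)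
    (hv : v ∈ Q.vertices) (hzv : z ≠ v) :
    ∃ z' ∈ Q.vertices, z' ≠ z ∧ ∀ w ∈ Q.vertices, w ≠ z → w ≠ z' → ε * cross z z' w < 0 := by
  classical
  set T : Finset (Fin Q.mB) := Finset.univ.filter fun i => Q.ineqs z i = Q.d i with hT
  set a : ℝ := -∑ i ∈ T, (Q.B i 0 : ℝ)
  set b : ℝ := -∑ i ∈ T, (Q.B i 1 : ℝ)
  set φ : (Fin 2 → ℝ) → ℝ := fun w => a * (w 0 - z 0) + b * (w 1 - z 1) with hφ
  set η : (Fin 2 → ℝ) → ℝ := fun w => -b * (w 0 - z 0) + a * (w 1 - z 1) with hη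
  have hφ' : ∀ w, φ w = ∑ i ∈ T, (Q.ineqs z i - Q.ineqs w i) := by
    intro w
    simp only [hφ, a, b, ineqs_apply, neg_mul, Finset.sum_mul, ← Finset.sum_neg_distrib,
      ← Finset.sum_add_distrib]
    exact Finset.sum_congr rfl fun i _ => by ring
  have hpos : ∀ w ∈ Q.vertices, w ≠ z → 0 < φ w := by
    intro w hw hwz
    have hnn : ∀ i ∈ T, 0 ≤ Q.ineqs z i - Q.ineqs w i := by
      intro i hi
      have : Q.ineqs z i = Q.d i := by simpa [hT] using hi
      rw [this]; linarith [hw.1.2 i]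
    rw [hφ']
    refine (Finset.sum_nonneg hnn).lt_of_ne fun h0 => hwz ?_
    have h1 := (Finset.sum_eq_zero_iff_of_nonneg hnn).1 h0.symm
    have : w - z = 0 := by
      refine eq_zero_of_rows_orthogonal hz (by rw [eqs_sub, hz.1.1, hw.1.1, sub_self]) ?_
      intro i hi
      have := h1 i (by simp [hT, hi])
      rw [ineqs_sub]; linarith
    exact sub_eq_zero.1 this
  obtain ⟨z', ⟨hz', hz'z⟩, hmax⟩ := ((finite_vertices Q).subset (Set.sdiff_subset (t := {z})))
    |>.exists_maximalFor (fun w => ε * η w / φ w) _ ⟨v, hv, fun h => hzv h.symm⟩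
  have hz'z : z' ≠ z := hz'z
  refine ⟨z', hz', hz'z, fun w hw hwz hwz' => ?_⟩
  have h1 := hpos w hw hwz
  have h2 := hpos z' hz' hz'z
  have h3 : ε * η w / φ w ≤ ε * η z' / φ z' := by
    rcases le_total (ε * η w / φ w) (ε * η z' / φ z') with h | h
    · exact h
    · exact hmax (j := w) ⟨hw, hwz⟩ h
  rw [div_le_div_iff₀ h1 h2] at h3
  have h4 : (a ^ 2 + b ^ 2) * (ε * cross z z' w) ≤ 0 := by
    have : (a ^ 2 + b ^ 2) * (ε * cross z z' w) = ε * η w * φ z' - ε * η z' * φ w := by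
      simp only [hφ, hη]; unfold cross; ring
    linarith
  have h5 : 0 < a ^ 2 + b ^ 2 := by
    rcases (add_nonneg (sq_nonneg a) (sq_nonneg b)).eq_or_lt with h | h
    · exfalso
      have ha : a = 0 := by nlinarith [sq_nonneg a, sq_nonneg b]
      have hb : b = 0 := by nlinarith [sq_nonneg a, sq_nonneg b]
      simp [hφ, ha, hb] at h1
    · exact h
  have h6 : ε * cross z z' w ≠ 0 :=
    mul_ne_zero hε (cross_ne_zero_of_extreme hz hz' hw hz'z.symm hwz.symm hwz'.symm)
  refine lt_of_le_of_ne ?_ h6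
  by_contra hc
  push Not at hc
  nlinarith [mul_pos h5 hc]

/-- Taking successors does not lead across the line through two vertices `u` and `v`. -/
theorem successor_side {ε : ℝ} (hε : ε ≠ 0) {u v z z' : Fin 2 → ℝ} (hu : u ∈ Q.vertices)
    (hv : v ∈ Q.vertices) (huv : u ≠ v) (hz : z ∈ Q.vertices) (hz' : z' ∈ Q.vertices)
    (hzv : z ≠ v)
    (h : ∀ w ∈ Q.vertices, w ≠ z → w ≠ z' → ε * cross z z' w < 0)
    (hzs : z = u ∨ 0 < ε * cross u v z) : z' = v ∨ 0 < ε * cross u v z' := by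
  by_cases hz'v : z' = v
  · exact Or.inl hz'v
  right
  rcases hzs with rfl | hzs
  · have h1 := h v hv (Ne.symm huv) (Ne.symm hz'v)
    have : cross z v z' = -cross z z' v := by unfold cross; ring
    rw [this]; linarith
  · have hzu : z ≠ u := by
      rintro rfl
      simp [cross] at hzs
    have hz'u : z' ≠ u := by
      rintro rfl
      have h1 := h v hv hzv.symm huv.symm
      have : cross z z' v = cross z' v z := by unfold cross; ring
      rw [this] at h1
      linarith
    by_contra hcon
    have hA := h u hu hzu.symm hz'u.symm
    have hB := h v hv hzv.symm (Ne.symm hz'v)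
    have hne : ε * cross u v z' ≠ 0 :=
      mul_ne_zero hε (cross_ne_zero_of_extreme hu hv hz' huv hz'u.symm (Ne.symm hz'v))
    have hneg : ε * cross u v z' < 0 := lt_of_le_of_ne (not_lt.1 hcon) hne
    set X := ε * cross u v z with hX
    set Y := ε * cross u v z' with hY
    have hXY : 0 < X - Y := by linarith
    -- the point in which the segment from `z` to `z'` crosses the line
    set x : Fin 2 → ℝ := (-Y / (X - Y)) • z + (X / (X - Y)) • z' with hx
    have hsum : -Y / (X - Y) + X / (X - Y) = 1 := by
      have := hXY.ne'
      field_simp; ring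
    have hxP : x ∈ Q.carrier := convex_carrier Q hz.1 hz'.1
      (div_nonneg (by linarith) hXY.le) (div_nonneg hzs.le hXY.le) hsum
    have hx0 : ε * cross u v x = 0 := by
      rw [hx, cross_affine _ _ _ _ _ _ _ hsum, ← hX, ← hY]
      field_simp; ring
    obtain ⟨τ, hτ⟩ := exists_eq_add_smul_of_cross_eq_zero huv ((mul_eq_zero.1 hx0).resolve_left hε)
    have hx1 : ε * cross z z' x = 0 := by
      rw [hx, cross_affine _ _ _ _ _ _ _ hsum]; unfold cross; ring
    have hx2 : ε * cross z z' x = (1 - τ) * (ε * cross z z' u) + τ * (ε * cross z z' v) := by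
      rw [← cross_affine ε z z' u v (1 - τ) τ (by ring), hτ]
      congr 2; module
    rw [hx1] at hx2
    have hvu : v - u ≠ 0 := sub_ne_zero.2 huv.symm
    rcases lt_or_ge τ 0 with h1 | h1
    · refine hvu (eq_zero_of_mem_extremePoints hu (s := 1) (t := -τ) one_pos (by linarith) ?_ ?_)
      · simpa using hv.1
      · have : u - -τ • (v - u) = x := by rw [hτ]; module
        rw [this]; exact hxP
    · rcases lt_or_ge 1 τ with h2 | h2
      · refine hvu (eq_zero_of_mem_extremePoints hv (s := τ - 1) (t := 1) (by linarith) one_pos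
          ?_ ?_)
        · have : v + (τ - 1) • (v - u) = x := by rw [hτ]; module
          rw [this]; exact hxP
        · simpa using hu.1
      · have e1 : (1 - τ) * (ε * cross z z' u) ≤ 0 :=
          mul_nonpos_of_nonneg_of_nonpos (by linarith) hA.le
        rcases h1.eq_or_lt with h3 | h3
        · subst h3; linarith
        · have := mul_neg_of_pos_of_neg h3 hB
          linarith

/-- An edge path from `u` to `v` along the vertices to one side (determined by the sign of `ε`)
of the line through `u` and `v`, each step leading from a vertex to its successor. -/
structure IsChain (Q : HPolyhedron 2) (ε : ℝ) (u v : Fin 2 → ℝ) (n : ℕ) (c : ℕ → Fin 2 → ℝ) :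
    Prop where
  start_eq : c 0 = u
  end_eq : c n = v
  pos : 0 < n
  neighbors : ∀ i < n, Q.Neighbors (c i) (c (i + 1))
  inj : ∀ i j, i ≤ n → j ≤ n → c i = c j → i = j
  side : ∀ i, 0 < i → i < n → 0 < ε * cross u v (c i)
  succ : ∀ i < n, ∀ w ∈ Q.vertices, w ≠ c i → w ≠ c (i + 1) → ε * cross (c i) (c (i + 1)) w < 0
  length_le : n ≤ {w ∈ Q.vertices | 0 < ε * cross u v w}.ncard + 1

/-- Taking successors is injective on the vertices, so iterates starting from `u` that never reach
`v` would return to `u`. This is impossible, since they stay strictly on one side of the line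
through `u` and `v` until they reach `v`. -/
theorem exists_isChain (hb : Bornology.IsBounded Q.carrier) {ε : ℝ} (hε : ε ≠ 0)
    {u v : Fin 2 → ℝ} (hu : u ∈ Q.vertices) (hv : v ∈ Q.vertices) (huv : u ≠ v) :
    ∃ n c, IsChain Q ε u v n c := by
  classical
  have hex : ∀ z, ∃ z', z ∈ Q.vertices → z' ∈ Q.vertices ∧ z' ≠ z ∧
      ∀ w ∈ Q.vertices, w ≠ z → w ≠ z' → ε * cross z z' w < 0 := by
    intro z
    by_cases hz : z ∈ Q.vertices
    · obtain ⟨w, hw, hzw⟩ : ∃ w ∈ Q.vertices, z ≠ w := by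
        by_cases h : z = u
        · exact ⟨v, hv, by rw [h]; exact huv⟩
        · exact ⟨u, hu, h⟩
      obtain ⟨z', h1, h2, h3⟩ := exists_successor hε hz hw hzw
      exact ⟨z', fun _ => ⟨h1, h2, h3⟩⟩
    · exact ⟨z, fun h => absurd h hz⟩
  choose nx hnx using hex
  set c : ℕ → Fin 2 → ℝ := fun i => nx^[i] u with hc
  have hc1 : ∀ i, c (i + 1) = nx (c i) := fun i => Function.iterate_succ_apply' nx i u
  have hcV : ∀ i, c i ∈ Q.vertices := by
    intro i
    induction i with
    | zero => exact hu
    | succ i ih => rw [hc1]; exact (hnx _ ih).1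
  have hnxinj : ∀ x ∈ Q.vertices, ∀ y ∈ Q.vertices, nx x = nx y → x = y := by
    intro x hx y hy hxy
    by_contra hne
    have h1 := (hnx x hx).2.2 y hy (Ne.symm hne) (by rw [hxy]; exact (hnx y hy).2.1.symm)
    have h2 := (hnx y hy).2.2 x hx hne (by rw [← hxy]; exact (hnx x hx).2.1.symm)
    rw [← hxy] at h2
    have : cross y (nx x) x = -cross x (nx x) y := by unfold cross; ring
    rw [this] at h2
    linarith
  have hcancel : ∀ i k, c i = c (i + k) → u = c k := by
    intro i
    induction i with
    | zero => intro k h; simpa [hc] using h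
    | succ i ih =>
      intro k h
      apply ih
      apply hnxinj _ (hcV _) _ (hcV _)
      rw [← hc1, ← hc1, h]
      congr 1; omega
  have hu0 : ε * cross u v u = 0 := by unfold cross; ring
  have hside : ∀ n, 0 < n → (∀ i ≤ n, c i ≠ v) → 0 < ε * cross u v (c n) := by
    intro n hn
    induction n, hn using Nat.le_induction with
    | base =>
      intro h
      have h2 := hnx _ (hcV 0)
      exact (successor_side hε hu hv huv (hcV 0) h2.1 (h 0 (by omega)) h2.2.2
        (Or.inl rfl)).resolve_left (h 1 le_rfl)
    | succ m hm ih =>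
      intro h
      have h2 := hnx _ (hcV m)
      have h3 := h (m + 1) le_rfl
      rw [hc1] at h3 ⊢
      exact (successor_side hε hu hv huv (hcV m) h2.1 (h m (by omega)) h2.2.2
        (Or.inr (ih fun i hi => h i (by omega)))).resolve_left h3
  have hreach : ∃ n, c n = v := by
    by_contra hcon
    push Not at hcon
    have hni : ¬ Function.Injective c := fun hi => by
      have : (Set.range c).Infinite := Set.infinite_range_of_injective hi
      exact this ((finite_vertices Q).subset (by rintro _ ⟨i, rfl⟩; exact hcV i))
    have : ∃ i k, 0 < k ∧ c i = c (i + k) := by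
      by_contra hno
      push Not at hno
      apply hni
      intro i j hij
      by_contra hne
      rcases lt_or_gt_of_ne hne with h | h
      · exact hno i (j - i) (by omega) (by rw [hij]; congr 1; omega)
      · exact hno j (i - j) (by omega) (by rw [← hij]; congr 1; omega)
    obtain ⟨i, k, hk, hik⟩ := this
    have h1 := hcancel i k hik
    have h2 := hside k hk fun i _ => hcon i
    rw [← h1, hu0] at h2
    exact lt_irrefl _ h2
  set n := Nat.find hreach with hn
  have hcn : c n = v := Nat.find_spec hreach
  have hmin : ∀ i < n, c i ≠ v := fun i hi => Nat.find_min hreach hi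
  have hpos : 0 < n := by
    rcases Nat.eq_zero_or_pos n with h | h
    · exfalso; apply huv; rw [← hcn, h]; rfl
    · exact h
  have hs : ∀ i, 0 < i → i < n → 0 < ε * cross u v (c i) :=
    fun i hi hin => hside i hi fun j hj => hmin j (by omega)
  have hinj : ∀ i j, i ≤ n → j ≤ n → c i = c j → i = j := by
    have key : ∀ i j, i < j → j ≤ n → c i ≠ c j := by
      intro i j hij hj h
      have h1 := hcancel i (j - i) (by rw [h]; congr 1; omega)
      rcases (show j - i ≤ n by omega).lt_or_eq with h2 | h2
      · have := hs (j - i) (by omega) h2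
        rw [← h1, hu0] at this
        exact lt_irrefl _ this
      · rw [h2, hcn] at h1
        exact huv h1
    intro i j hi hj h
    by_contra hne
    rcases lt_or_gt_of_ne hne with h' | h'
    · exact key i j h' hj h
    · exact key j i h' hi h.symm
  refine ⟨n, c, rfl, hcn, hpos, fun i hi => ?_, hinj, hs, fun i hi => ?_, ?_⟩
  · have h := hnx _ (hcV i)
    rw [hc1]
    exact neighbors_of_side hb (hcV i) h.1 h.2.1.symm h.2.2
  · rw [hc1]; exact (hnx _ (hcV i)).2.2
  · have h1 : (c '' Set.Ioo 0 n) ⊆ {w ∈ Q.vertices | 0 < ε * cross u v w} := by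
      rintro _ ⟨i, hi, rfl⟩
      exact ⟨hcV i, hs i hi.1 hi.2⟩
    have h2 := Set.ncard_le_ncard h1 ((finite_vertices Q).subset (Set.sep_subset _ _))
    rw [Set.InjOn.ncard_image] at h2
    · have : (Set.Ioo 0 n).ncard = n - 1 := by
        rw [Set.ncard_eq_toFinset_card']; simp
      omega
    · intro i hi j hj h
      exact hinj i j hi.2.le hj.2.le h

/-- On a step of a chain that avoids both ends, a linear function increases if it is smallest at
`u` and largest at `v`: the points `u`, `c i`, `c (i + 1)`, `v` are in convex position, so that
the diagonals of their quadrilateral cross. -/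
theorem IsChain.lt_of_step {ε : ℝ} {u v : Fin 2 → ℝ} {n : ℕ} {c : ℕ → Fin 2 → ℝ}
    (hc : IsChain Q ε u v n c) (hu : u ∈ Q.vertices) (hv : v ∈ Q.vertices) {p q : ℝ} {i : ℕ}
    (hi : 0 < i) (hin : i + 1 < n)
    (h1 : p * u 0 + q * u 1 < p * c (i + 1) 0 + q * c (i + 1) 1)
    (h2 : p * c i 0 + q * c i 1 ≤ p * v 0 + q * v 1) :
    p * c i 0 + q * c i 1 < p * c (i + 1) 0 + q * c (i + 1) 1 := by
  have hne : ∀ k l, k ≤ n → l ≤ n → k ≠ l → c k ≠ c l := fun k l hk hl hkl h =>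
    hkl (hc.inj k l hk hl h)
  have hA := hc.succ i (by omega) u hu (by
    rw [← hc.start_eq]; exact hne 0 i (by omega) (by omega) (by omega)) (by
    rw [← hc.start_eq]; exact hne 0 (i + 1) (by omega) (by omega) (by omega))
  have hB := hc.succ i (by omega) v hv (by
    rw [← hc.end_eq]; exact hne n i (by omega) (by omega) (by omega)) (by
    rw [← hc.end_eq]; exact hne n (i + 1) (by omega) (by omega) (by omega))
  have hC := hc.side i hi (by omega)
  have hD := hc.side (i + 1) (by omega) hin
  set z := c i
  set z' := c (i + 1)
  set A := ε * cross z z' u with hAd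
  set B := ε * cross z z' v with hBd
  set C := ε * cross u v z with hCd
  set D := ε * cross u v z' with hDd
  have hsum : D - A = C - B := by
    rw [hAd, hBd, hCd, hDd]; unfold cross; ring
  have hrel : D * (p * z 0 + q * z 1) - A * (p * v 0 + q * v 1) =
      C * (p * z' 0 + q * z' 1) - B * (p * u 0 + q * u 1) := by
    rw [hAd, hBd, hCd, hDd]; unfold cross; ring
  have e1 : (-A) * (p * z 0 + q * z 1) ≤ (-A) * (p * v 0 + q * v 1) :=
    mul_le_mul_of_nonneg_left h2 (by linarith)
  have e2 : (-B) * (p * u 0 + q * u 1) < (-B) * (p * z' 0 + q * z' 1) :=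
    mul_lt_mul_of_pos_left h1 (by linarith)
  have e3 : (D - A) * (p * z 0 + q * z 1) < (D - A) * (p * z' 0 + q * z' 1) := by
    calc (D - A) * (p * z 0 + q * z 1) ≤
        C * (p * z' 0 + q * z' 1) - B * (p * u 0 + q * u 1) := by rw [← hrel]; linarith
      _ < C * (p * z' 0 + q * z' 1) - B * (p * z' 0 + q * z' 1) := by linarith
      _ = (D - A) * (p * z' 0 + q * z' 1) := by rw [hsum]; ring
  exact lt_of_mul_lt_mul_left e3 (by linarith)

/-- A chain along which a linear function is strictly smallest at the start and largest at the
end does not use two opposite directions: the function increases in every step, except possibly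
in the last one. -/
theorem IsChain.no_opposite {ε : ℝ} {u v : Fin 2 → ℝ} {n : ℕ} {c : ℕ → Fin 2 → ℝ}
    (hc : IsChain Q ε u v n c) (hu : u ∈ Q.vertices) (hv : v ∈ Q.vertices) {p q : ℝ}
    (h1 : ∀ i, 0 < i → i ≤ n → p * u 0 + q * u 1 < p * c i 0 + q * c i 1)
    (h2 : ∀ i ≤ n, p * c i 0 + q * c i 1 ≤ p * v 0 + q * v 1) (i j : ℕ) (hij : i < j) (hj : j < n)
    (s t : ℝ) (hs : 0 < s) (ht : 0 < t) :
    s • (c (i + 1) - c i) ≠ -(t • (c (j + 1) - c j)) := by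
  intro he
  have hpos : ∀ k, k + 1 < n → p * c k 0 + q * c k 1 < p * c (k + 1) 0 + q * c (k + 1) 1 := by
    intro k hk
    rcases Nat.eq_zero_or_pos k with rfl | h
    · have := h1 1 one_pos (by omega)
      rwa [hc.start_eq]
    · exact hc.lt_of_step hu hv h hk (h1 _ (by omega) (by omega)) (h2 _ (by omega))
  have hnn : p * c j 0 + q * c j 1 ≤ p * c (j + 1) 0 + q * c (j + 1) 1 := by
    rcases (show j + 1 ≤ n from hj).lt_or_eq with h | h
    · exact (hpos j h).le
    · rw [h, hc.end_eq]; exact h2 j hj.le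
  have hi := hpos i (by omega)
  have e0 := congrFun he 0
  have e1 := congrFun he 1
  simp only [Pi.smul_apply, Pi.sub_apply, Pi.neg_apply, smul_eq_mul] at e0 e1
  have : s * ((p * c (i + 1) 0 + q * c (i + 1) 1) - (p * c i 0 + q * c i 1)) =
      -(t * ((p * c (j + 1) 0 + q * c (j + 1) 1) - (p * c j 0 + q * c j 1))) := by
    linear_combination p * e0 + q * e1
  have p1 := mul_pos hs (sub_pos.2 hi)
  have p2 := mul_nonneg ht.le (sub_nonneg.2 hnn)
  linarith

/-- A chain with at most two edges does not use opposite directions. -/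
theorem IsChain.no_opposite_of_le_two {ε : ℝ} {u v : Fin 2 → ℝ} {n : ℕ} {c : ℕ → Fin 2 → ℝ}
    (hc : IsChain Q ε u v n c) (hn : n ≤ 2) (i j : ℕ) (hij : i < j) (hj : j < n)
    (s t : ℝ) (_ : 0 < s) (ht : 0 < t) :
    s • (c (i + 1) - c i) ≠ -(t • (c (j + 1) - c j)) := by
  intro he
  have hi : i = 0 := by omega
  have hj' : j = 1 := by omega
  subst hi hj'
  have hN0 := hc.neighbors 0 (by omega)
  have hN1 := hc.neighbors 1 hj
  refine cross_ne_zero_of_extreme hN0.1 hN0.2.1 hN1.2.1 hN0.2.2.1 (fun h => ?_) hN1.2.2.1 ?_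
  · have := hc.inj 0 2 (by omega) (by omega) h
    omega
  · have e0 := congrFun he 0
    have e1 := congrFun he 1
    simp only [Pi.smul_apply, Pi.sub_apply, Pi.neg_apply, smul_eq_mul, zero_add,
      one_add_one_eq_two] at e0 e1 ⊢
    have : t * cross (c 0) (c 1) (c 2) = 0 := by
      unfold cross
      linear_combination (c 1 0 - c 0 0) * e1 - (c 1 1 - c 0 1) * e0
    exact (mul_eq_zero.1 this).resolve_left ht.ne'

/-! ### Upper bounds for polygons -/

/-- Every ray from a point of a compact set has a last point in the set. -/
theorem exists_last_mem {P : Set (Fin 2 → ℝ)} (hP : IsCompact P) {x d : Fin 2 → ℝ} (hx : x ∈ P)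
    (hd : d ≠ 0) : ∃ α : ℝ, 0 ≤ α ∧ x + α • d ∈ P ∧ ∀ a, α < a → x + a • d ∉ P := by
  set S : Set ℝ := {α | 0 ≤ α ∧ x + α • d ∈ P} with hS
  obtain ⟨R, hR⟩ := hP.isBounded.exists_norm_le
  have hbdd : BddAbove S := by
    refine ⟨2 * R / ‖d‖, ?_⟩
    rintro α ⟨hα, hα'⟩
    rw [le_div_iff₀ (norm_pos_iff.2 hd)]
    have h1 : ‖α • d‖ = α * ‖d‖ := by rw [norm_smul, Real.norm_of_nonneg hα]
    have h2 : ‖α • d‖ ≤ ‖x + α • d‖ + ‖x‖ := by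
      have : α • d = (x + α • d) - x := by abel
      rw [this]; exact norm_sub_le _ _ |>.trans (by simp)
    linarith [hR _ hα', hR _ hx]
  have hcl : IsClosed S := by
    refine isClosed_Ici.inter (hP.isClosed.preimage (f := fun α : ℝ => x + α • d) ?_)
    fun_prop
  have hmem := hcl.csSup_mem ⟨0, by simp [hS, hx]⟩ hbdd
  refine ⟨sSup S, hmem.1, hmem.2, fun a ha ha' => ?_⟩
  exact absurd (le_csSup hbdd ⟨hmem.1.trans ha.le, ha'⟩) (not_le.2 ha)

/-- The polyhedron with one further inequality. -/
def addRow (Q : HPolyhedron 2) (r : Fin 2 → ℤ) (e : ℝ) : HPolyhedron 2 where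
  mA := Q.mA
  mB := Q.mB + 1
  A := Q.A
  B := Fin.cons (α := fun _ => Fin 2 → ℤ) r Q.B
  b := Q.b
  d := Fin.cons (α := fun _ => ℝ) e Q.d

theorem mem_carrier_addRow {r : Fin 2 → ℤ} {e : ℝ} {z : Fin 2 → ℝ} :
    z ∈ (Q.addRow r e).carrier ↔ z ∈ Q.carrier ∧ r 0 * z 0 + r 1 * z 1 ≤ e := by
  have h1 : (Q.addRow r e).eqs z = Q.eqs z := rfl
  have h2 : (∀ i, (Q.addRow r e).ineqs z i ≤ (Q.addRow r e).d i) ↔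
      r 0 * z 0 + r 1 * z 1 ≤ e ∧ ∀ i, Q.ineqs z i ≤ Q.d i := by
    simp only [ineqs_apply]
    exact Fin.forall_fin_succ
  simp only [carrier, Set.mem_ofPred_eq, h1, h2]
  exact ⟨fun h => ⟨⟨h.1, h.2.2⟩, h.2.1⟩, fun h => ⟨h.1.1, h.2, h.1.2⟩⟩

theorem Aligned.of_addRow {r : Fin 2 → ℤ} {e : ℝ} {z g : Fin 2 → ℝ}
    (h : (Q.addRow r e).Aligned z) (hg : Q.Aligned g) (hg0 : g ≠ 0)
    (hrg : r 0 * g 0 + r 1 * g 1 = 0) : Q.Aligned z := by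
  obtain ⟨h0, h1 | ⟨i, hi, hi0⟩⟩ := h
  · exact ⟨h0, Or.inl h1⟩
  · rw [ineqs_apply] at hi0
    refine Fin.cases (fun hi hi0 => ?_) (fun j hi hi0 => ?_) i hi hi0
    · have hi' : r 0 ≠ 0 ∨ r 1 ≠ 0 := hi
      have hi0' : (r 0 : ℝ) * z 0 + r 1 * z 1 = 0 := hi0
      obtain ⟨c, rfl⟩ := exists_smul_of_orthogonal (a := r 0) (b := r 1) (y := z)
        (by exact_mod_cast hi') hg0 hrg hi0'
      exact hg.smul c
    · exact ⟨h0, Or.inr ⟨j, hi, by rw [ineqs_apply]; exact hi0⟩⟩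

/-- The circuit along the edge at `v` on the far side of the line through two non-neighboring
vertices `u` and `v`: the linear function `z ↦ ε * (g 1 * z 0 - g 0 * z 1)` is maximal along this
edge. -/
theorem exists_edge_circuit (hb : Bornology.IsBounded Q.carrier) {ε : ℝ} (hε : ε ≠ 0)
    {u v : Fin 2 → ℝ} (hu : u ∈ Q.vertices) (hv : v ∈ Q.vertices) (huv : u ≠ v)
    (hN : ¬ Q.Neighbors u v) :
    ∃ g : Fin 2 → ℤ, g ≠ 0 ∧ Q.Aligned (toReal g) ∧
      (∀ w ∈ Q.vertices, ε * (g 1 * w 0 - g 0 * w 1) ≤ ε * (g 1 * v 0 - g 0 * v 1)) ∧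
      ∀ w ∈ Q.vertices, w ≠ v → 0 ≤ ε * cross u v w →
        ε * (g 1 * w 0 - g 0 * w 1) < ε * (g 1 * v 0 - g 0 * v 1) := by
  obtain ⟨n, c, hc⟩ := exists_isChain hb hε hv hu huv.symm
  have hn1 : n ≠ 1 := by
    rintro rfl
    apply hN
    have := hc.neighbors 0 one_pos
    rw [hc.start_eq, zero_add, hc.end_eq] at this
    exact this.symm
  have hpos := hc.pos
  have hN1 := hc.neighbors 0 hpos
  have hside := hc.side 1 one_pos (by omega)
  have hsucc := hc.succ 0 hpos
  rw [hc.start_eq, zero_add] at hN1 hsucc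
  set b := c 1
  have hal : Q.Aligned (v - b) := by simpa using hN1.aligned.neg
  obtain ⟨g, β, hg, hβ, hgv⟩ := hal.exists_isCircuit (sub_ne_zero.2 hN1.2.2.1)
  have hgal : Q.Aligned (toReal g) := by
    have := hal.smul β⁻¹
    rwa [hgv, smul_smul, inv_mul_cancel₀ hβ.ne', one_smul] at this
  have e0 : v 0 - b 0 = β * g 0 := by simpa [toReal] using congrFun hgv 0
  have e1 : v 1 - b 1 = β * g 1 := by simpa [toReal] using congrFun hgv 1
  have key : ∀ w, β * (ε * (g 1 * w 0 - g 0 * w 1) - ε * (g 1 * v 0 - g 0 * v 1)) =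
      ε * cross v b w := by
    intro w
    unfold cross
    linear_combination ε * (w 1 - v 1) * e0 - ε * (w 0 - v 0) * e1
  have hlt : ∀ w ∈ Q.vertices, w ≠ v → w ≠ b →
      ε * (g 1 * w 0 - g 0 * w 1) < ε * (g 1 * v 0 - g 0 * v 1) := by
    intro w hw h1 h2
    have h3 := hsucc w hw h1 h2
    rw [← key] at h3
    by_contra hcon
    push Not at hcon
    have := mul_nonneg hβ.le (sub_nonneg.2 hcon)
    linarith
  have hbeq : ε * (g 1 * b 0 - g 0 * b 1) = ε * (g 1 * v 0 - g 0 * v 1) := by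
    have h1 := key b
    have h2 : ε * cross v b b = 0 := by unfold cross; ring
    rw [h2] at h1
    have := (mul_eq_zero.1 h1).resolve_left hβ.ne'
    linarith
  refine ⟨g, hg.2.1, hgal, fun w hw => ?_, fun w hw hwv hs => hlt w hw hwv ?_⟩
  · by_cases h1 : w = v
    · rw [h1]
    · by_cases h2 : w = b
      · rw [h2, hbeq]
      · exact (hlt w hw h1 h2).le
  · intro hwb
    have : cross v u b = -cross u v b := by unfold cross; ring
    rw [this] at hside
    rw [hwb] at hs
    linarith

/-- If the line through `u` in the direction of `g` does not enter the polyhedron on one side of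
the line through `u` and `v`, then `u` is strictly minimal on that side. -/
theorem lt_of_no_ray {ε σ : ℝ} (hσ : σ * σ = 1) {u v : Fin 2 → ℝ} {g : Fin 2 → ℤ} (hg : g ≠ 0)
    (hε : ε ≠ 0) (hv : v ∈ Q.carrier)
    (huv : ε * (g 1 * u 0 - g 0 * u 1) < ε * (g 1 * v 0 - g 0 * v 1))
    (hno : ∀ α : ℝ, 0 < α → u + (σ * α) • toReal g ∉ Q.carrier) {z : Fin 2 → ℝ}
    (hz : z ∈ Q.carrier) (hs : 0 < σ * (ε * cross u v z)) :
    ε * (g 1 * u 0 - g 0 * u 1) < ε * (g 1 * z 0 - g 0 * z 1) := by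
  by_contra hcon
  push Not at hcon
  set U := ε * (g 1 * u 0 - g 0 * u 1) with hU
  set V := ε * (g 1 * v 0 - g 0 * v 1) with hV
  set Z := ε * (g 1 * z 0 - g 0 * z 1) with hZ
  have hVZ : 0 < V - Z := by linarith
  set t := (U - Z) / (V - Z) with ht
  have ht0 : 0 ≤ t := div_nonneg (by linarith) hVZ.le
  have ht1 : t < 1 := by rw [ht, div_lt_one hVZ]; linarith
  have htZ : t * (V - Z) = U - Z := div_mul_cancel₀ _ hVZ.ne'
  set x : Fin 2 → ℝ := (1 - t) • z + t • v with hx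
  have hxP : x ∈ Q.carrier := convex_carrier Q hz hv (by linarith) ht0 (by ring)
  have hx0 : x 0 = (1 - t) * z 0 + t * v 0 := by simp [hx]
  have hx1 : x 1 = (1 - t) * z 1 + t * v 1 := by simp [hx]
  have hdet : (g 1 : ℝ) * (x - u) 0 + (-(g 0 : ℝ)) * (x - u) 1 = 0 := by
    apply mul_left_cancel₀ hε
    simp only [Pi.sub_apply, hx0, hx1]
    rw [hU, hV, hZ] at htZ
    linear_combination htZ
  obtain ⟨c, hc⟩ := exists_smul_of_orthogonal (a := g 1) (b := -(g 0 : ℝ)) (x := toReal g)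
    (y := x - u) (by
      by_contra h
      push Not at h
      apply hg
      have h0 : (g 0 : ℝ) = 0 := by linarith [h.2]
      have h1 := h.1
      funext i
      fin_cases i
      · exact_mod_cast h0
      · exact_mod_cast h1) (toReal_ne_zero hg) (by simp only [toReal]; ring) hdet
  have hxc : x = u + c • toReal g := by rw [← hc]; abel
  have hf : σ * (ε * cross u v x) = (1 - t) * (σ * (ε * cross u v z)) := by
    unfold cross; rw [hx0, hx1]; ring
  have hf' : ε * cross u v x = c * (V - U) := by
    rw [hxc, hU, hV]; unfold cross
    simp only [Pi.add_apply, Pi.smul_apply, smul_eq_mul, toReal]; ring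
  have hpos : 0 < σ * c * (V - U) := by
    rw [hf'] at hf
    have := mul_pos (show 0 < 1 - t by linarith) hs
    linarith
  have hσc : 0 < σ * c := by
    by_contra h
    push Not at h
    have := mul_nonpos_of_nonpos_of_nonneg h (sub_nonneg.2 huv.le)
    linarith
  apply hno _ hσc
  rw [← mul_assoc, hσ, one_mul, ← hxc]
  exact hxP

/-- A chain that leaves `u` on a side that the line through `u` in the direction of the edge
circuit `g` avoids does not use opposite directions. -/
theorem IsChain.no_opposite_of_no_ray {ε σ : ℝ} (hσ : σ * σ = 1) {u v : Fin 2 → ℝ}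
    {g : Fin 2 → ℤ} (hg : g ≠ 0) (hε : ε ≠ 0) (hu : u ∈ Q.vertices) (hv : v ∈ Q.vertices)
    (hmax : ∀ w ∈ Q.vertices, ε * (g 1 * w 0 - g 0 * w 1) ≤ ε * (g 1 * v 0 - g 0 * v 1))
    (huv : ε * (g 1 * u 0 - g 0 * u 1) < ε * (g 1 * v 0 - g 0 * v 1))
    (hno : ∀ α : ℝ, 0 < α → u + (σ * α) • toReal g ∉ Q.carrier) {n : ℕ} {c : ℕ → Fin 2 → ℝ}
    (hc : IsChain Q (σ * ε) u v n c) (i j : ℕ) (hij : i < j) (hj : j < n)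
    (s t : ℝ) (hs : 0 < s) (ht : 0 < t) :
    s • (c (i + 1) - c i) ≠ -(t • (c (j + 1) - c j)) := by
  have hcV : ∀ i ≤ n, c i ∈ Q.vertices := by
    intro i hi
    rcases hi.lt_or_eq with h | rfl
    · exact (hc.neighbors i h).1
    · rw [hc.end_eq]; exact hv
  refine hc.no_opposite hu hv (p := ε * g 1) (q := -(ε * g 0)) (fun i hi hin => ?_)
    (fun i hi => ?_) i j hij hj s t hs ht
  · rcases hin.lt_or_eq with h | rfl
    · have := lt_of_no_ray hσ hg hε hv.1 huv hno (hcV i hin).1 (by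
        have := hc.side i hi h
        rwa [mul_assoc] at this)
      linarith
    · rw [hc.end_eq]; linarith
  · have := hmax _ (hcV i hi)
    linarith

/-- A line through a vertex that enters the polyhedron on one side does not on the other. -/
theorem no_ray_neg {u : Fin 2 → ℝ} (hu : u ∈ Q.vertices) {g : Fin 2 → ℤ} (hg : g ≠ 0) {α : ℝ}
    (hα : 0 < α) (h : u + α • toReal g ∈ Q.carrier) (a : ℝ) (ha : 0 < a) :
    u + ((-1) * a) • toReal g ∉ Q.carrier := by
  intro h'
  refine toReal_ne_zero hg (eq_zero_of_mem_extremePoints hu hα ha h ?_)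
  have : u - a • toReal g = u + ((-1) * a) • toReal g := by module
  rwa [this]

/-- An extreme point of a part of the polyhedron cut off by a line is a vertex, unless it lies on
that line. -/
theorem mem_vertices_of_addRow {r : Fin 2 → ℤ} {e : ℝ} {z : Fin 2 → ℝ}
    (hz : z ∈ (Q.addRow r e).vertices) (hlt : r 0 * z 0 + r 1 * z 1 < e) : z ∈ Q.vertices := by
  have hzP := (mem_carrier_addRow.1 hz.1).1
  have key : ∀ x ∈ Q.carrier, ∃ s : ℝ, 0 < s ∧ z + s • (x - z) ∈ (Q.addRow r e).carrier := by
    intro x hx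
    set δ := r 0 * (x 0 - z 0) + r 1 * (x 1 - z 1)
    set γ := e - (r 0 * z 0 + r 1 * z 1)
    have hγ : 0 < γ := sub_pos.2 hlt
    have hden : 0 < |δ| + γ := by positivity
    refine ⟨γ / (|δ| + γ), by positivity, mem_carrier_addRow.2 ⟨?_, ?_⟩⟩
    · have hle : γ / (|δ| + γ) ≤ 1 := by
        rw [div_le_one hden]; linarith [abs_nonneg δ]
      have : z + (γ / (|δ| + γ)) • (x - z) =
          (1 - γ / (|δ| + γ)) • z + (γ / (|δ| + γ)) • x := by module
      rw [this]
      exact convex_carrier Q hzP hx (by linarith) (by positivity) (by ring)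
    · simp only [Pi.add_apply, Pi.smul_apply, Pi.sub_apply, smul_eq_mul]
      have h1 : γ / (|δ| + γ) * δ ≤ γ := by
        rw [div_mul_eq_mul_div, div_le_iff₀ hden]
        nlinarith [le_abs_self δ]
      have h2 : γ / (|δ| + γ) * δ = γ / (|δ| + γ) * (r 0 * (x 0 - z 0) + r 1 * (x 1 - z 1)) := rfl
      have h3 : γ = e - (r 0 * z 0 + r 1 * z 1) := rfl
      linarith
  refine mem_extremePoints_iff_left.2 ⟨hzP, fun x hx y hy hxy => ?_⟩
  obtain ⟨a, b, ha, hb, hab, hzab⟩ := hxy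
  obtain ⟨s, hs, hs'⟩ := key x hx
  obtain ⟨t, ht, ht'⟩ := key y hy
  have hyx : y - z = -((a / b) • (x - z)) := by
    have hb' := hb.ne'
    have ha' : a = 1 - b := by linarith
    rw [← hzab, ha']
    apply plane_ext <;>
    · simp only [Pi.add_apply, Pi.smul_apply, Pi.sub_apply, Pi.neg_apply, smul_eq_mul]
      field_simp; ring
  have := eq_zero_of_mem_extremePoints hz (w := x - z) (s := s) (t := t * (a / b)) hs
    (by positivity) hs' (by
      rw [hyx, smul_neg, ← sub_eq_add_neg, smul_smul] at ht'
      exact ht')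
  exact sub_eq_zero.1 this

theorem mem_vertices_addRow {r : Fin 2 → ℤ} {e : ℝ} {z : Fin 2 → ℝ}
    (hz : z ∈ Q.vertices) (hle : r 0 * z 0 + r 1 * z 1 ≤ e) : z ∈ (Q.addRow r e).vertices :=
  inter_extremePoints_subset_extremePoints_of_subset
    (fun _ h => (mem_carrier_addRow.1 h).1) ⟨mem_carrier_addRow.2 ⟨hz.1, hle⟩, hz⟩

/-- On each side of the line through two vertices there is a feasible maximal walk without
opposite or repeated circuits that is at most as long as the edge path on that side. If this edge
path itself is not suitable, the walk first follows the direction of the edge at `v` on the other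
side until it hits the boundary; the part of the polygon cut off by this first step is then
traversed along its edges. -/
theorem exists_fmbr_walk (hb : Bornology.IsBounded Q.carrier) {ε : ℤ} (hε : ε ≠ 0)
    {u v : Fin 2 → ℝ} (hu : u ∈ Q.vertices) (hv : v ∈ Q.vertices) (huv : u ≠ v) :
    ∃ W : CircuitWalk Q u v, W.length ≤ {w ∈ Q.vertices | 0 < ε * cross u v w}.ncard + 1 ∧
      W.IsFeasible ∧ W.IsMaximal ∧ W.NonBackwards ∧ W.NonRepetitive := by
  have hεR : (ε : ℝ) ≠ 0 := by exact_mod_cast hε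
  by_cases hN : Q.Neighbors u v
  · obtain ⟨W, h1, _, h2, h3, h4, h5⟩ := exists_circuitWalk_of_edge_path (Q := Q) (u := u) (v := v)
      (n := 1) (c := fun i => if i = 0 then u else v) (by simp) (by simp)
      (fun i hi => by
        obtain rfl : i = 0 := by omega
        simpa using hN)
      (fun i j hi hj h => by
        rcases Nat.le_one_iff_eq_zero_or_eq_one.1 hi with rfl | rfl <;>
          rcases Nat.le_one_iff_eq_zero_or_eq_one.1 hj with rfl | rfl <;> simp at h ⊢
        · exact huv h
        · exact huv h.symm)
    exact ⟨W, by omega, h2, h3, h5 fun i j hij hj => by omega, h4⟩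
  obtain ⟨g, hg, hgal, hmax, hlt⟩ := exists_edge_circuit hb hεR hu hv huv hN
  have hcuu : (ε : ℝ) * cross u v u = 0 := by unfold cross; ring
  have hψ := hlt u hu huv hcuu.ge
  obtain ⟨n, c, hc⟩ := exists_isChain hb hεR hu hv huv
  by_cases hray : ∀ α : ℝ, 0 < α → u + (1 * α) • toReal g ∉ Q.carrier
  · obtain ⟨W, h1, _, h2, h3, h4, h5⟩ := exists_circuitWalk_of_edge_path hc.start_eq hc.end_eq
      hc.neighbors hc.inj
    refine ⟨W, by rw [h1]; exact hc.length_le, h2, h3, h5 ?_, h4⟩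
    exact IsChain.no_opposite_of_no_ray (one_mul 1) hg hεR hu hv hmax hψ hray
      (by rw [one_mul]; exact hc)
  push Not at hray
  obtain ⟨α₀, hα₀, hα₀P⟩ := hray
  rw [one_mul] at hα₀P
  obtain ⟨α, hα, hyP, hlast⟩ := exists_last_mem (isCompact_carrier hb) hu.1 (toReal_ne_zero hg)
  have hαpos : 0 < α := by
    by_contra h
    exact hlast α₀ (by linarith) hα₀P
  set y : Fin 2 → ℝ := u + α • toReal g with hy
  set ψ : (Fin 2 → ℝ) → ℝ := fun z => ε * (g 1 * z 0 - g 0 * z 1) with hψdef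
  have hψuv : ψ u < ψ v := hψ
  have hψy : ψ y = ψ u := by
    simp only [hψdef, hy, Pi.add_apply, Pi.smul_apply, smul_eq_mul, toReal]; ring
  have hcrossy : ∀ w, (ε : ℝ) * cross u w y = α * (ψ w - ψ u) := by
    intro w
    simp only [hψdef, hy]; unfold cross
    simp only [Pi.add_apply, Pi.smul_apply, smul_eq_mul, toReal]; ring
  have hfy : 0 < (ε : ℝ) * cross u v y := by
    rw [hcrossy]; exact mul_pos hαpos (sub_pos.2 hψuv)
  have hcuy : u ≠ y := fun h => by rw [← h, hcuu] at hfy; exact lt_irrefl _ hfy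
  have hside0 : ∀ w w' : Fin 2 → ℝ, (ε : ℝ) * cross w w' w = 0 ∧ (ε : ℝ) * cross w w' w' = 0 := by
    intro w w'; unfold cross; constructor <;> ring
  -- a first step of a chain from `u` that rises above the level of `u` would leave `y` outside
  have hfirst : ∀ (R : HPolyhedron 2), Bornology.IsBounded R.carrier → y ∈ R.carrier →
      ∀ w ∈ R.vertices, (∀ z ∈ R.vertices, z ≠ u → z ≠ w → (ε : ℝ) * cross u w z < 0) →
      ψ w ≤ ψ u := by
    intro R hRb hyR w _ hs
    rw [carrier_eq_convexHull hRb] at hyR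
    have h1 := (mem_convexHull_of_affine_eq_zero (f := fun z => (ε : ℝ) * cross u w z)
      (cross_affine ε u w) (fun z hz => by
      by_cases h1 : z = u
      · rw [h1, (hside0 u w).1]
      · by_cases h2 : z = w
        · rw [h2, (hside0 u w).2]
        · exact (hs z hz h1 h2).le) hyR).1
    change (ε : ℝ) * cross u w y ≤ 0 at h1
    rw [hcrossy] at h1
    by_contra hcon
    push Not at hcon
    have := mul_pos hαpos (sub_pos.2 hcon)
    linarith
  -- the part of the polygon above the first step
  set r : Fin 2 → ℤ := ![-(ε * g 1), ε * g 0] with hr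
  have hrψ : ∀ z : Fin 2 → ℝ, (r 0 : ℝ) * z 0 + r 1 * z 1 = -ψ z := by
    intro z; simp only [hr, hψdef, Matrix.cons_val_zero, Matrix.cons_val_one]; push_cast; ring
  set R := Q.addRow r (-ψ u) with hR
  have hmemR : ∀ z, z ∈ R.carrier ↔ z ∈ Q.carrier ∧ ψ u ≤ ψ z := by
    intro z; rw [hR, mem_carrier_addRow, hrψ, neg_le_neg_iff]
  have hRb : Bornology.IsBounded R.carrier := hb.subset fun z hz => ((hmemR z).1 hz).1
  have huR : u ∈ R.vertices := mem_vertices_addRow hu (by rw [hrψ])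
  have hvR : v ∈ R.vertices := mem_vertices_addRow hv (by rw [hrψ]; linarith)
  have hyR : y ∈ R.carrier := (hmemR y).2 ⟨hyP, hψy.ge⟩
  have hRV : ∀ z ∈ R.vertices, ψ u < ψ z → z ∈ Q.vertices := by
    intro z hz h
    exact mem_vertices_of_addRow hz (by rw [hrψ]; linarith)
  have hRlevel : ∀ z ∈ R.vertices, z ≠ u → z ≠ y → ψ u < ψ z := by
    intro z hz hzu hzy
    obtain ⟨hzQ, hzle⟩ := (hmemR z).1 hz.1
    refine hzle.lt_of_ne fun heq => ?_
    have hdet : cross u y z = 0 := by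
      have h1 : (ε : ℝ) * cross u y z = α * (ψ u - ψ z) := by
        simp only [hψdef, hy]; unfold cross
        simp only [Pi.add_apply, Pi.smul_apply, smul_eq_mul, toReal]; ring
      rw [heq, sub_self, mul_zero] at h1
      exact (mul_eq_zero.1 h1).resolve_left hεR
    obtain ⟨τ, hτ⟩ := exists_eq_add_smul_of_cross_eq_zero hcuy hdet
    have hτ' : z = u + (τ * α) • toReal g := by
      rw [hτ, hy]; module
    have hne : y - u ≠ 0 := sub_ne_zero.2 hcuy.symm
    rcases lt_trichotomy τ 0 with h | h | h
    · refine hne (eq_zero_of_mem_extremePoints hu (s := 1) (t := -τ) one_pos (by linarith) ?_ ?_)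
      · simpa using hyP
      · have : u - -τ • (y - u) = z := by rw [hτ]; module
        rw [this]; exact hzQ
    · apply hzu; rw [hτ, h]; module
    · rcases lt_trichotomy τ 1 with h' | h' | h'
      · refine hne (eq_zero_of_mem_extremePoints hz (s := 1 - τ) (t := τ) (by linarith) h ?_ ?_)
        · have : z + (1 - τ) • (y - u) = y := by rw [hτ]; module
          rw [this]; exact hyR
        · have : z - τ • (y - u) = u := by rw [hτ]; module
          rw [this]; exact huR.1
      · apply hzy; rw [hτ, h']; module
      · refine hlast (τ * α) ?_ (by rw [← hτ']; exact hzQ)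
        nlinarith
  obtain ⟨m, e, he⟩ := exists_isChain hRb hεR huR hvR huv
  have hm1 := he.neighbors 0 he.pos
  have hs1 := he.succ 0 he.pos
  rw [he.start_eq, zero_add] at hm1 hs1
  have he1 : e 1 = y := by
    by_contra hne
    have h1 := hRlevel _ hm1.2.1 hm1.2.2.1.symm hne
    exact absurd (hfirst R hRb hyR _ hm1.2.1 hs1) (not_le.2 h1)
  have hm2 : 1 < m := by
    rcases (show 1 ≤ m from he.pos).eq_or_lt with h | h
    · exfalso
      have h1 := he.end_eq
      rw [← h, he1] at h1
      rw [h1] at hψy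
      linarith
    · exact h
  have heV : ∀ i ≤ m, e i ∈ R.vertices := by
    intro i hi
    rcases hi.lt_or_eq with h | rfl
    · exact (he.neighbors i h).1
    · rw [he.end_eq]; exact hvR
  have hne : ∀ k l, k ≤ m → l ≤ m → k ≠ l → e k ≠ e l := fun k l hk hl hkl h =>
    hkl (he.inj k l hk hl h)
  have hlev : ∀ i, 2 ≤ i → i ≤ m → ψ u < ψ (e i) := by
    intro i h2 hi
    refine hRlevel _ (heV i hi) ?_ ?_
    · rw [← he.start_eq]; exact hne _ _ hi (by omega) (by omega)
    · rw [← he1]; exact hne _ _ hi (by omega) (by omega)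
  have hψmax : ∀ i, 1 ≤ i → i < m → ψ (e i) < ψ v := by
    intro i h1 hi
    rcases h1.eq_or_lt with h | h
    · rw [← h, he1, hψy]; exact hψuv
    · refine hlt _ (hRV _ (heV i hi.le) (hlev i h hi.le)) ?_ (he.side i (by omega) hi).le
      rw [← he.end_eq]; exact hne _ _ hi.le le_rfl hi.ne
  have hψstep : ∀ i, 1 ≤ i → i < m → ψ (e i) < ψ (e (i + 1)) := by
    intro i h1 hi
    rcases (show i + 1 ≤ m from hi).eq_or_lt with h | h
    · rw [h, he.end_eq]; exact hψmax i h1 hi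
    · have := he.lt_of_step huR hvR (p := ε * g 1) (q := -(ε * g 0)) h1 h
        (by have := hlev (i + 1) (by omega) h.le
            simp only [hψdef] at this; linarith)
        (by have := hψmax i h1 hi
            simp only [hψdef] at this; linarith)
      simp only [hψdef]; linarith
  have hψ0 : ψ (e 0) = ψ (e 1) := by rw [he.start_eq, he1, hψy]
  have hgr : (r 0 : ℝ) * toReal g 0 + r 1 * toReal g 1 = 0 := by
    rw [hrψ]; simp only [hψdef, toReal]; ring
  obtain ⟨W, h1, _, h2, h3, h4, h5⟩ := exists_circuitWalk_of_seq (Q := Q) m e he.start_eq he.end_eq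
    (fun i hi => (he.neighbors i hi).aligned.of_addRow hgal (toReal_ne_zero hg) hgr)
    (fun i hi => (he.neighbors i hi).2.2.1)
  refine ⟨W, ?_, h2 fun i hi => ((hmemR _).1 (heV i hi.le).1).1, h3 ?_, h5 ?_, h4 ?_⟩
  · -- the first vertex of the edge path on this side is cut off
    have hn1 := hc.neighbors 0 hc.pos
    have hn2 := hc.succ 0 hc.pos
    rw [hc.start_eq, zero_add] at hn1 hn2
    have hlow : ψ (c 1) ≤ ψ u := hfirst Q hb hyP _ hn1.2.1 hn2
    have hcn : 1 < n := by
      rcases (show 1 ≤ n from hc.pos).eq_or_lt with h | h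
      · exfalso
        have h1 := hc.end_eq
        rw [← h] at h1
        rw [h1] at hlow
        linarith
      · exact h
    have hc1 : c 1 ∈ {w ∈ Q.vertices | 0 < (ε : ℝ) * cross u v w} :=
      ⟨hn1.2.1, hc.side 1 one_pos hcn⟩
    have hfin : {w ∈ Q.vertices | 0 < (ε : ℝ) * cross u v w}.Finite :=
      (finite_vertices Q).subset (Set.sep_subset _ _)
    have hsub : {w ∈ R.vertices | 0 < (ε : ℝ) * cross u v w} ⊆
        insert y ({w ∈ Q.vertices | 0 < (ε : ℝ) * cross u v w} \ {c 1}) := by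
      rintro z ⟨hz, hzs⟩
      by_cases hzy : z = y
      · exact Or.inl hzy
      · right
        have hzu : z ≠ u := by
          rintro rfl
          rw [hcuu] at hzs
          exact lt_irrefl _ hzs
        have hzl := hRlevel z hz hzu hzy
        refine ⟨⟨hRV z hz hzl, hzs⟩, ?_⟩
        rintro rfl
        linarith
    have e1 := Set.ncard_le_ncard hsub ((hfin.subset Set.sdiff_subset).insert y)
    have e2 := Set.ncard_insert_le y ({w ∈ Q.vertices | 0 < (ε : ℝ) * cross u v w} \ {c 1})
    have e3 := Set.ncard_sdiff_singleton_add_one hc1 hfin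
    have e4 := he.length_le
    omega
  · intro i hi a ha
    rcases Nat.eq_zero_or_pos i with rfl | hi0
    · rw [he.start_eq, zero_add, he1]
      have : u + a • (y - u) = u + (a * α) • toReal g := by rw [hy]; module
      rw [this]
      apply hlast
      nlinarith
    · refine notMem_of_end_extreme ((hmemR _).1 (heV i hi.le).1).1
        (hRV _ (heV (i + 1) hi) (hlev _ (by omega) hi))
        (sub_ne_zero.2 (he.neighbors i hi).2.2.1.symm) one_pos (one_smul ℝ _).symm ha
  · intro i j hij hj s t hs ht hst
    have e0 := congrFun hst 0
    have e1 := congrFun hst 1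
    simp only [Pi.smul_apply, Pi.sub_apply, Pi.neg_apply, smul_eq_mul] at e0 e1
    have hE : s * (ψ (e (i + 1)) - ψ (e i)) = -(t * (ψ (e (j + 1)) - ψ (e j))) := by
      simp only [hψdef]
      linear_combination ε * g 1 * e0 - ε * g 0 * e1
    have p1 : 0 ≤ s * (ψ (e (i + 1)) - ψ (e i)) := by
      apply mul_nonneg hs.le
      rcases Nat.eq_zero_or_pos i with rfl | hi0
      · rw [zero_add, hψ0, sub_self]
      · linarith [hψstep i hi0 (by omega)]
    have p2 : 0 < t * (ψ (e (j + 1)) - ψ (e j)) :=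
      mul_pos ht (sub_pos.2 (hψstep j (by omega) hj))
    linarith
  · intro i j hij hj s t hs ht
    exact edge_path_directions he.neighbors he.inj hij hj hs ht

/-- At least one of the two edge paths between two vertices uses no opposite directions. -/
theorem exists_chain_no_opposite (hb : Bornology.IsBounded Q.carrier)
    {u v : Fin 2 → ℝ} (hu : u ∈ Q.vertices) (hv : v ∈ Q.vertices) (huv : u ≠ v)
    (hN : ¬ Q.Neighbors u v) : ∃ σ : ℝ, σ * σ = 1 ∧ ∀ n c, IsChain Q σ u v n c → ∀ i j, i < j →
      j < n → ∀ s t : ℝ, 0 < s → 0 < t → s • (c (i + 1) - c i) ≠ -(t • (c (j + 1) - c j)) := by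
  obtain ⟨g, hg, _, hmax, hlt⟩ := exists_edge_circuit hb (one_ne_zero (α := ℝ)) hu hv huv hN
  have hcuu : (1 : ℝ) * cross u v u = 0 := by unfold cross; ring
  have hψ := hlt u hu huv hcuu.ge
  by_cases hray : ∀ α : ℝ, 0 < α → u + (1 * α) • toReal g ∉ Q.carrier
  · refine ⟨1, one_mul 1, fun n c hc => ?_⟩
    exact IsChain.no_opposite_of_no_ray (one_mul 1) hg one_ne_zero hu hv hmax hψ hray
      (by rw [one_mul]; exact hc)
  · push Not at hray
    obtain ⟨α, hα, hα'⟩ := hray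
    rw [one_mul] at hα'
    refine ⟨-1, by norm_num, fun n c hc => ?_⟩
    exact IsChain.no_opposite_of_no_ray (σ := -1) (by norm_num) hg one_ne_zero hu hv hmax hψ
      (no_ray_neg hu hg hα hα') (by rw [mul_one]; exact hc)

/-- Two vertices, the vertices to the left and those to the right of the line through them are
all vertices. -/
theorem ncard_sides {u v : Fin 2 → ℝ} (hu : u ∈ Q.vertices) (hv : v ∈ Q.vertices) (huv : u ≠ v) :
    {w ∈ Q.vertices | 0 < 1 * cross u v w}.ncard + {w ∈ Q.vertices | 0 < -1 * cross u v w}.ncard +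
      2 = Q.vertices.ncard := by
  have hfin := finite_vertices Q
  have h1 : Q.vertices = ({w ∈ Q.vertices | 0 < 1 * cross u v w} ∪
      {w ∈ Q.vertices | 0 < -1 * cross u v w}) ∪ {u, v} := by
    ext w
    simp only [Set.mem_union, Set.mem_ofPred_eq, Set.mem_insert_iff, Set.mem_singleton_iff]
    constructor
    · intro hw
      by_cases hwu : w = u
      · exact Or.inr (Or.inl hwu)
      by_cases hwv : w = v
      · exact Or.inr (Or.inr hwv)
      left
      rcases lt_or_gt_of_ne (cross_ne_zero_of_extreme hu hv hw huv (Ne.symm hwu) (Ne.symm hwv))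
        with h | h
      · right; exact ⟨hw, by linarith⟩
      · left; exact ⟨hw, by linarith⟩
    · rintro ((h | h) | (rfl | rfl))
      · exact h.1
      · exact h.1
      · exact hu
      · exact hv
  have hd1 : Disjoint {w ∈ Q.vertices | 0 < 1 * cross u v w}
      {w ∈ Q.vertices | 0 < -1 * cross u v w} := by
    rw [Set.disjoint_left]
    rintro w ⟨_, h⟩ ⟨_, h'⟩
    linarith
  have hd2 : Disjoint ({w ∈ Q.vertices | 0 < 1 * cross u v w} ∪
      {w ∈ Q.vertices | 0 < -1 * cross u v w}) {u, v} := by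
    rw [Set.disjoint_right]
    rintro w hw h
    have : cross u v w = 0 := by
      rcases hw with rfl | rfl
      · unfold cross; ring
      · unfold cross; ring
    rcases h with ⟨_, h⟩ | ⟨_, h⟩ <;> rw [this] at h <;> linarith
  have f1 : {w ∈ Q.vertices | 0 < 1 * cross u v w}.Finite := hfin.subset (Set.sep_subset _ _)
  have f2 : {w ∈ Q.vertices | 0 < -1 * cross u v w}.Finite := hfin.subset (Set.sep_subset _ _)
  conv_rhs => rw [h1]
  rw [Set.ncard_union_eq hd2 (f1.union f2) (Set.toFinite _), Set.ncard_union_eq hd1 f1 f2,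
    Set.ncard_pair huv]

theorem CDfmbr_le {k : ℕ} (hb : Bornology.IsBounded Q.carrier) (hk : Q.vertices.ncard = k)
    {u v : Fin 2 → ℝ} (hu : u ∈ Q.vertices) (hv : v ∈ Q.vertices) (huv : u ≠ v) :
    Q.CDfmbr u v ≤ ((k / 2 : ℕ) : ℕ∞) := by
  have hs := ncard_sides hu hv huv
  obtain ⟨W, hW, hp⟩ := exists_fmbr_walk hb (one_ne_zero (α := ℤ)) hu hv huv
  obtain ⟨W', hW', hp'⟩ := exists_fmbr_walk hb (show (-1 : ℤ) ≠ 0 by norm_num) hu hv huv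
  push_cast at hW hW'
  rcases (show W.length ≤ k / 2 ∨ W'.length ≤ k / 2 by omega) with h | h
  · exact (circuitDist_le W hp).trans (by exact_mod_cast h)
  · exact (circuitDist_le W' hp').trans (by exact_mod_cast h)

theorem CDefm_le {k : ℕ} (hb : Bornology.IsBounded Q.carrier) (hk : Q.vertices.ncard = k)
    {u v : Fin 2 → ℝ} (hu : u ∈ Q.vertices) (hv : v ∈ Q.vertices) (huv : u ≠ v) :
    Q.CDefm u v ≤ ((k / 2 : ℕ) : ℕ∞) := by
  have hs := ncard_sides hu hv huv
  have key : ∀ ε : ℝ, ε ≠ 0 → Q.CDefm u v ≤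
      (({w ∈ Q.vertices | 0 < ε * cross u v w}.ncard + 1 : ℕ) : ℕ∞) := by
    intro ε hε
    obtain ⟨n, c, hc⟩ := exists_isChain hb hε hu hv huv
    obtain ⟨W, h1, he, h2, h3, _, _⟩ := exists_circuitWalk_of_edge_path hc.start_eq hc.end_eq
      hc.neighbors hc.inj
    refine (circuitDist_le W ⟨he, h2, h3⟩).trans ?_
    rw [h1]
    exact_mod_cast hc.length_le
  have h1 := key 1 one_ne_zero
  have h2 := key (-1) (by norm_num)
  rcases (show {w ∈ Q.vertices | 0 < 1 * cross u v w}.ncard + 1 ≤ k / 2 ∨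
      {w ∈ Q.vertices | 0 < -1 * cross u v w}.ncard + 1 ≤ k / 2 by omega) with h | h
  · exact h1.trans (by exact_mod_cast h)
  · exact h2.trans (by exact_mod_cast h)

/-- If both chains have at least three edges, then each has at most `k - 3` of the `k` edges, and
one of them is non-backwards. A chain with at most two edges always is, and `2 ≤ k - 3`. -/
theorem CDefmb_le {k : ℕ} (hb : Bornology.IsBounded Q.carrier) (hk : Q.vertices.ncard = k)
    (hk5 : 5 ≤ k) {u v : Fin 2 → ℝ} (hu : u ∈ Q.vertices) (hv : v ∈ Q.vertices) (huv : u ≠ v) :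
    Q.CDefmb u v ≤ ((k - 3 : ℕ) : ℕ∞) := by
  have hs := ncard_sides hu hv huv
  -- every chain without opposite directions that is short enough will do
  have key : ∀ ε n c, IsChain Q ε u v n c → n ≤ k - 3 → (∀ i j, i < j →
      j < n → ∀ s t : ℝ, 0 < s → 0 < t → s • (c (i + 1) - c i) ≠ -(t • (c (j + 1) - c j))) →
      Q.CDefmb u v ≤ ((k - 3 : ℕ) : ℕ∞) := by
    intro ε n c hc hn hop
    obtain ⟨W, h1, he, h2, h3, _, h5⟩ := exists_circuitWalk_of_edge_path hc.start_eq hc.end_eq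
      hc.neighbors hc.inj
    refine (circuitDist_le W ⟨he, h2, h3, h5 hop⟩).trans ?_
    rw [h1]
    exact_mod_cast hn
  obtain ⟨n, c, hc⟩ := exists_isChain hb (one_ne_zero (α := ℝ)) hu hv huv
  obtain ⟨n', c', hc'⟩ := exists_isChain hb (show (-1 : ℝ) ≠ 0 by norm_num) hu hv huv
  have l1 := hc.length_le
  have l2 := hc'.length_le
  by_cases h2 : n ≤ 2
  · exact key _ n c hc (by omega) (hc.no_opposite_of_le_two h2)
  by_cases h2' : n' ≤ 2
  · exact key _ n' c' hc' (by omega) (hc'.no_opposite_of_le_two h2')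
  by_cases hN : Q.Neighbors u v
  · obtain ⟨W, h1, he, h2, h3, _, h5⟩ := exists_circuitWalk_of_edge_path (Q := Q) (u := u) (v := v)
      (n := 1) (c := fun i => if i = 0 then u else v) (by simp) (by simp)
      (fun i hi => by
        obtain rfl : i = 0 := by omega
        simpa using hN)
      (fun i j hi hj h => by
        rcases Nat.le_one_iff_eq_zero_or_eq_one.1 hi with rfl | rfl <;>
          rcases Nat.le_one_iff_eq_zero_or_eq_one.1 hj with rfl | rfl <;> simp at h ⊢
        · exact huv h
        · exact huv h.symm)
    refine (circuitDist_le W ⟨he, h2, h3, h5 fun i j hij hj => by omega⟩).trans ?_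
    rw [h1]
    exact_mod_cast (show 1 ≤ k - 3 by omega)
  · obtain ⟨σ, hσ, hop⟩ := exists_chain_no_opposite hb hu hv huv hN
    rcases mul_self_eq_one_iff.1 hσ with rfl | rfl
    · exact key _ n c hc (by omega) (hop n c hc)
    · exact key _ n' c' hc' (by omega) (hop n' c' hc')

/-! ### Polygons from a cyclic list of edges -/

/-- The value of the linear function with integer coefficients `r` at the point `z`. -/
def dot (r : Fin 2 → ℤ) (z : Fin 2 → ℝ) : ℝ := r 0 * z 0 + r 1 * z 1

theorem dot_add (r : Fin 2 → ℤ) (x y : Fin 2 → ℝ) : dot r (x + y) = dot r x + dot r y := by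
  simp only [dot, Pi.add_apply]; ring

theorem dot_sub (r : Fin 2 → ℤ) (x y : Fin 2 → ℝ) : dot r (x - y) = dot r x - dot r y := by
  simp only [dot, Pi.sub_apply]; ring

theorem dot_smul (r : Fin 2 → ℤ) (c : ℝ) (x : Fin 2 → ℝ) : dot r (c • x) = c * dot r x := by
  simp only [dot, Pi.smul_apply, smul_eq_mul]; ring

theorem continuous_dot (r : Fin 2 → ℤ) : Continuous (dot r) := by
  unfold dot; fun_prop

/-- A description of a polygon by its edges, indexed in cyclic order by `ι`: the edge `i` is given
by the inequality `row i ⬝ z ≤ rhs i` and starts at the vertex `pt i`; it ends at `pt (nxt i)`.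
The inequality `r` is tight at exactly these two of the given points. -/
structure PolygonData (ι : Type) where
  row : ι → Fin 2 → ℤ
  rhs : ι → ℝ
  pt : ι → Fin 2 → ℝ
  nxt : ι → ι
  prev : ι → ι
  nxt_prev : ∀ i, nxt (prev i) = i
  prev_nxt : ∀ i, prev (nxt i) = i
  prev_ne : ∀ i, prev i ≠ i
  prev_prev_ne : ∀ i, prev (prev i) ≠ i
  tight : ∀ i, dot (row i) (pt i) = rhs i
  tight_prev : ∀ i, dot (row (prev i)) (pt i) = rhs (prev i)
  dot_le : ∀ r j, dot (row r) (pt j) ≤ rhs r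
  eq_or_eq : ∀ r j, dot (row r) (pt j) = rhs r → r = j ∨ r = prev j

namespace PolygonData

variable {ι : Type} (D : PolygonData ι)

/-- The point set of the polygon. -/
def carrier : Set (Fin 2 → ℝ) := {z | ∀ i, dot (D.row i) z ≤ D.rhs i}

theorem pt_mem (i : ι) : D.pt i ∈ D.carrier := fun r => D.dot_le r i

theorem pt_injective : Function.Injective D.pt := by
  intro i j h
  have h1 := D.eq_or_eq i j (by rw [← h, D.tight])
  have h2 := D.eq_or_eq j i (by rw [h, D.tight])
  rcases h1 with h1 | h1
  · exact h1
  · rcases h2 with h2 | h2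
    · exact h2.symm
    · exact absurd (by rw [← h2, ← h1]) (D.prev_prev_ne i)

theorem tight_nxt (i : ι) : dot (D.row i) (D.pt (D.nxt i)) = D.rhs i := by
  have := D.tight_prev (D.nxt i)
  rwa [D.prev_nxt] at this

theorem dot_lt {r j : ι} (h1 : r ≠ j) (h2 : r ≠ D.prev j) : dot (D.row r) (D.pt j) < D.rhs r :=
  lt_of_le_of_ne (D.dot_le r j) fun h => (D.eq_or_eq r j h).elim h1 h2

theorem prev_ne_nxt (i : ι) : D.prev i ≠ D.nxt i := fun h =>
  D.prev_prev_ne i (by rw [h, D.prev_nxt])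

theorem nxt_ne (i : ι) : D.nxt i ≠ i := fun h => D.prev_ne i (by
  have := D.prev_nxt i
  rwa [h] at this)

/-- The edge before `i` is not tight at the end of the edge `i`. -/
theorem dot_prev_lt (i : ι) : dot (D.row (D.prev i)) (D.pt (D.nxt i)) < D.rhs (D.prev i) :=
  D.dot_lt (D.prev_ne_nxt i) (by rw [D.prev_nxt]; exact D.prev_ne i)

/-- The edge after `i` is not tight at the start of the edge `i`. -/
theorem dot_nxt_lt (i : ι) : dot (D.row (D.nxt i)) (D.pt i) < D.rhs (D.nxt i) :=
  D.dot_lt (D.nxt_ne i) (D.prev_ne_nxt i).symm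

theorem row_ne_zero (i : ι) : D.row i 0 ≠ 0 ∨ D.row i 1 ≠ 0 := by
  by_contra hcon
  push Not at hcon
  have h1 := D.dot_prev_lt (D.nxt i)
  rw [D.prev_nxt, ← D.tight i] at h1
  simp [dot, hcon.1, hcon.2] at h1

theorem isClosed_carrier : IsClosed D.carrier := by
  have : D.carrier = ⋂ i, {z | dot (D.row i) z ≤ D.rhs i} := by
    ext z; simp [carrier]
  rw [this]
  exact isClosed_iInter fun i => isClosed_le (continuous_dot _) continuous_const

/-- The points where no inequality is tight are interior. -/
theorem mem_interior_of_forall_lt [Finite ι] {z : Fin 2 → ℝ}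
    (h : ∀ i, dot (D.row i) z < D.rhs i) : z ∈ interior D.carrier := by
  have ho : IsOpen (⋂ i, {z | dot (D.row i) z < D.rhs i}) :=
    isOpen_iInter_of_finite fun i => isOpen_lt (continuous_dot _) continuous_const
  refine mem_interior.2 ⟨_, ?_, ho, Set.mem_iInter.2 h⟩
  intro w hw i
  exact (Set.mem_iInter.1 hw i).le

theorem interior_nonempty [Finite ι] [Nonempty ι] : (interior D.carrier).Nonempty := by
  obtain ⟨i⟩ := ‹Nonempty ι›
  refine ⟨(3 : ℝ)⁻¹ • (D.pt i + D.pt (D.nxt i) + D.pt (D.prev i)),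
    D.mem_interior_of_forall_lt fun r => ?_⟩
  rw [dot_smul, dot_add, dot_add]
  have h1 := D.dot_le r i
  have h2 := D.dot_le r (D.nxt i)
  have h3 := D.dot_le r (D.prev i)
  suffices h : dot (D.row r) (D.pt i) < D.rhs r ∨ dot (D.row r) (D.pt (D.nxt i)) < D.rhs r ∨
      dot (D.row r) (D.pt (D.prev i)) < D.rhs r by
    rcases h with h | h | h <;> linarith
  by_cases hr : r = i
  · refine Or.inr (Or.inr (D.dot_lt ?_ ?_)) <;> rw [hr]
    · exact (D.prev_ne i).symm
    · exact (D.prev_prev_ne i).symm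
  · by_cases hr' : r = D.prev i
    · rw [hr']
      exact Or.inr (Or.inl (D.dot_prev_lt i))
    · exact Or.inl (D.dot_lt hr hr')

theorem eq_pt_of_tight {i : ι} {z : Fin 2 → ℝ} (h1 : dot (D.row i) z = D.rhs i)
    (h2 : dot (D.row (D.prev i)) z = D.rhs (D.prev i)) : z = D.pt i := by
  have ha1 : dot (D.row i) (D.pt (D.nxt i) - D.pt i) = 0 := by
    rw [dot_sub, D.tight_nxt, D.tight, sub_self]
  have ha2 : dot (D.row (D.prev i)) (D.pt (D.nxt i) - D.pt i) < 0 := by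
    rw [dot_sub, D.tight_prev]
    linarith [D.dot_prev_lt i]
  have hne : D.pt (D.nxt i) - D.pt i ≠ 0 := fun h => by
    rw [h] at ha2; simp [dot] at ha2
  obtain ⟨c, hc⟩ := exists_smul_of_orthogonal (a := D.row i 0) (b := D.row i 1)
    (by exact_mod_cast D.row_ne_zero i) hne ha1 (y := z - D.pt i) (by
      have : dot (D.row i) (z - D.pt i) = 0 := by rw [dot_sub, h1, D.tight, sub_self]
      exact this)
  have h3 : dot (D.row (D.prev i)) (z - D.pt i) = 0 := by rw [dot_sub, h2, D.tight_prev, sub_self]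
  rw [hc, dot_smul] at h3
  have hc0 := (mul_eq_zero.1 h3).resolve_right ha2.ne
  rw [hc0, zero_smul] at hc
  exact sub_eq_zero.1 hc

/-- The given points are the vertices. -/
theorem extremePoints_eq [Finite ι] [Nonempty ι] : D.carrier.extremePoints ℝ = Set.range D.pt := by
  ext z
  constructor
  · intro hz
    -- some inequality is tight at `z`
    obtain ⟨r, hr⟩ : ∃ r, dot (D.row r) z = D.rhs r := by
      by_contra hcon
      push Not at hcon
      have hint : z ∈ interior D.carrier :=
        D.mem_interior_of_forall_lt fun i => lt_of_le_of_ne (hz.1 i) (hcon i)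
      have hnhds := mem_interior_iff_mem_nhds.1 hint
      have hcont : Filter.Tendsto (fun t : ℝ => z + t • (1 : Fin 2 → ℝ)) (nhds 0) (nhds z) := by
        have : Continuous (fun t : ℝ => z + t • (1 : Fin 2 → ℝ)) := by fun_prop
        simpa using this.tendsto 0
      obtain ⟨e, he, hball⟩ := Metric.mem_nhds_iff.1 (hcont hnhds)
      have h1 : e / 2 ∈ Metric.ball (0 : ℝ) e := by
        rw [Metric.mem_ball, Real.dist_eq, sub_zero, abs_of_pos (half_pos he)]; linarith
      have h2 : -(e / 2) ∈ Metric.ball (0 : ℝ) e := by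
        rw [Metric.mem_ball, Real.dist_eq, sub_zero, abs_neg, abs_of_pos (half_pos he)]; linarith
      have := eq_zero_of_mem_extremePoints hz (half_pos he) (half_pos he) (hball h1) (by
        have := hball h2
        simpa [sub_eq_add_neg] using this)
      exact one_ne_zero this
    have ha1 : dot (D.row r) (D.pt (D.nxt r) - D.pt r) = 0 := by
      rw [dot_sub, D.tight_nxt, D.tight, sub_self]
    have hne : D.pt (D.nxt r) - D.pt r ≠ 0 :=
      sub_ne_zero.2 fun h => D.nxt_ne r (D.pt_injective h)
    obtain ⟨c, hc⟩ := exists_smul_of_orthogonal (a := D.row r 0) (b := D.row r 1)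
      (by exact_mod_cast D.row_ne_zero r) hne ha1 (y := z - D.pt r) (by
        have : dot (D.row r) (z - D.pt r) = 0 := by rw [dot_sub, hr, D.tight, sub_self]
        exact this)
    have hz' : z = D.pt r + c • (D.pt (D.nxt r) - D.pt r) := by rw [← hc]; abel
    have hc0 : 0 ≤ c := by
      have h1 := hz.1 (D.prev r)
      rw [hz', dot_add, dot_smul, dot_sub, D.tight_prev] at h1
      have h2 := D.dot_prev_lt r
      by_contra hcon
      nlinarith
    have hc1 : c ≤ 1 := by
      have h1 := hz.1 (D.nxt r)
      rw [hz', dot_add, dot_smul, dot_sub, D.tight] at h1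
      have h2 := D.dot_nxt_lt r
      by_contra hcon
      nlinarith
    have hseg : z ∈ segment ℝ (D.pt r) (D.pt (D.nxt r)) := by
      rw [segment_eq_image']
      exact ⟨c, ⟨hc0, hc1⟩, hz'.symm⟩
    rcases eq_or_eq_of_extreme_mem_segment hz (D.pt_mem r) (D.pt_mem _) hseg with h | h
    · exact ⟨r, h.symm⟩
    · exact ⟨D.nxt r, h.symm⟩
  · rintro ⟨i, rfl⟩
    refine ⟨D.pt_mem i, fun x hx y hy hseg => ?_⟩
    obtain ⟨a, b, ha, hb, hab, he⟩ := hseg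
    have key : ∀ r, dot (D.row r) (D.pt i) = D.rhs r → dot (D.row r) x = D.rhs r := by
      intro r hr
      rw [← he, dot_add, dot_smul, dot_smul] at hr
      have h1 := hx r
      have h2 := hy r
      have hb' : b = 1 - a := by linarith
      rw [hb'] at hr hb
      have : (1 - a) * dot (D.row r) y ≤ (1 - a) * D.rhs r :=
        mul_le_mul_of_nonneg_left h2 hb.le
      have h3 : a * D.rhs r ≤ a * dot (D.row r) x := by linarith
      exact le_antisymm h1 (le_of_mul_le_mul_left h3 ha)
    exact D.eq_pt_of_tight (key i (D.tight i)) (key _ (D.tight_prev i))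

/-- Two of the vertices can be neighbors only if they are consecutive: otherwise the midpoint of
the segment between them is an interior point. -/
theorem eq_nxt_of_isExtreme [Finite ι] [Nonempty ι] {i j : ι} (hij : i ≠ j)
    (h : IsExtreme ℝ D.carrier (segment ℝ (D.pt i) (D.pt j))) : j = D.nxt i ∨ i = D.nxt j := by
  by_contra hcon
  push Not at hcon
  set m := (2 : ℝ)⁻¹ • (D.pt i + D.pt j) with hm
  have hint : m ∈ interior D.carrier := D.mem_interior_of_forall_lt fun r => by
    rw [hm, dot_smul, dot_add]
    have h1 := D.dot_le r i
    have h2 := D.dot_le r j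
    suffices h : dot (D.row r) (D.pt i) < D.rhs r ∨ dot (D.row r) (D.pt j) < D.rhs r by
      rcases h with h | h <;> linarith
    by_contra hcon'
    push Not at hcon'
    have e1 := D.eq_or_eq r i (le_antisymm h1 hcon'.1)
    have e2 := D.eq_or_eq r j (le_antisymm h2 hcon'.2)
    rcases e1 with e1 | e1 <;> rcases e2 with e2 | e2
    · exact hij (e1.symm.trans e2)
    · exact hcon.1 (by rw [← e1, e2, D.nxt_prev])
    · exact hcon.2 (by rw [← e2, e1, D.nxt_prev])
    · exact hij (by rw [← D.nxt_prev i, ← e1, e2, D.nxt_prev])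
  have hnhds := mem_interior_iff_mem_nhds.1 hint
  set p := D.pt (D.nxt i) with hp
  have hcont : Filter.Tendsto (fun t : ℝ => m + t • (m - p)) (nhds 0) (nhds m) := by
    have : Continuous (fun t : ℝ => m + t • (m - p)) := by fun_prop
    simpa using this.tendsto 0
  obtain ⟨e, he, hball⟩ := Metric.mem_nhds_iff.1 (hcont hnhds)
  have h1 : e / 2 ∈ Metric.ball (0 : ℝ) e := by
    rw [Metric.mem_ball, Real.dist_eq, sub_zero, abs_of_pos (half_pos he)]; linarith
  have hq := hball h1
  have hmseg : m ∈ segment ℝ (D.pt i) (D.pt j) :=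
    ⟨2⁻¹, 2⁻¹, by norm_num, by norm_num, by norm_num, by rw [hm, smul_add]⟩
  have hopen : m ∈ openSegment ℝ p (m + (e / 2) • (m - p)) := by
    refine ⟨(e / 2) / (1 + e / 2), 1 / (1 + e / 2), by positivity, by positivity,
      by field_simp; ring, ?_⟩
    apply plane_ext <;> simp only [Pi.add_apply, Pi.smul_apply, Pi.sub_apply, smul_eq_mul] <;>
      field_simp <;> ring
  have hpseg := h.2 (D.pt_mem _) hq hmseg hopen
  have hpe : D.pt (D.nxt i) ∈ D.carrier.extremePoints ℝ := by
    rw [D.extremePoints_eq]; exact ⟨_, rfl⟩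
  rcases eq_or_eq_of_extreme_mem_segment hpe (D.pt_mem i) (D.pt_mem j) hpseg with h' | h'
  · exact D.nxt_ne i (D.pt_injective h')
  · exact hcon.1 (D.pt_injective h').symm

/-- The polygon as a polyhedron without equations and with one inequality for every edge. -/
noncomputable def toHPolyhedron [Fintype ι] : HPolyhedron 2 where
  mA := 0
  mB := Fintype.card ι
  A := fun i => i.elim0
  B := fun i => D.row ((Fintype.equivFin ι).symm i)
  b := fun i => i.elim0
  d := fun i => D.rhs ((Fintype.equivFin ι).symm i)

variable [Fintype ι]

theorem carrier_toHPolyhedron : D.toHPolyhedron.carrier = D.carrier := by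
  ext z
  constructor
  · intro h i
    have := h.2 (Fintype.equivFin ι i)
    have e : dot (D.toHPolyhedron.B (Fintype.equivFin ι i)) z ≤
        D.toHPolyhedron.d (Fintype.equivFin ι i) := (ineqs_apply _ _ _).symm.trans_le this
    simpa [toHPolyhedron] using e
  · intro h
    refine ⟨funext fun i => i.elim0, fun i => ?_⟩
    rw [ineqs_apply]
    exact h ((Fintype.equivFin ι).symm i)

theorem vertices_toHPolyhedron [Nonempty ι] : D.toHPolyhedron.vertices = Set.range D.pt := by
  rw [vertices, carrier_toHPolyhedron, extremePoints_eq]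

theorem pt_mem_vertices [Nonempty ι] (i : ι) : D.pt i ∈ D.toHPolyhedron.vertices := by
  rw [vertices_toHPolyhedron]; exact ⟨i, rfl⟩

theorem isIrredundantPolygon [Nonempty ι] (hb : Bornology.IsBounded D.carrier) {k : ℕ}
    (hk : Fintype.card ι = k) : D.toHPolyhedron.IsIrredundantPolygon k := by
  refine ⟨⟨by rwa [carrier_toHPolyhedron], ?_, ?_⟩, rfl, hk⟩
  · rw [carrier_toHPolyhedron]; exact D.interior_nonempty
  · rw [vertices_toHPolyhedron, ← Set.image_univ, Set.ncard_image_of_injective _ D.pt_injective,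
      Set.ncard_univ, Nat.card_eq_fintype_card, hk]

/-- Circuits are orthogonal to one of the rows. -/
theorem exists_row_of_isCircuit [Nonempty ι] {g : Fin 2 → ℤ} (hg : D.toHPolyhedron.IsCircuit g) :
    ∃ i, dot (D.row i) (toReal g) = 0 := by
  obtain ⟨i₀⟩ := ‹Nonempty ι›
  have h := hg.aligned ⟨Fintype.equivFin ι i₀, by
    simpa [toHPolyhedron] using D.row_ne_zero i₀⟩
  rcases h with ⟨-, ⟨i, -⟩ | ⟨i, -, hi⟩⟩
  · exact i.elim0
  · rw [ineqs_apply] at hi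
    exact ⟨_, hi⟩

theorem aligned_of_dot_eq_zero {i : ι} {z : Fin 2 → ℝ} (h : dot (D.row i) z = 0) :
    D.toHPolyhedron.Aligned z := by
  refine ⟨funext fun i => i.elim0, Or.inr ⟨Fintype.equivFin ι i, ?_, ?_⟩⟩
  · simpa [toHPolyhedron] using D.row_ne_zero i
  · have e : dot (D.toHPolyhedron.B (Fintype.equivFin ι i)) z = 0 := by
      simpa [toHPolyhedron] using h
    exact (ineqs_apply _ _ _).trans e

end PolygonData

/-! ### A long way around without stepping backwards -/

/-- The points of a circuit walk as a sequence indexed by `ℕ`. -/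
theorem CircuitWalk.exists_seq {n : ℕ} {Q : HPolyhedron n} {u v : Fin n → ℝ}
    (W : CircuitWalk Q u v) : ∃ c : ℕ → Fin n → ℝ, c 0 = u ∧ c W.length = v ∧
      ∀ i : Fin W.length, W.y i.castSucc = c i ∧ W.y i.succ = c (i + 1) := by
  refine ⟨fun k => W.y ⟨min k W.length, by omega⟩, W.y_eq_start (by simp), W.y_eq_end (by simp),
    fun i => ⟨congrArg W.y (Fin.ext ?_), congrArg W.y (Fin.ext ?_)⟩⟩
  · simp [i.isLt.le]
  · simp [i.isLt]

/-- The circuit of a step in the direction of a primitive vector is this vector. -/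
theorem CircuitWalk.g_eq {u v : Fin 2 → ℝ} (W : CircuitWalk Q u v)
    (i : Fin W.length) {g : Fin 2 → ℤ} (hg : Finset.univ.gcd g = 1)
    (h : W.y i.succ - W.y i.castSucc = toReal g) : W.g i = g :=
  primitive_eq_of_smul_eq (W.circuit i).2.2.1 hg (W.α_pos i) one_pos
    (by rw [one_smul, ← h, W.step i])

theorem exists_step {p : ℕ → Prop} {a b : ℕ} (hab : a ≤ b) (ha : ¬ p a) (hb : p b) :
    ∃ i, a ≤ i ∧ i < b ∧ ¬ p i ∧ p (i + 1) := by
  induction b, hab using Nat.le_induction with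
  | base => exact absurd hb ha
  | succ b hab ih =>
    by_cases h : p b
    · obtain ⟨i, h1, h2, h3⟩ := ih h
      exact ⟨i, h1, by omega, h3⟩
    · exact ⟨b, hab, by omega, h, hb⟩

namespace Bowl

/-- The vertices of a bowl: lattice points `(i, i * (i - m))`, `0 ≤ i ≤ m`, on a parabola, and the
two points `(m, 1)` and `(0, 1)` above them. -/
def pt (m i : ℕ) : Fin 2 → ℝ :=
  if i ≤ m then ![i, i * (i - m)] else if i = m + 1 then ![m, 1] else ![0, 1]

/-- The normals of the edges of the bowl; the edge `i` starts at the vertex `i`. -/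
def row (m i : ℕ) : Fin 2 → ℤ :=
  if i < m then ![2 * i + 1 - m, -1] else if i = m then ![1, 0] else
    if i = m + 1 then ![0, 1] else ![-1, 0]

/-- The right-hand sides of the edges of the bowl. -/
def rhs (m i : ℕ) : ℝ :=
  if i < m then i * (i + 1) else if i = m then m else if i = m + 1 then 1 else 0

/-- The cyclic predecessor of an edge of the bowl. -/
def prev (m i : ℕ) : ℕ := if i = 0 then m + 2 else i - 1

theorem dot_le {m : ℕ} (hm : 2 ≤ m) {r j : ℕ} (hr : r < m + 3) (hj : j < m + 3) :
    dot (row m r) (pt m j) ≤ rhs m r ∧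
      (dot (row m r) (pt m j) = rhs m r ↔ r = j ∨ r = prev m j) := by
  have hm' : (2 : ℝ) ≤ m := by exact_mod_cast hm
  -- the points on the parabola lie below the line of each edge between two of them
  have hpar : ∀ i k : ℕ, ((2 * i + 1 - m : ℤ) : ℝ) * k - k * (k - m) - i * (i + 1) =
      -(((k : ℤ) - i) * ((k : ℤ) - i - 1) : ℤ) := by
    intro i k; push_cast; ring
  have hnonneg : ∀ i k : ℕ, (0 : ℤ) ≤ ((k : ℤ) - i) * ((k : ℤ) - i - 1) := by
    intro i k
    rcases le_or_gt ((k : ℤ) - i) 0 with h | h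
    · exact mul_nonneg_of_nonpos_of_nonpos h (by omega)
    · exact mul_nonneg h.le (by omega)
  by_cases h1 : r < m
  · by_cases h2 : j ≤ m
    · have e : dot (row m r) (pt m j) - rhs m r = -(((j : ℤ) - r) * ((j : ℤ) - r - 1) : ℤ) := by
        rw [← hpar]
        simp only [dot, row, pt, rhs, h1, h2, if_true, Matrix.cons_val_zero, Matrix.cons_val_one]
        push_cast; ring
      have h0 : (0 : ℝ) ≤ (((j : ℤ) - r) * ((j : ℤ) - r - 1) : ℤ) := by exact_mod_cast hnonneg r j
      refine ⟨by linarith, ?_⟩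
      rw [← sub_eq_zero, e, neg_eq_zero, Int.cast_eq_zero, mul_eq_zero]
      unfold prev
      split_ifs <;> omega
    · have h0 : (0 : ℝ) ≤ (((m : ℤ) - r) * ((m : ℤ) - r - 1) : ℤ) := by exact_mod_cast hnonneg r m
      have e := hpar r m
      push_cast at h0
      have hr0 : (0 : ℝ) ≤ r * (r + 1) := by positivity
      have hlt : dot (row m r) (pt m j) < rhs m r := by
        by_cases h3 : j = m + 1
        · subst h3
          simp only [dot, row, pt, rhs, h1, h2, if_true, if_false, Matrix.cons_val_zero,
            Matrix.cons_val_one] at e ⊢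
          push_cast at e ⊢
          linarith
        · simp only [dot, row, pt, rhs, h1, h2, h3, if_true, if_false, Matrix.cons_val_zero,
            Matrix.cons_val_one]
          push_cast
          linarith
      refine ⟨hlt.le, ⟨fun h => absurd h hlt.ne, fun h => absurd h ?_⟩⟩
      unfold prev
      split_ifs <;> omega
  · have hj0 : (0 : ℝ) ≤ j := by positivity
    obtain rfl | rfl | rfl : r = m ∨ r = m + 1 ∨ r = m + 2 := by omega
    · have e1 : dot (row r r) (pt r j) = (pt r j) 0 := by simp [dot, row]
      have e2 : rhs r r = r := by simp [rhs]
      rw [e1, e2]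
      unfold pt prev
      split_ifs with h2 h3 h3 h3
      · subst h3
        simp only [Matrix.cons_val_zero, Nat.cast_zero]
        exact ⟨by linarith, ⟨fun h => by linarith, fun h => by omega⟩⟩
      · simp only [Matrix.cons_val_zero, Nat.cast_inj, Nat.cast_le]
        omega
      · omega
      · simp only [Matrix.cons_val_zero]
        exact ⟨le_rfl, ⟨fun _ => by omega, fun _ => trivial⟩⟩
      · omega
      · simp only [Matrix.cons_val_zero]
        exact ⟨by linarith, ⟨fun h => by linarith, fun h => by omega⟩⟩
    · have e1 : dot (row m (m + 1)) (pt m j) = (pt m j) 1 := by simp [dot, row]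
      have e2 : rhs m (m + 1) = 1 := by simp [rhs]
      rw [e1, e2]
      by_cases h2 : j ≤ m
      · have hjm : (j : ℝ) ≤ m := by exact_mod_cast h2
        have hlt : (pt m j) 1 < 1 := by
          have : (pt m j) 1 = j * (j - m) := by simp [pt, h2]
          rw [this]
          nlinarith
        refine ⟨hlt.le, ⟨fun h => absurd h hlt.ne, fun h => absurd h ?_⟩⟩
        unfold prev
        split_ifs <;> omega
      · have e3 : (pt m j) 1 = 1 := by
          simp only [pt, h2, if_false]
          split_ifs <;> simp
        refine ⟨e3.le, ⟨fun _ => ?_, fun _ => e3⟩⟩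
        unfold prev
        split_ifs <;> omega
    · have e1 : dot (row m (m + 2)) (pt m j) = -(pt m j) 0 := by simp [dot, row]
      have e2 : rhs m (m + 2) = 0 := by simp [rhs]
      rw [e1, e2]
      unfold pt prev
      split_ifs with h2 h3 h3 h3
      · subst h3
        simp
      · have : (0 : ℝ) < j := by exact_mod_cast Nat.pos_of_ne_zero h3
        simp only [Matrix.cons_val_zero]
        exact ⟨by linarith, ⟨fun h => by linarith, fun h => by omega⟩⟩
      · omega
      · simp only [Matrix.cons_val_zero]
        exact ⟨by linarith, ⟨fun h => by linarith, fun h => by omega⟩⟩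
      · omega
      · simp only [Matrix.cons_val_zero, neg_zero, le_refl, true_and, true_iff]
        omega

/-- The bowl with `m + 3` vertices. -/
def data (m : ℕ) (hm : 2 ≤ m) : PolygonData (Fin (m + 3)) where
  row i := row m i
  rhs i := rhs m i
  pt i := pt m i
  nxt i := ⟨if (i : ℕ) = m + 2 then 0 else i + 1, by split_ifs <;> omega⟩
  prev i := ⟨prev m i, by unfold prev; split_ifs <;> omega⟩
  nxt_prev i := by ext; unfold prev; dsimp only; split_ifs <;> omega
  prev_nxt i := by
    ext
    by_cases h : (i : ℕ) = m + 2 <;> simp [prev, h]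
  prev_ne i h := by
    have := congrArg Fin.val h
    unfold prev at this; dsimp only at this; split_ifs at this <;> omega
  prev_prev_ne i h := by
    have := congrArg Fin.val h
    unfold prev at this; simp only at this; split_ifs at this <;> omega
  tight i := ((dot_le hm i.2 i.2).2.2 (Or.inl rfl))
  tight_prev i := (dot_le hm (by unfold prev; split_ifs <;> omega) i.2).2.2 (Or.inr rfl)
  dot_le r j := (dot_le hm r.2 j.2).1
  eq_or_eq r j h := ((dot_le hm r.2 j.2).2.1 h).imp Fin.ext Fin.ext

variable {m : ℕ} (hm : 2 ≤ m)

theorem isBounded : Bornology.IsBounded (data m hm).carrier := by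
  have hm' : (2 : ℝ) ≤ m := by exact_mod_cast hm
  refine (Metric.isBounded_closedBall (x := (0 : Fin 2 → ℝ)) (r := m * m + 1)).subset ?_
  intro z hz
  have h1 := hz ⟨0, by omega⟩
  have h2 := hz ⟨m, by omega⟩
  have h3 := hz ⟨m + 1, by omega⟩
  have h4 := hz ⟨m + 2, by omega⟩
  simp only [data, row, rhs, dot, show 0 < m by omega, if_true] at h1
  simp [data, row, rhs, dot] at h2 h3 h4
  simp at h1
  rw [mem_closedBall_zero_iff, pi_norm_le_iff_of_nonneg (by positivity)]
  intro i
  rw [Real.norm_eq_abs, abs_le]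
  fin_cases i
  · constructor <;> simp only [Fin.zero_eta] <;> nlinarith
  · constructor <;> simp only [Fin.mk_one] <;> nlinarith

/-- An edge between the two top vertices of the bowl and the other vertices is vertical. -/
theorem vertical {i j : Fin (m + 3)}
    (h : (data m hm).toHPolyhedron.Neighbors ((data m hm).pt i) ((data m hm).pt j))
    (hi : m < (i : ℕ)) (hj : (j : ℕ) ≤ m) :
    (data m hm).pt i - (data m hm).pt j = toReal ![0, 1] := by
  have hex := h.2.2.2
  rw [PolygonData.carrier_toHPolyhedron] at hex
  have hij : i ≠ j := fun h => by rw [h] at hi; omega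
  have e0 := (data m hm).eq_nxt_of_isExtreme hij hex
  have e1 : ((j : ℕ) = 0 ∧ (i : ℕ) = m + 2) ∨ ((j : ℕ) = m ∧ (i : ℕ) = m + 1) := by
    rcases e0 with e | e <;>
    · have := congrArg Fin.val e
      simp only [data] at this
      split_ifs at this <;> omega
  apply plane_ext
  · rcases e1 with ⟨h1, h2⟩ | ⟨h1, h2⟩ <;> simp [data, pt, h1, h2, toReal]
  · rcases e1 with ⟨h1, h2⟩ | ⟨h1, h2⟩ <;> simp [data, pt, h1, h2, toReal]

theorem pt_ne : (data m hm).pt ⟨0, by omega⟩ ≠ (data m hm).pt ⟨m, by omega⟩ := fun h => by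
  have := congrArg Fin.val ((data m hm).pt_injective h)
  simp only at this
  omega

/-- A non-backwards edge walk from `(0, 0)` to `(m, 0)` cannot use the top of the bowl, since it
would go up and down. -/
theorem le_CDefmb : (m : ℕ∞) ≤ (data m hm).toHPolyhedron.CDefmb
    ((data m hm).pt ⟨0, by omega⟩) ((data m hm).pt ⟨m, by omega⟩) := by
  refine le_circuitDist fun W ⟨hE, _, _, hB⟩ => ?_
  rw [Nat.cast_le]
  obtain ⟨c, hc0, hcm, hc⟩ := W.exists_seq
  have hidx : ∀ i, ∃ j : Fin (m + 3), i ≤ W.length → c i = (data m hm).pt j := by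
    intro i
    rcases Nat.eq_zero_or_pos i with rfl | h
    · exact ⟨_, fun _ => hc0⟩
    · by_cases hi : i ≤ W.length
      · have h1 := (hE ⟨i - 1, by omega⟩).2.1
        rw [(hc _).2, PolygonData.vertices_toHPolyhedron] at h1
        obtain ⟨j, hj⟩ := h1
        refine ⟨j, fun _ => ?_⟩
        rw [hj]
        congr 1
        simp only
        omega
      · exact ⟨⟨0, by omega⟩, fun h => absurd h hi⟩
  choose a ha using hidx
  have ha0 : (a 0 : ℕ) = 0 := by
    have := (data m hm).pt_injective (hc0.symm.trans (ha 0 (Nat.zero_le _)))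
    rw [← this]
  have ham : (a W.length : ℕ) = m := by
    have := (data m hm).pt_injective (hcm.symm.trans (ha _ le_rfl))
    rw [← this]
  have hN : ∀ i : Fin W.length, (data m hm).toHPolyhedron.Neighbors
      ((data m hm).pt (a i)) ((data m hm).pt (a (i + 1))) := by
    intro i
    have := hE i
    rwa [(hc i).1, (hc i).2, ha i i.2.le, ha (i + 1) i.2] at this
  have hno : ∀ i ≤ W.length, (a i : ℕ) ≤ m := by
    by_contra hcon
    push Not at hcon
    obtain ⟨i₀, hi₀, htop⟩ := hcon
    obtain ⟨i, -, hi, hi1, hi2⟩ := exists_step (p := fun k => m < (a k : ℕ)) (Nat.zero_le i₀)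
      (by simp only [ha0]; omega) htop
    obtain ⟨j, hj', hj, hj1, hj2⟩ := exists_step (p := fun k => (a k : ℕ) ≤ m) hi₀
      (by omega) ham.le
    have h1 := vertical hm (hN ⟨i, by omega⟩).symm hi2 (by simp only; omega)
    have h2 := vertical hm (hN ⟨j, by omega⟩) (by simp only; omega) hj2
    have g1 : W.g ⟨i, by omega⟩ = ![0, 1] := W.g_eq _ (by decide) (by
      rw [(hc _).1, (hc _).2, ha _ (by simp only; omega), ha _ (by simp only; omega)]
      exact h1)
    have g2 : W.g ⟨j, by omega⟩ = -![0, 1] := W.g_eq _ (by decide) (by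
      rw [(hc _).1, (hc _).2, ha _ (by simp only; omega), ha _ (by simp only; omega), toReal_neg,
        ← h2]
      exact (neg_sub _ _).symm)
    exact hB ⟨j, by omega⟩ ⟨i, by omega⟩ (by rw [g1, g2])
  have hle : ∀ i ≤ W.length, (a i : ℕ) ≤ i := by
    intro i
    induction i with
    | zero => intro _; exact ha0.le
    | succ i ih =>
      intro hi
      have h1 := ih (by omega)
      have h2 := hN ⟨i, by omega⟩
      have h3 := hno i (by omega)
      have h4 := hno (i + 1) hi
      by_cases heq : a i = a (i + 1)
      · rw [← heq]; omega
      have hex := h2.2.2.2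
      rw [PolygonData.carrier_toHPolyhedron] at hex
      rcases (data m hm).eq_nxt_of_isExtreme heq hex with e | e <;>
      · have := congrArg Fin.val e
        simp only [data] at this
        split_ifs at this <;> omega
  have := hle _ le_rfl
  omega

theorem CDefmb_eq : (data m hm).toHPolyhedron.CDefmb
    ((data m hm).pt ⟨0, by omega⟩) ((data m hm).pt ⟨m, by omega⟩) = m := by
  refine le_antisymm ?_ (le_CDefmb hm)
  have h := (data m hm).isIrredundantPolygon (isBounded hm) (Fintype.card_fin _)
  have := CDefmb_le h.1.1 h.1.2.2 (by omega) ((data m hm).pt_mem_vertices ⟨0, by omega⟩)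
    ((data m hm).pt_mem_vertices ⟨m, by omega⟩)
    (pt_ne hm)
  simpa using this

/-- The chord from `(0, 0)` to `(m, 0)` is parallel to the top of the bowl. -/
theorem exists_circuit : ∃ (g : Fin 2 → ℤ) (α : ℝ), (data m hm).toHPolyhedron.IsCircuit g ∧ 0 < α ∧
    (data m hm).pt ⟨m, by omega⟩ - (data m hm).pt ⟨0, by omega⟩ = α • toReal g := by
  refine ((data m hm).aligned_of_dot_eq_zero (i := ⟨m + 1, by omega⟩) ?_).exists_isCircuit ?_
  · simp [data, row, pt, dot]
  · exact sub_ne_zero.2 (pt_ne hm).symm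

theorem two_le_CDefm : 2 ≤ (data m hm).toHPolyhedron.CDefm
    ((data m hm).pt ⟨0, by omega⟩) ((data m hm).pt ⟨m, by omega⟩) := by
  have hne := pt_ne hm
  refine le_circuitDist fun W ⟨hE, _, _⟩ => ?_
  have hpos := W.length_pos hne
  by_contra hcon
  have h1 : W.length = 1 := by
    have : ¬ 2 ≤ W.length := fun h => hcon (by exact_mod_cast h)
    omega
  have h2 := hE ⟨0, by omega⟩
  rw [W.y_eq_start (by simp), W.y_eq_end (by simp [h1])] at h2
  have hex := h2.2.2.2
  rw [PolygonData.carrier_toHPolyhedron] at hex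
  rcases (data m hm).eq_nxt_of_isExtreme (fun h => hne (by rw [h])) hex with e | e <;>
  · have := congrArg Fin.val e
    simp only [data] at this
    split_ifs at this <;> omega

end Bowl

/-! ### Maximal steps orthogonal to given normals -/

/-- `y` is reached from `x` by a maximal step in the set `P`, in a direction that is orthogonal to
one of the normals in `N`. -/
def Step (P : Set (Fin 2 → ℝ)) (N : Set (Fin 2 → ℤ)) (x y : Fin 2 → ℝ) : Prop :=
  x ∈ P ∧ y ∈ P ∧ y ≠ x ∧ (∃ n ∈ N, dot n (y - x) = 0) ∧ ∀ a : ℝ, 1 < a → x + a • (y - x) ∉ P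

/-- The points that are reached from `u` by at most `k` maximal steps. -/
def Reach (P : Set (Fin 2 → ℝ)) (N : Set (Fin 2 → ℤ)) (u : Fin 2 → ℝ) : ℕ → Set (Fin 2 → ℝ)
  | 0 => {u}
  | k + 1 => Reach P N u k ∪ {y | ∃ x ∈ Reach P N u k, Step P N x y}

theorem reach_mono (P : Set (Fin 2 → ℝ)) (N : Set (Fin 2 → ℤ)) (u : Fin 2 → ℝ) :
    Monotone (Reach P N u) :=
  monotone_nat_of_le_succ fun _ => Set.subset_union_left

theorem reach_subset {P : Set (Fin 2 → ℝ)} {N : Set (Fin 2 → ℤ)} {u : Fin 2 → ℝ} (hu : u ∈ P)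
    (k : ℕ) : Reach P N u k ⊆ P := by
  induction k with
  | zero => exact Set.singleton_subset_iff.2 hu
  | succ k ih => exact Set.union_subset ih fun y ⟨_, _, h⟩ => h.2.1

theorem finite_setOf_step (P : Set (Fin 2 → ℝ)) {N : Set (Fin 2 → ℤ)} (hN : N.Finite)
    (hN0 : ∀ n ∈ N, n 0 ≠ 0 ∨ n 1 ≠ 0) (x : Fin 2 → ℝ) : {y | Step P N x y}.Finite := by
  -- for each normal there is at most one end point on either side of `x`
  have h1 : ∀ n ∈ N, ∀ σ : ℝ, {y | Step P N x y ∧ ∃ c : ℝ, 0 < c ∧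
      y = x + (σ * c) • ![-(n 1 : ℝ), (n 0 : ℝ)]}.Subsingleton := by
    intro n _ σ y ⟨hy, c, hc, hyc⟩ y' ⟨hy', c', hc', hyc'⟩
    have key : ∀ {y y' : Fin 2 → ℝ} {c c' : ℝ}, Step P N x y → y' ∈ P → 0 < c → c < c' →
        y = x + (σ * c) • ![-(n 1 : ℝ), (n 0 : ℝ)] →
        y' = x + (σ * c') • ![-(n 1 : ℝ), (n 0 : ℝ)] → False := by
      intro y y' c c' hy hy' hc hcc hyc hyc'
      refine hy.2.2.2.2 (c' / c) ((one_lt_div hc).2 hcc) ?_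
      convert hy' using 1
      rw [hyc', hyc, add_sub_cancel_left, smul_smul]
      congr 2
      field_simp
    rcases lt_trichotomy c c' with h | h | h
    · exact (key hy hy'.2.1 hc h hyc hyc').elim
    · rw [hyc, hyc', h]
    · exact (key hy' hy.2.1 hc' h hyc' hyc).elim
  refine (hN.biUnion (t := fun n => {y | Step P N x y ∧ ∃ c : ℝ, 0 < c ∧
      y = x + ((1 : ℝ) * c) • ![-(n 1 : ℝ), (n 0 : ℝ)]} ∪ {y | Step P N x y ∧ ∃ c : ℝ, 0 < c ∧
      y = x + ((-1 : ℝ) * c) • ![-(n 1 : ℝ), (n 0 : ℝ)]})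
      fun n hn => (h1 n hn 1).finite.union (h1 n hn (-1)).finite).subset ?_
  intro y hy
  obtain ⟨n, hn, hny⟩ := hy.2.2.2.1
  have hd : (![-(n 1 : ℝ), (n 0 : ℝ)] : Fin 2 → ℝ) ≠ 0 := by
    intro h
    rcases hN0 n hn with h' | h'
    · exact h' (by simpa using congrFun h 1)
    · exact h' (by simpa using congrFun h 0)
  obtain ⟨c, hc⟩ := exists_smul_of_orthogonal (a := n 0) (b := n 1)
    (by exact_mod_cast hN0 n hn) hd (by simp; ring) (y := y - x) hny
  have hc0 : c ≠ 0 := by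
    rintro rfl
    rw [zero_smul] at hc
    exact hy.2.2.1 (sub_eq_zero.1 hc)
  simp only [Set.mem_iUnion]
  refine ⟨n, hn, ?_⟩
  rcases lt_or_gt_of_ne hc0 with h | h
  · refine Or.inr ⟨hy, -c, by linarith, ?_⟩
    rw [neg_one_mul, neg_neg, ← hc]; abel
  · refine Or.inl ⟨hy, c, h, ?_⟩
    rw [one_mul, ← hc]; abel

theorem finite_reach (P : Set (Fin 2 → ℝ)) {N : Set (Fin 2 → ℤ)} (hN : N.Finite)
    (hN0 : ∀ n ∈ N, n 0 ≠ 0 ∨ n 1 ≠ 0) (u : Fin 2 → ℝ) (k : ℕ) : (Reach P N u k).Finite := by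
  induction k with
  | zero => exact Set.finite_singleton u
  | succ k ih =>
    refine ih.union ((ih.biUnion fun x _ => finite_setOf_step P hN hN0 x).subset ?_)
    rintro y ⟨x, hx, hy⟩
    exact Set.mem_biUnion hx hy

/-- The steps of a feasible maximal circuit walk in a polygon. -/
theorem CircuitWalk.isStep {ι : Type} [Fintype ι] [Nonempty ι] {D : PolygonData ι}
    {N : Set (Fin 2 → ℤ)} (hN : ∀ i, D.row i ∈ N) {u v : Fin 2 → ℝ}
    {W : CircuitWalk D.toHPolyhedron u v} (hf : W.IsFeasible) (hm : W.IsMaximal)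
    (hv : v ∈ D.carrier) (i : Fin W.length) :
    Step D.carrier N (W.y i.castSucc) (W.y i.succ) := by
  have hα := W.α_pos i
  have hs := W.step i
  obtain ⟨j, hj⟩ := D.exists_row_of_isCircuit (W.circuit i)
  refine ⟨?_, ?_, ?_, ⟨_, hN j, ?_⟩, fun a ha => ?_⟩
  · rw [← D.carrier_toHPolyhedron]; exact hf i
  · by_cases h : (i : ℕ) + 1 = W.length
    · rw [W.y_eq_end (by simpa using h)]; exact hv
    · have := hf ⟨i + 1, by omega⟩
      rw [D.carrier_toHPolyhedron] at this
      exact this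
  · rw [ne_eq, ← sub_eq_zero, hs]
    exact smul_ne_zero hα.ne' (toReal_ne_zero (W.circuit i).2.1)
  · rw [hs, dot_smul, hj, mul_zero]
  · rw [hs, smul_smul, ← D.carrier_toHPolyhedron]
    exact hm i _ (lt_mul_of_one_lt_left hα ha)

theorem CircuitWalk.mem_reach {ι : Type} [Fintype ι] [Nonempty ι] {D : PolygonData ι}
    {N : Set (Fin 2 → ℤ)} (hN : ∀ i, D.row i ∈ N) {u v : Fin 2 → ℝ}
    {W : CircuitWalk D.toHPolyhedron u v} (hf : W.IsFeasible) (hm : W.IsMaximal)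
    (hv : v ∈ D.carrier) : v ∈ Reach D.carrier N u W.length := by
  obtain ⟨c, hc0, hcm, hc⟩ := W.exists_seq
  have key : ∀ k ≤ W.length, c k ∈ Reach D.carrier N u k := by
    intro k
    induction k with
    | zero => intro _; rw [hc0]; exact Set.mem_singleton u
    | succ k ih =>
      intro hk
      refine Or.inr ⟨c k, ih (by omega), ?_⟩
      have := W.isStep hN hf hm hv ⟨k, hk⟩
      rwa [(hc _).1, (hc _).2] at this
  have := key _ le_rfl
  rwa [hcm] at this

theorem succ_le_CDfm {ι : Type} [Fintype ι] [Nonempty ι] {D : PolygonData ι}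
    {N : Set (Fin 2 → ℤ)} (hN : ∀ i, D.row i ∈ N) {u v : Fin 2 → ℝ} (hv : v ∈ D.carrier) {k : ℕ}
    (h : v ∉ Reach D.carrier N u k) : ((k + 1 : ℕ) : ℕ∞) ≤ D.toHPolyhedron.CDfm u v := by
  refine le_circuitDist fun W ⟨hf, hm⟩ => ?_
  rw [Nat.cast_le]
  by_contra hcon
  exact h (reach_mono _ _ _ (by omega) (W.mem_reach hN hf hm hv))

/-! ### Cutting off a vertex -/

/-- The part of `P` in the upward cone with slopes `± s` whose apex is at height `t` above `v`. -/
def cutSet (P : Set (Fin 2 → ℝ)) (v : Fin 2 → ℝ) (s t : ℝ) : Set (Fin 2 → ℝ) :=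
  {z ∈ P | s * |z 0 - v 0| + t ≤ z 1 - v 1}

theorem cutSet_subset (P : Set (Fin 2 → ℝ)) (v : Fin 2 → ℝ) (s t : ℝ) : cutSet P v s t ⊆ P :=
  fun _ h => h.1

section Cut

open Filter Topology

variable {P : Set (Fin 2 → ℝ)} {v : Fin 2 → ℝ} {s s' : ℝ}

/-- Points other than the vertex `v` survive a small cut at `v`. -/
theorem eventually_mem_cutSet (hP : ∀ z ∈ P, s * |z 0 - v 0| ≤ z 1 - v 1) (hs : s' < s)
    {z : Fin 2 → ℝ} (hz : z ∈ P) (hzv : z ≠ v) : ∀ᶠ t in 𝓝[>] (0 : ℝ), z ∈ cutSet P v s' t := by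
  have hlt : s' * |z 0 - v 0| < z 1 - v 1 ∨ (z 0 = v 0 ∧ z 1 = v 1) := by
    have h1 := hP z hz
    rcases (abs_nonneg (z 0 - v 0)).eq_or_lt with h0 | h0
    · rw [← h0, mul_zero] at h1 ⊢
      rcases h1.eq_or_lt with h2 | h2
      · exact Or.inr ⟨sub_eq_zero.1 (abs_eq_zero.1 h0.symm), by linarith⟩
      · exact Or.inl h2
    · exact Or.inl ((mul_lt_mul_of_pos_right hs h0).trans_le h1)
  rcases hlt with h | h
  · have : ∀ᶠ t in 𝓝[>] (0 : ℝ), t < z 1 - v 1 - s' * |z 0 - v 0| :=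
      eventually_nhdsWithin_of_eventually_nhds (eventually_lt_nhds (sub_pos.2 h))
    filter_upwards [this] with t ht
    exact ⟨hz, by linarith⟩
  · exact absurd (plane_ext h.1 h.2) hzv

/-- A small cut does not affect walks that do not reach the vertex that is cut off. -/
theorem eventually_step_of_step_cutSet (hcomp : IsCompact P)
    (hP : ∀ z ∈ P, s * |z 0 - v 0| ≤ z 1 - v 1) (hs : s' < s) {N : Set (Fin 2 → ℤ)}
    (hN : N.Finite) (hN0 : ∀ n ∈ N, n 0 ≠ 0 ∨ n 1 ≠ 0) {u : Fin 2 → ℝ} (hu : u ∈ P) {k : ℕ}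
    (hv : v ∉ Reach P N u k) : ∀ᶠ t in 𝓝[>] (0 : ℝ),
      (∀ j ≤ k, Reach (cutSet P v s' t) N u j ⊆ Reach P N u j) ∧
      ∀ j < k, ∀ x ∈ Reach (cutSet P v s' t) N u j, ∀ y, Step (cutSet P v s' t) N x y →
        Step P N x y := by
  have hfin := finite_reach P hN hN0 u k
  have hmem : ∀ᶠ t in 𝓝[>] (0 : ℝ), ∀ z ∈ Reach P N u k, z ∈ cutSet P v s' t :=
    (eventually_all_finite hfin).2 fun z hz =>
      eventually_mem_cutSet hP hs (reach_subset hu k hz) fun h => hv (h ▸ hz)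
  filter_upwards [hmem] with t ht
  have hstep : ∀ j < k, ∀ x ∈ Reach P N u j, ∀ y, Step (cutSet P v s' t) N x y →
      Step P N x y := by
    intro j hj x hx y hy
    have hd : y - x ≠ 0 := sub_ne_zero.2 hy.2.2.1
    obtain ⟨c, hc0, hc, hc'⟩ := exists_last_mem hcomp (reach_subset hu j hx) hd
    have hc1 : 1 ≤ c := by
      by_contra hcon
      refine hc' 1 (not_le.1 hcon) ?_
      rw [one_smul, add_sub_cancel]
      exact hy.2.1.1
    have hz : Step P N x (x + c • (y - x)) := by
      refine ⟨reach_subset hu j hx, hc, ?_, ?_, fun a ha => ?_⟩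
      · rw [ne_eq, add_eq_left]
        exact smul_ne_zero (by linarith) hd
      · obtain ⟨n, hn, hny⟩ := hy.2.2.2.1
        exact ⟨n, hn, by rw [add_sub_cancel_left, dot_smul, hny, mul_zero]⟩
      · rw [add_sub_cancel_left, smul_smul]
        exact hc' _ (lt_mul_of_one_lt_left (by linarith) ha)
    have hzc := ht _ (reach_mono P N u (Nat.succ_le_of_lt hj) (Or.inr ⟨x, hx, hz⟩))
    rcases hc1.eq_or_lt with h | h
    · rw [← h, one_smul, add_sub_cancel] at hz
      exact hz
    · exact absurd hzc (hy.2.2.2.2 c h)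
  have hreach : ∀ j ≤ k, Reach (cutSet P v s' t) N u j ⊆ Reach P N u j := by
    intro j
    induction j with
    | zero => intro _; exact subset_rfl
    | succ j ih =>
      intro hj
      refine Set.union_subset ((ih (by omega)).trans Set.subset_union_left) ?_
      rintro y ⟨x, hx, hy⟩
      exact Or.inr ⟨x, ih (by omega) hx, hstep j hj x (ih (by omega) hx) y hy⟩
  exact ⟨hreach, fun j hj x hx y hy => hstep j hj x (hreach j hj.le hx) y hy⟩

/-- The apex of a small cut lies on none of finitely many non-vertical lines. -/
theorem eventually_dot_ne_zero {N : Set (Fin 2 → ℤ)} (hN : N.Finite)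
    (hN0 : ∀ n ∈ N, n 0 ≠ 0 ∨ n 1 ≠ 0) {F : Set (Fin 2 → ℝ)} (hF : F.Finite) :
    ∀ᶠ t in 𝓝[>] (0 : ℝ), ∀ x ∈ F, ∀ n ∈ N, dot n (v + ![0, t] - x) = 0 →
      n 1 = 0 ∧ x 0 = v 0 := by
  refine (eventually_all_finite hF).2 fun x _ => (eventually_all_finite hN).2 fun n hn => ?_
  have e : ∀ t : ℝ, dot n (v + ![0, t] - x) = dot n (v - x) + n 1 * t := by
    intro t
    simp only [dot, Pi.add_apply, Pi.sub_apply, Matrix.cons_val_zero, Matrix.cons_val_one]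
    ring
  by_cases h1 : n 1 = 0
  · refine Eventually.of_forall fun t ht => ⟨h1, ?_⟩
    have h0 : (n 0 : ℝ) ≠ 0 := by exact_mod_cast (hN0 n hn).resolve_right (not_not.2 h1)
    rw [e, h1] at ht
    simp only [dot, h1, Int.cast_zero, zero_mul, add_zero, Pi.sub_apply, mul_eq_zero, h0,
      false_or] at ht
    linarith
  · have h1' : (n 1 : ℝ) ≠ 0 := by exact_mod_cast h1
    have hne : ∀ᶠ t in 𝓝[>] (0 : ℝ), t ≠ -dot n (v - x) / n 1 := by
      by_cases h0 : -dot n (v - x) / n 1 = 0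
      · rw [h0]
        filter_upwards [self_mem_nhdsWithin] with t ht using ne_of_gt ht
      · exact eventually_nhdsWithin_of_eventually_nhds (eventually_ne_nhds (Ne.symm h0))
    filter_upwards [hne] with t ht hdot
    refine absurd ?_ ht
    rw [e] at hdot
    field_simp
    linarith

theorem eventually_apex_notMem {F : Set (Fin 2 → ℝ)} (hF : F.Finite) (hv : v ∉ F) :
    ∀ᶠ t in 𝓝[>] (0 : ℝ), v + ![0, t] ∉ F := by
  have hcont : Continuous fun t : ℝ => v + ![0, t] := by
    refine continuous_pi fun i => ?_
    fin_cases i <;> simp <;> fun_prop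
  have := (hcont.tendsto 0).eventually (hF.isClosed.isOpen_compl.mem_nhds
    (show v + ![0, (0 : ℝ)] ∈ Fᶜ by
      have : v + ![0, (0 : ℝ)] = v := by apply plane_ext <;> simp
      rwa [this]))
  exact eventually_nhdsWithin_of_eventually_nhds this

/-- After a small cut the new vertex can only be reached vertically with one further step. -/
theorem eventually_apex_notMem_reach (hcomp : IsCompact P)
    (hP : ∀ z ∈ P, s * |z 0 - v 0| ≤ z 1 - v 1) (hs : s' < s) {N : Set (Fin 2 → ℤ)}
    (hN : N.Finite) (hN0 : ∀ n ∈ N, n 0 ≠ 0 ∨ n 1 ≠ 0) {u : Fin 2 → ℝ} (hu : u ∈ P) {k : ℕ}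
    (hv : v ∉ Reach P N u k)
    (hvert : (∀ n ∈ N, n 1 ≠ 0) ∨ ∀ x ∈ Reach P N u k, x 0 ≠ v 0) : ∀ᶠ t in 𝓝[>] (0 : ℝ),
      v + ![0, t] ∉ Reach (cutSet P v s' t) N u (k + 1) := by
  have hfin := finite_reach P hN hN0 u k
  filter_upwards [eventually_step_of_step_cutSet hcomp hP hs hN hN0 hu hv,
    eventually_apex_notMem hfin hv, eventually_dot_ne_zero (v := v) hN hN0 hfin] with t h1 h2 h3
  rintro (h | ⟨x, hx, hxv⟩)
  · exact h2 (h1.1 k le_rfl h)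
  · obtain ⟨n, hn, hn0⟩ := hxv.2.2.2.1
    have h4 := h3 x (h1.1 k le_rfl hx) n hn hn0
    rcases hvert with h | h
    · exact h n hn h4.1
    · exact h x (h1.1 k le_rfl hx) h4.2

end Cut

namespace PolygonData

section Cut

open Filter Topology

variable {ι : Type} (D : PolygonData ι)

theorem cone_of_rows {i₀ : ι} {s : ℤ} (h1 : D.row i₀ = ![s, -1])
    (h2 : D.row (D.prev i₀) = ![-s, -1]) :
    ∀ z ∈ D.carrier, (s : ℝ) * |z 0 - D.pt i₀ 0| ≤ z 1 - D.pt i₀ 1 := by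
  intro z hz
  have e1 := hz i₀
  have e2 := hz (D.prev i₀)
  have e3 := D.tight i₀
  have e4 := D.tight_prev i₀
  rw [h1] at e1 e3
  rw [h2] at e2 e4
  simp only [dot, Matrix.cons_val_zero, Matrix.cons_val_one, Int.cast_neg, Int.cast_one] at *
  rcases abs_cases (z 0 - D.pt i₀ 0) with ⟨h, -⟩ | ⟨h, -⟩ <;> rw [h] <;> linarith

theorem eventually_dot_lt {r : Fin 2 → ℤ} {e : ℝ} {v : Fin 2 → ℝ} (h : dot r v < e)
    (w : Fin 2 → ℝ) : ∀ᶠ t in 𝓝[>] (0 : ℝ), dot r (v + t • w) < e := by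
  have hcont : Continuous fun t : ℝ => dot r (v + t • w) :=
    (continuous_dot r).comp (by fun_prop)
  refine eventually_nhdsWithin_of_eventually_nhds
    ((hcont.tendsto 0).eventually (eventually_lt_nhds (b := e) ?_))
  simpa using h

/-- The rows after a vertex between edges of slopes `-s` and `s` is cut off by two edges of slopes
`-s'` and `s'`: the new edges are `some none` and `none`. -/
def cutRow (s' : ℤ) : Option (Option ι) → Fin 2 → ℤ
  | none => ![s', -1]
  | some none => ![-s', -1]
  | some (some i) => D.row i

/-- The right-hand sides after a cut; the new edges meet at height `t` above `v`. -/
def cutRhs (v : Fin 2 → ℝ) (s' : ℤ) (t : ℝ) : Option (Option ι) → ℝ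
  | none => s' * v 0 - v 1 - t
  | some none => -s' * v 0 - v 1 - t
  | some (some i) => D.rhs i

open Classical in
/-- The vertices after a cut at the vertex `i₀` between edges of slopes `-s` and `s`, where
`d = 1 / (s - s')`. -/
noncomputable def cutPt (i₀ : ι) (s : ℤ) (d t : ℝ) : Option (Option ι) → Fin 2 → ℝ
  | none => D.pt i₀ + t • ![0, 1]
  | some none => D.pt i₀ + t • ![-d, s * d]
  | some (some i) => if i = i₀ then D.pt i₀ + t • ![d, s * d] else D.pt i

open Classical in
/-- The cyclic successor after a cut. -/
noncomputable def cutNxt (i₀ : ι) : Option (Option ι) → Option (Option ι)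
  | none => some (some i₀)
  | some none => none
  | some (some i) => if i = D.prev i₀ then some none else some (some (D.nxt i))

open Classical in
/-- The cyclic predecessor after a cut. -/
noncomputable def cutPrev (i₀ : ι) : Option (Option ι) → Option (Option ι)
  | none => some none
  | some none => some (some (D.prev i₀))
  | some (some i) => if i = i₀ then none else some (some (D.prev i))

/-- Each inequality at each vertex after a sufficiently small cut. -/
theorem dot_cutRow_le {i₀ : ι} {s s' : ℤ} (hs' : 0 < s') {d t : ℝ}
    (h1 : D.row i₀ = ![s, -1]) (h2 : D.row (D.prev i₀) = ![-s, -1]) (hdpos : 0 < d)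
    (hd1 : d * s = 1 + d * s') (ht : 0 < t)
    (hcut : ∀ i, i ≠ i₀ → s' * (D.pt i 0 - D.pt i₀ 0) + t < D.pt i 1 - D.pt i₀ 1 ∧
      -s' * (D.pt i 0 - D.pt i₀ 0) + t < D.pt i 1 - D.pt i₀ 1)
    (e2 : ∀ r, r ≠ i₀ → r ≠ D.prev i₀ → dot (D.row r) (D.pt i₀ + t • ![0, 1]) < D.rhs r)
    (e3 : ∀ r, r ≠ i₀ → r ≠ D.prev i₀ → dot (D.row r) (D.pt i₀ + t • ![-d, s * d]) < D.rhs r)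
    (e4 : ∀ r, r ≠ i₀ → r ≠ D.prev i₀ → dot (D.row r) (D.pt i₀ + t • ![d, s * d]) < D.rhs r)
    (r j : Option (Option ι)) :
    dot (D.cutRow s' r) (D.cutPt i₀ s d t j) ≤ D.cutRhs (D.pt i₀) s' t r ∧
      (dot (D.cutRow s' r) (D.cutPt i₀ s d t j) = D.cutRhs (D.pt i₀) s' t r ↔
        r = j ∨ r = D.cutPrev i₀ j) := by
  have hs'R : (0 : ℝ) < s' := by exact_mod_cast hs'
  have hdt : 0 < d * t := mul_pos hdpos ht
  have hsdt : d * t * s = t + d * t * s' := by linear_combination t * hd1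
  have hs'dt : 0 < d * t * s' := mul_pos hdt hs'R
  have c1 := D.tight i₀
  have c2 := D.tight_prev i₀
  rw [h1] at c1
  rw [h2] at c2
  simp only [dot, Matrix.cons_val_zero, Matrix.cons_val_one, Int.cast_neg, Int.cast_one] at c1 c2
  set v := D.pt i₀ with hv
  have simps : ∀ (a b : ℤ) (x y : ℝ), dot ![a, b] (v + t • ![x, y]) =
      a * v 0 + b * v 1 + t * (a * x + b * y) := by
    intro a b x y
    simp only [dot, Matrix.cons_val_zero, Matrix.cons_val_one, Pi.add_apply, Pi.smul_apply,
      smul_eq_mul]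
    ring
  have lt : ∀ {x y : ℝ} {p q : Prop}, x < y → ¬ p → ¬ q → x ≤ y ∧ (x = y ↔ p ∨ q) :=
    fun h h1 h2 => ⟨h.le, ⟨fun h' => absurd h' h.ne, fun h' => absurd h' (not_or.2 ⟨h1, h2⟩)⟩⟩
  have eq : ∀ {x y : ℝ} {p q : Prop}, x = y → p ∨ q → x ≤ y ∧ (x = y ↔ p ∨ q) :=
    fun h h1 => ⟨h.le, ⟨fun _ => h1, fun _ => h⟩⟩
  rcases r with _ | _ | r <;> rcases j with _ | _ | j
  · refine eq ?_ (Or.inl rfl)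
    simp only [cutRow, cutPt, cutRhs, ← hv, simps]; push_cast; ring
  · refine lt ?_ (by simp) (by simp [cutPrev])
    simp only [cutRow, cutPt, cutRhs, ← hv, simps]; push_cast; linarith
  · by_cases hj : j = i₀
    · refine eq ?_ (Or.inr (by simp [cutPrev, hj]))
      simp only [cutRow, cutPt, cutRhs, hj, if_true, ← hv, simps]; push_cast; linarith
    · refine lt ?_ (by simp) (by simp [cutPrev, hj])
      have := hcut j hj
      simp only [cutRow, cutPt, cutRhs, hj, if_false, dot, Matrix.cons_val_zero,
        Matrix.cons_val_one]
      push_cast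
      linarith
  · refine eq ?_ (Or.inr rfl)
    simp only [cutRow, cutPt, cutRhs, ← hv, simps]; push_cast; ring
  · refine eq ?_ (Or.inl rfl)
    simp only [cutRow, cutPt, cutRhs, ← hv, simps]; push_cast; linarith
  · by_cases hj : j = i₀
    · refine lt ?_ (by simp) (by simp [cutPrev, hj])
      simp only [cutRow, cutPt, cutRhs, hj, if_true, ← hv, simps]; push_cast; linarith
    · refine lt ?_ (by simp) (by simp [cutPrev, hj])
      have := hcut j hj
      simp only [cutRow, cutPt, cutRhs, hj, if_false, dot, Matrix.cons_val_zero,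
        Matrix.cons_val_one]
      push_cast
      linarith
  · refine lt ?_ (by simp) (by simp [cutPrev])
    simp only [cutRow, cutPt, cutRhs, ← hv]
    by_cases hr : r = i₀
    · rw [hr, h1, simps, ← c1]; push_cast; linarith
    by_cases hr' : r = D.prev i₀
    · rw [hr', h2, simps, ← c2]; push_cast; linarith
    exact e2 r hr hr'
  · by_cases hr' : r = D.prev i₀
    · refine eq ?_ (Or.inr (by simp [cutPrev, hr']))
      simp only [cutRow, cutPt, cutRhs, ← hv]
      rw [hr', h2, simps, ← c2]; push_cast; ring
    · refine lt ?_ (by simp) (by simp [cutPrev, hr'])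
      simp only [cutRow, cutPt, cutRhs, ← hv]
      by_cases hr : r = i₀
      · rw [hr, h1, simps, ← c1]; push_cast; linarith
      exact e3 r hr hr'
  · by_cases hj : j = i₀
    · rw [hj]
      by_cases hr : r = i₀
      · refine eq ?_ (Or.inl (by rw [hr]))
        simp only [cutRow, cutPt, cutRhs, if_true, ← hv]
        rw [hr, h1, simps, ← c1]; push_cast; ring
      refine lt ?_ (by simpa using hr) (by simp [cutPrev])
      simp only [cutRow, cutPt, cutRhs, if_true, ← hv]
      by_cases hr' : r = D.prev i₀
      · rw [hr', h2, simps, ← c2]; push_cast; linarith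
      exact e4 r hr hr'
    · have e : D.cutPt i₀ s d t (some (some j)) = D.pt j := by simp [cutPt, hj]
      rw [e]
      refine ⟨D.dot_le r j, ?_⟩
      simp only [cutPrev, hj, if_false, Option.some.injEq]
      refine ⟨D.eq_or_eq r j, ?_⟩
      rintro (h | h)
      · rw [h]; exact D.tight j
      · rw [h]; exact D.tight_prev j

/-- A vertex between edges of slopes `-s` and `s` is cut off by two edges of slopes `-s'` and `s'`,
where `0 < s' < s`, which meet a little above the vertex, at the start of the edge `none`. -/
theorem eventually_exists_cut [Finite ι] {i₀ : ι} {s s' : ℤ} (hs' : 0 < s') (hs : s' < s)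
    (h1 : D.row i₀ = ![s, -1]) (h2 : D.row (D.prev i₀) = ![-s, -1]) :
    ∀ᶠ t in 𝓝[>] (0 : ℝ), ∃ D' : PolygonData (Option (Option ι)),
      D'.carrier = cutSet D.carrier (D.pt i₀) s' t ∧
      D'.pt none = D.pt i₀ + ![0, t] ∧ D'.row none = ![s', -1] ∧
      D'.row (D'.prev none) = ![-s', -1] ∧
      (∀ i, D'.row i = ![s', -1] ∨ D'.row i = ![-s', -1] ∨ ∃ j, D'.row i = D.row j) ∧
      (∀ i, D'.row (some (some i)) = D.row i) ∧
      ∀ i, i ≠ i₀ → D'.pt (some (some i)) = D.pt i := by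
  have hsR : (s' : ℝ) < s := by exact_mod_cast hs
  have hs'R : (0 : ℝ) < s' := by exact_mod_cast hs'
  have hcone := D.cone_of_rows h1 h2
  set d : ℝ := ((s : ℝ) - s')⁻¹ with hd
  have hdpos : 0 < d := inv_pos.2 (sub_pos.2 hsR)
  have hd1 : d * s = 1 + d * s' := by
    have : d * (s - s') = 1 := inv_mul_cancel₀ (sub_pos.2 hsR).ne'
    linarith
  have E1 : ∀ᶠ t in 𝓝[>] (0 : ℝ), ∀ i, i ≠ i₀ → D.pt i ∈ cutSet D.carrier (D.pt i₀) s' (2 * t) := by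
    refine eventually_all.2 fun i => ?_
    by_cases hi : i = i₀
    · exact Eventually.of_forall fun t h => absurd hi h
    have h2 : Tendsto (fun t : ℝ => 2 * t) (𝓝[>] 0) (𝓝[>] 0) := by
      refine tendsto_nhdsWithin_iff.2 ⟨?_, ?_⟩
      · have : Tendsto (fun t : ℝ => 2 * t) (𝓝 0) (𝓝 (2 * 0)) :=
          (continuous_const.mul continuous_id).tendsto 0
        rw [mul_zero] at this
        exact this.mono_left nhdsWithin_le_nhds
      · filter_upwards [self_mem_nhdsWithin] with t ht
        simpa using ht
    filter_upwards [h2.eventually (eventually_mem_cutSet hcone hsR (D.pt_mem i)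
      fun h => hi (D.pt_injective h))] with t ht _ using ht
  have E2 : ∀ w : Fin 2 → ℝ, ∀ᶠ t in 𝓝[>] (0 : ℝ), ∀ r, r ≠ i₀ → r ≠ D.prev i₀ →
      dot (D.row r) (D.pt i₀ + t • w) < D.rhs r := by
    intro w
    refine eventually_all.2 fun r => ?_
    by_cases hr : r = i₀
    · exact Eventually.of_forall fun t h => absurd hr h
    by_cases hr' : r = D.prev i₀
    · exact Eventually.of_forall fun t _ h => absurd hr' h
    filter_upwards [eventually_dot_lt (D.dot_lt hr hr') w] with t ht _ _ using ht
  filter_upwards [E1, E2 ![0, 1], E2 ![-d, s * d], E2 ![d, s * d], self_mem_nhdsWithin]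
    with t e1 e2 e3 e4 ht
  have ht : 0 < t := ht
  have main := D.dot_cutRow_le hs' h1 h2 hdpos hd1 ht (fun i hi => by
    have := (e1 i hi).2
    rcases abs_cases (D.pt i 0 - D.pt i₀ 0) with ⟨h, h'⟩ | ⟨h, h'⟩ <;> rw [h] at this <;>
      constructor <;> nlinarith) e2 e3 e4
  have hprev : ∀ i j, D.prev i = D.prev j → i = j := fun i j h => by
    rw [← D.nxt_prev i, h, D.nxt_prev]
  refine ⟨{ row := D.cutRow s', rhs := D.cutRhs (D.pt i₀) s' t, pt := D.cutPt i₀ s d t,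
            nxt := D.cutNxt i₀, prev := D.cutPrev i₀,
            nxt_prev := ?_, prev_nxt := ?_, prev_ne := ?_, prev_prev_ne := ?_,
            tight := fun i => (main i i).2.2 (Or.inl rfl),
            tight_prev := fun i => (main _ i).2.2 (Or.inr rfl),
            dot_le := fun r j => (main r j).1,
            eq_or_eq := fun r j => (main r j).2.1 }, ?_, ?_, rfl, rfl, ?_, fun i => rfl, ?_⟩
  · rintro (_ | _ | i)
    · rfl
    · simp [cutNxt, cutPrev]
    · by_cases h : i = i₀
      · simp [cutNxt, cutPrev, h]
      · have : D.prev i ≠ D.prev i₀ := fun h' => h (hprev _ _ h')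
        simp [cutNxt, cutPrev, h, this, D.nxt_prev]
  · rintro (_ | _ | i)
    · simp [cutNxt, cutPrev]
    · rfl
    · by_cases h : i = D.prev i₀
      · simp [cutNxt, cutPrev, h]
      · have : D.nxt i ≠ i₀ := fun h' => h (by rw [← h', D.prev_nxt])
        simp [cutNxt, cutPrev, h, this, D.prev_nxt]
  · rintro (_ | _ | i)
    · simp [cutPrev]
    · simp [cutPrev]
    · by_cases h : i = i₀
      · simp [cutPrev, h]
      · simp [cutPrev, h, D.prev_ne]
  · rintro (_ | _ | i)
    · simp [cutPrev]
    · simp [cutPrev, D.prev_ne]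
    · by_cases h : i = i₀
      · simp [cutPrev, h]
      · by_cases h' : D.prev i = i₀
        · simp [cutPrev, h, h']
        · simp [cutPrev, h, h', D.prev_prev_ne]
  · ext z
    constructor
    · intro hz
      refine ⟨fun i => hz (some (some i)), ?_⟩
      have z1 := hz none
      have z2 := hz (some none)
      simp only [cutRow, cutRhs, dot, Matrix.cons_val_zero, Matrix.cons_val_one] at z1 z2
      push_cast at z1 z2
      rcases abs_cases (z 0 - D.pt i₀ 0) with ⟨h, -⟩ | ⟨h, -⟩ <;> rw [h] <;> linarith
    · rintro ⟨hz, hz'⟩ (_ | _ | i)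
      · simp only [cutRow, cutRhs, dot, Matrix.cons_val_zero, Matrix.cons_val_one]
        have := mul_le_mul_of_nonneg_left (le_abs_self (z 0 - D.pt i₀ 0)) hs'R.le
        push_cast
        linarith
      · simp only [cutRow, cutRhs, dot, Matrix.cons_val_zero, Matrix.cons_val_one]
        have := mul_le_mul_of_nonneg_left (neg_le_abs (z 0 - D.pt i₀ 0)) hs'R.le
        push_cast
        linarith
      · exact hz i
  · simp only [cutPt]
    congr 1
    apply plane_ext <;> simp
  · rintro (_ | _ | i)
    · exact Or.inl rfl
    · exact Or.inr (Or.inl rfl)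
    · exact Or.inr (Or.inr ⟨i, rfl⟩)
  · intro i hi
    simp [cutPt, hi]

end Cut

end PolygonData

/-! ### Long maximal walks -/

namespace PolygonData

/-- The description of a polygon with edges `0, 1, …, k + 2` in cyclic order. -/
def ofFin {k : ℕ} (row : Fin (k + 3) → Fin 2 → ℤ) (rhs : Fin (k + 3) → ℝ)
    (pt : Fin (k + 3) → Fin 2 → ℝ) (h1 : ∀ r, dot (row r) (pt r) = rhs r)
    (h2 : ∀ r, dot (row r) (pt (r + 1)) = rhs r)
    (h3 : ∀ r j, r ≠ j → r + 1 ≠ j → dot (row r) (pt j) < rhs r) :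
    PolygonData (Fin (k + 3)) where
  row := row
  rhs := rhs
  pt := pt
  nxt i := i + 1
  prev i := i - 1
  nxt_prev i := sub_add_cancel i 1
  prev_nxt i := add_sub_cancel_right i 1
  prev_ne i h := one_ne_zero (sub_eq_self.1 h)
  prev_prev_ne i h := by
    rw [sub_sub, sub_eq_self] at h
    exact absurd (congrArg Fin.val h) (by simp [Fin.val_add, Nat.mod_eq_of_lt])
  tight := h1
  tight_prev i := by simpa using h2 (i - 1)
  dot_le r j := by
    by_cases hr : r = j
    · rw [hr, h1]
    by_cases hr' : r + 1 = j
    · rw [← hr', h2]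
    exact (h3 r j hr hr').le
  eq_or_eq r j h := by
    by_contra hcon
    push Not at hcon
    exact (h3 r j hcon.1 fun h' => hcon.2 (eq_sub_of_add_eq h')).ne h

end PolygonData

/-- The normals of the lines of integral slope at most `s` in absolute value. -/
def normals (s : ℤ) : Set (Fin 2 → ℤ) := {n | |n 1| = 1 ∧ |n 0| ≤ s}

theorem finite_normals (s : ℤ) : (normals s).Finite := by
  refine (Set.finite_Icc (![-s, -1] : Fin 2 → ℤ) ![s, 1]).subset ?_
  rintro n ⟨h1, h2⟩
  have h1' := abs_le.1 h1.le
  have h2' := abs_le.1 h2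
  constructor <;> intro i <;> fin_cases i <;> simp <;> omega

theorem ne_zero_of_mem_normals {s : ℤ} {n : Fin 2 → ℤ} (h : n ∈ normals s) : n 1 ≠ 0 := by
  intro h0
  have := h.1
  rw [h0] at this
  norm_num at this

/-- Repeated cuts at the same place produce polygons in which the lowest vertex is hard to reach:
each cut needs two more vertices and costs one more step. -/
theorem exists_polygon_notMem_reach {ι : Type} [Fintype ι] (D : PolygonData ι) {i₀ iu : ι}
    (hiu : iu ≠ i₀) {r m : ℕ} (hb : Bornology.IsBounded D.carrier)
    (h1 : D.row i₀ = ![(r : ℤ) + 1, -1]) (h2 : D.row (D.prev i₀) = ![-((r : ℤ) + 1), -1])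
    (hrow : ∀ i, D.row i ∈ normals (r + 1))
    (hv : D.pt i₀ ∉ Reach D.carrier (normals (r + 1)) (D.pt iu) m) {j : ℕ} (hj : j ≤ r) :
    ∃ (κ : Type) (_ : Fintype κ) (D' : PolygonData κ) (k₀ ku : κ), ku ≠ k₀ ∧
      Fintype.card κ = Fintype.card ι + 2 * j ∧ Bornology.IsBounded D'.carrier ∧
      D'.row k₀ = ![(r : ℤ) + 1 - j, -1] ∧ D'.row (D'.prev k₀) = ![-((r : ℤ) + 1 - j), -1] ∧
      (∀ i, D'.row i ∈ normals (r + 1)) ∧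
      D'.pt k₀ ∉ Reach D'.carrier (normals (r + 1)) (D'.pt ku) (m + j) := by
  induction j with
  | zero => exact ⟨ι, inferInstance, D, i₀, iu, hiu, rfl, hb, by simpa using h1, by simpa using h2,
      hrow, hv⟩
  | succ j ih =>
    obtain ⟨κ, _, D', k₀, ku, hne, hcard, hb', h1', h2', hrow', hv'⟩ := ih (by omega)
    have hs' : (0 : ℤ) < r + 1 - (j + 1 : ℕ) := by push_cast; omega
    have hs : (r + 1 - (j + 1 : ℕ) : ℤ) < r + 1 - j := by push_cast; omega
    have hcomp : IsCompact D'.carrier := Metric.isCompact_of_isClosed_isBounded D'.isClosed_carrier hb'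
    obtain ⟨t, ⟨D'', hcar, hpt, hr1, hr2, hrows, -, hpts⟩, ht⟩ :=
      ((D'.eventually_exists_cut hs' hs h1' h2').and
        (eventually_apex_notMem_reach hcomp (D'.cone_of_rows h1' h2') (Int.cast_lt.2 hs)
          (finite_normals _) (fun n hn => Or.inr (ne_zero_of_mem_normals hn)) (D'.pt_mem ku) hv'
          (Or.inl fun n hn => ne_zero_of_mem_normals hn))).exists
    refine ⟨Option (Option κ), inferInstance, D'', none, some (some ku), by simp, ?_, ?_, hr1, hr2,
      ?_, ?_⟩
    · rw [Fintype.card_option, Fintype.card_option, hcard]; ring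
    · rw [hcar]; exact hb'.subset (cutSet_subset _ _ _ _)
    · intro i
      rcases hrows i with h | h | ⟨l, h⟩
      · rw [h]
        exact ⟨by simp, by simp only [Matrix.cons_val_zero]; rw [abs_of_pos hs']; push_cast; omega⟩
      · rw [h]
        exact ⟨by simp, by
          simp only [Matrix.cons_val_zero]; rw [abs_neg, abs_of_pos hs']; push_cast; omega⟩
      · rw [h]; exact hrow' l
    · rw [hcar, hpt, hpts ku hne]
      exact ht

/-- The triangle with vertices `(0, 0)`, `(1, -s)` and `(2, 0)`. -/
noncomputable def triangle (s : ℤ) (hs : 0 < s) : PolygonData (Fin 3) := by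
  have hs' : (0 : ℝ) < s := by exact_mod_cast hs
  refine PolygonData.ofFin ![![-s, -1], ![s, -1], ![0, 1]] ![0, 2 * s, 0]
    ![![0, 0], ![1, -s], ![2, 0]] ?_ ?_ ?_
  · intro r; fin_cases r <;> simp [dot]; ring
  · intro r; fin_cases r <;> simp [dot]; ring
  · intro r j h1 h2; fin_cases r <;> fin_cases j <;> simp [dot] at h1 h2 ⊢ <;> linarith

/-- The quadrilateral with vertices `(-1 / (s + 1), -1 / (s + 1))`, `(1, -(s + 1))`,
`(2 + 1 / s, 0)` and `(0, 0)`. -/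
noncomputable def quadrilateral (s : ℤ) (hs : 0 < s) : PolygonData (Fin 4) := by
  have hs' : (0 : ℝ) < s := by exact_mod_cast hs
  have h0 : (s : ℝ) + 1 ≠ 0 := by positivity
  have h0' : 0 < ((s : ℝ) + 1)⁻¹ := by positivity
  have h0'' : 0 < (s : ℝ)⁻¹ := by positivity
  refine PolygonData.ofFin ![![-s, -1], ![s, -1], ![0, 1], ![-1, 1]] ![1, 2 * s + 1, 0, 0]
    ![![-((s : ℝ) + 1)⁻¹, -((s : ℝ) + 1)⁻¹], ![1, -(s + 1)], ![2 + (s : ℝ)⁻¹, 0], ![0, 0]] ?_ ?_ ?_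
  · intro r; fin_cases r <;> simp [dot]
    field_simp; ring
  · intro r; fin_cases r <;> simp [dot]
    field_simp
  · intro r j h1 h2
    have e : (s : ℝ) * (s : ℝ)⁻¹ = 1 := mul_inv_cancel₀ hs'.ne'
    have e' : (s : ℝ) * ((s : ℝ) + 1)⁻¹ = 1 - ((s : ℝ) + 1)⁻¹ := by field_simp; ring
    fin_cases r <;> fin_cases j <;> simp [dot] at h1 h2 ⊢ <;> nlinarith

theorem isBounded_of_forall_abs_le {P : Set (Fin 2 → ℝ)} {R : ℝ}
    (h : ∀ z ∈ P, |z 0| ≤ R ∧ |z 1| ≤ R) : Bornology.IsBounded P := by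
  refine (Metric.isBounded_closedBall (x := (0 : Fin 2 → ℝ)) (r := R)).subset fun z hz => ?_
  obtain ⟨h0, h1⟩ := h z hz
  rw [mem_closedBall_zero_iff, pi_norm_le_iff_of_nonneg ((abs_nonneg _).trans h0)]
  intro i
  fin_cases i
  · exact h0
  · exact h1

theorem isBounded_triangle {s : ℤ} (hs : 0 < s) : Bornology.IsBounded (triangle s hs).carrier := by
  have hs' : (1 : ℝ) ≤ s := by exact_mod_cast hs
  refine isBounded_of_forall_abs_le (R := 2 * s) fun z hz => ?_
  have e0 := hz 0
  have e1 := hz 1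
  have e2 := hz 2
  simp [triangle, PolygonData.ofFin, dot] at e0 e1 e2
  have h1 : 0 ≤ z 0 := by by_contra hcon; nlinarith
  have h2 : z 0 ≤ 2 := by by_contra hcon; nlinarith
  exact ⟨abs_le.2 ⟨by linarith, by linarith⟩, abs_le.2 ⟨by nlinarith, by linarith⟩⟩

theorem isBounded_quadrilateral {s : ℤ} (hs : 0 < s) :
    Bornology.IsBounded (quadrilateral s hs).carrier := by
  have hs' : (1 : ℝ) ≤ s := by exact_mod_cast hs
  refine isBounded_of_forall_abs_le (R := 3 * s + 1) fun z hz => ?_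
  have e0 := hz 0
  have e1 := hz 1
  have e2 := hz 2
  simp [quadrilateral, PolygonData.ofFin, dot] at e0 e1 e2
  have h1 : -1 ≤ z 0 := by by_contra hcon; nlinarith
  have h2 : z 0 ≤ 3 := by by_contra hcon; nlinarith
  exact ⟨abs_le.2 ⟨by linarith, by linarith⟩, abs_le.2 ⟨by nlinarith, by linarith⟩⟩

/-- For every `k ≥ 3` there is a polygon on `k` vertices and two vertices at distance at least
`k / 2` with respect to maximal walks. -/
theorem exists_polygon_le_CDfm {k : ℕ} (hk : 3 ≤ k) : ∃ Q : HPolyhedron 2,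
    Q.IsIrredundantPolygon k ∧ ∃ u ∈ Q.vertices, ∃ v ∈ Q.vertices, u ≠ v ∧
      ((k / 2 : ℕ) : ℕ∞) ≤ Q.CDfm u v := by
  have fin : ∀ {ι : Type} [Fintype ι] (D : PolygonData ι) {i₀ iu : ι} (_ : iu ≠ i₀) {r m : ℕ}
      (_ : Bornology.IsBounded D.carrier) (_ : D.row i₀ = ![(r : ℤ) + 1, -1])
      (_ : D.row (D.prev i₀) = ![-((r : ℤ) + 1), -1]) (_ : ∀ i, D.row i ∈ normals (r + 1))
      (_ : D.pt i₀ ∉ Reach D.carrier (normals (r + 1)) (D.pt iu) m)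
      (_ : k = Fintype.card ι + 2 * r) (_ : k / 2 = m + r + 1), ∃ Q : HPolyhedron 2,
        Q.IsIrredundantPolygon k ∧ ∃ u ∈ Q.vertices, ∃ v ∈ Q.vertices, u ≠ v ∧
        ((k / 2 : ℕ) : ℕ∞) ≤ Q.CDfm u v := by
    intro ι _ D i₀ iu hiu r m hb h1 h2 hrow hv hk1 hk2
    obtain ⟨κ, _, D', k₀, ku, hne, hcard, hb', -, -, hrow', hv'⟩ :=
      exists_polygon_notMem_reach D hiu hb h1 h2 hrow hv le_rfl
    have : Nonempty κ := ⟨k₀⟩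
    refine ⟨D'.toHPolyhedron, D'.isIrredundantPolygon hb' (by omega), _, D'.pt_mem_vertices ku, _,
      D'.pt_mem_vertices k₀, fun h => hne (D'.pt_injective h), ?_⟩
    rw [hk2]
    exact succ_le_CDfm hrow' (D'.pt_mem k₀) hv'
  rcases Nat.even_or_odd' k with ⟨r, hr | hr⟩
  · obtain ⟨r, rfl⟩ : ∃ q, r = q + 2 := ⟨r - 2, by omega⟩
    have hpos : (0 : ℤ) < r + 1 := by omega
    refine fin (quadrilateral (r + 1) hpos) (i₀ := 1) (iu := 3) (by decide) (r := r) (m := 1)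
      (isBounded_quadrilateral hpos) (by simp [quadrilateral, PolygonData.ofFin])
      (by simp [quadrilateral, PolygonData.ofFin]) ?_ ?_ (by simp; omega) (by omega)
    · intro i
      fin_cases i <;> simp [quadrilateral, PolygonData.ofFin, normals, abs_le] <;> omega
    · rintro (h | ⟨x, hx, hxv⟩)
      · have := (quadrilateral (r + 1) hpos).pt_injective h
        revert this
        decide
      · obtain rfl : x = _ := hx
        obtain ⟨n, hn, hn0⟩ := hxv.2.2.2.1
        have e : (n 0 : ℝ) - n 1 * (r + 1 + 1) = 0 := by
          simp [quadrilateral, PolygonData.ofFin, dot] at hn0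
          linarith
        have e' : n 0 - n 1 * (r + 1 + 1) = 0 := by exact_mod_cast e
        have h1 := hn.2
        rw [sub_eq_zero.1 e', abs_mul, hn.1, abs_of_pos (by omega)] at h1
        omega
  · obtain ⟨r, rfl⟩ : ∃ q, r = q + 1 := ⟨r - 1, by omega⟩
    have hpos : (0 : ℤ) < r + 1 := by omega
    refine fin (triangle (r + 1) hpos) (i₀ := 1) (iu := 0) (by decide) (r := r) (m := 0)
      (isBounded_triangle hpos) (by simp [triangle, PolygonData.ofFin])
      (by simp [triangle, PolygonData.ofFin]) ?_ ?_ (by simp; omega) (by omega)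
    · intro i
      fin_cases i <;> simp [triangle, PolygonData.ofFin, normals, abs_le] <;> omega
    · intro h
      have := (triangle (r + 1) hpos).pt_injective h
      revert this
      decide

/-- A pair of vertices that is not at distance `1` with respect to maximal walks is at
distance `2` without restrictions. -/
theorem CD_eq_two {u v : Fin 2 → ℝ} (hu : u ∈ Q.vertices) (hv : v ∈ Q.vertices) (huv : u ≠ v)
    (h : 2 ≤ Q.CDfm u v) : Q.CD u v = 2 := by
  have hno : ¬ ∃ (g : Fin 2 → ℤ) (α : ℝ), Q.IsCircuit g ∧ 0 < α ∧ v - u = α • toReal g := by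
    intro hg
    have := h.trans (circuitDist_le_one hu hv hg _ fun W _ h1 h2 _ _ _ => ⟨h1, h2⟩)
    norm_num at this
  refine le_antisymm (circuitDist_le_two hu hv huv hno _ fun _ _ _ _ _ => trivial)
    (le_circuitDist fun W _ => ?_)
  by_contra hcon
  have hpos := W.length_pos huv
  have h1 : W.length = 1 := by
    have : ¬ 2 ≤ W.length := fun h => hcon (by exact_mod_cast h)
    omega
  have hs := W.step ⟨0, by omega⟩
  rw [W.y_eq_start (i := Fin.castSucc ⟨0, _⟩) (by simp),
    W.y_eq_end (i := Fin.succ ⟨0, _⟩) (by simp [h1])] at hs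
  exact hno ⟨_, _, W.circuit _, W.α_pos _, hs⟩

/-! ### Maximal walks after two cuts at a vertex -/

theorem Step.notMem_interior {P : Set (Fin 2 → ℝ)} {N : Set (Fin 2 → ℤ)} {x y : Fin 2 → ℝ}
    (h : Step P N x y) : y ∉ interior P := by
  intro hy
  have hcont : Continuous fun a : ℝ => x + a • (y - x) := by fun_prop
  have hmem : ∀ᶠ a in nhds (1 : ℝ), x + a • (y - x) ∈ P := by
    refine (hcont.tendsto 1).eventually ?_
    rw [one_smul, add_sub_cancel]
    exact mem_interior_iff_mem_nhds.1 hy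
  obtain ⟨e, he, hball⟩ := Metric.eventually_nhds_iff.1 hmem
  refine h.2.2.2.2 (1 + e / 2) (by linarith) (hball ?_)
  rw [Real.dist_eq, add_sub_cancel_left, abs_of_pos (half_pos he)]
  exact half_lt_self he

theorem Step.exists_tight {ι : Type} [Finite ι] {D : PolygonData ι} {N : Set (Fin 2 → ℤ)}
    {x y : Fin 2 → ℝ} (h : Step D.carrier N x y) : ∃ i, dot (D.row i) y = D.rhs i := by
  by_contra hcon
  push Not at hcon
  exact h.notMem_interior
    (D.mem_interior_of_forall_lt fun i => lt_of_le_of_ne (h.2.1 i) (hcon i))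

section TwoCuts

open Filter Topology

/-- Two successive cuts at a vertex `v`. If no point on the vertical line through `v` is reached
from `u` in one step, then the lowest vertex of the resulting polygon is not reached in two steps;
and it is reached in three steps only by a vertical last step from a point at which an edge that is
not adjacent to `v` is tight. -/
theorem exists_polygon_of_two_cuts {ι : Type} [Fintype ι] (D : PolygonData ι)
    (hb : Bornology.IsBounded D.carrier) {i₀ iu : ι} (hiu : iu ≠ i₀) {s s₁ s₂ : ℤ} (hs₂ : 0 < s₂)
    (hs₁ : s₂ < s₁) (hs : s₁ < s) (h1 : D.row i₀ = ![s, -1]) (h2 : D.row (D.prev i₀) = ![-s, -1])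
    {N : Set (Fin 2 → ℤ)} (hN : N.Finite) (hN0 : ∀ n ∈ N, n 0 ≠ 0 ∨ n 1 ≠ 0)
    (hrow : ∀ i, D.row i ∈ N) (hN1 : ∀ σ ∈ ({s₁, s₂} : Set ℤ), ![σ, -1] ∈ N ∧ ![-σ, -1] ∈ N)
    (hu : ∀ x ∈ Reach D.carrier N (D.pt iu) 1, x 0 ≠ D.pt i₀ 0)
    {F : Set (Fin 2 → ℝ)} (hF : F.Finite) (hFD : F ⊆ D.carrier) (hvF : D.pt i₀ ∉ F) :
    ∃ (κ : Type) (_ : Fintype κ) (D' : PolygonData κ) (k₀ ku : κ), ku ≠ k₀ ∧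
      D'.carrier ⊆ D.carrier ∧ F ⊆ D'.carrier ∧ D'.pt ku = D.pt iu ∧
      D'.pt k₀ 0 = D.pt i₀ 0 ∧ D'.row k₀ = ![s₂, -1] ∧ (∀ i, D'.row i ∈ N) ∧
      (∀ i, ∃ j, D'.row j = D.row i) ∧ D'.pt k₀ ∉ F ∧
      D'.pt k₀ ∉ Reach D'.carrier N (D.pt iu) 2 ∧ ∀ y₁ y₂, Step D'.carrier N (D.pt iu) y₁ →
        Step D'.carrier N y₁ y₂ → Step D'.carrier N y₂ (D'.pt k₀) →
        Step D.carrier N (D.pt iu) y₁ ∧ y₂ 0 = D.pt i₀ 0 ∧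
          ∃ i, i ≠ i₀ ∧ i ≠ D.prev i₀ ∧ dot (D.row i) y₂ = D.rhs i := by
  have hcone := D.cone_of_rows h1 h2
  have hcomp := Metric.isCompact_of_isClosed_isBounded D.isClosed_carrier hb
  have hv1 : D.pt i₀ ∉ Reach D.carrier N (D.pt iu) 1 := fun h => hu _ h rfl
  -- the first cut
  obtain ⟨t₁, ⟨D₁, hcar₁, hpt₁, hr₁, hr₁', hrows₁, hrowsD₁, hpts₁⟩, hstep₁, hapex₁, hF₁, hvF₁,
      ht₁⟩ :=
    ((D.eventually_exists_cut (hs₂.trans hs₁) hs h1 h2).and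
      ((eventually_step_of_step_cutSet hcomp hcone (Int.cast_lt.2 hs) hN hN0 (D.pt_mem iu)
        hv1).and ((eventually_apex_notMem_reach hcomp hcone (Int.cast_lt.2 hs) hN hN0
        (D.pt_mem iu) hv1 (Or.inr hu)).and
      (((eventually_all_finite hF).2 fun z hz => eventually_mem_cutSet hcone (Int.cast_lt.2 hs)
        (hFD hz) fun h => hvF (h ▸ hz)).and
      ((eventually_apex_notMem hF hvF).and self_mem_nhdsWithin))))).exists
  have ht₁ : 0 < t₁ := ht₁
  rw [← hcar₁, ← hpt₁] at hapex₁
  rw [← hcar₁] at hstep₁ hF₁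
  rw [← hpt₁] at hvF₁
  have hu₁ : D.pt iu ∈ D₁.carrier := by rw [← hpts₁ iu hiu]; exact D₁.pt_mem _
  have hb₁ : Bornology.IsBounded D₁.carrier := by
    rw [hcar₁]; exact hb.subset (cutSet_subset _ _ _ _)
  have hcone₁ := D₁.cone_of_rows hr₁ hr₁'
  have hcomp₁ := Metric.isCompact_of_isClosed_isBounded D₁.isClosed_carrier hb₁
  have hfin₁ := finite_reach D₁.carrier hN hN0 (D.pt iu) 2
  have hpt₁0 : D₁.pt none 0 = D.pt i₀ 0 := by rw [hpt₁]; simp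
  have hpt₁1 : D₁.pt none 1 = D.pt i₀ 1 + t₁ := by rw [hpt₁]; simp
  -- the second cut
  obtain ⟨t₂, ⟨D₂, hcar₂, hpt₂, hr₂, hr₂', hrows₂, hrowsD₂, hpts₂⟩, hstep₂, hapex₂, hdot₂,
      hF₂, hvF₂⟩ :=
    ((D₁.eventually_exists_cut hs₂ hs₁ hr₁ hr₁').and
      ((eventually_step_of_step_cutSet hcomp₁ hcone₁ (Int.cast_lt.2 hs₁) hN hN0 hu₁ hapex₁).and
      ((eventually_apex_notMem hfin₁ hapex₁).and
      ((eventually_dot_ne_zero (v := D₁.pt none) hN hN0 hfin₁).and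
      (((eventually_all_finite hF).2 fun z hz => eventually_mem_cutSet hcone₁ (Int.cast_lt.2 hs₁)
        (hF₁ z hz) fun h => hvF₁ (h ▸ hz)).and (eventually_apex_notMem hF hvF₁)))))).exists
  rw [← hcar₂] at hstep₂ hF₂
  rw [← hpt₂] at hapex₂ hdot₂ hvF₂
  have hsub₁ : D₁.carrier ⊆ D.carrier := by rw [hcar₁]; exact cutSet_subset _ _ _ _
  have hsub₂ : D₂.carrier ⊆ D₁.carrier := by rw [hcar₂]; exact cutSet_subset _ _ _ _
  have hrowN₁ : ∀ i, D₁.row i ∈ N := by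
    intro i
    rcases hrows₁ i with h | h | ⟨j, h⟩
    · rw [h]; exact (hN1 s₁ (by simp)).1
    · rw [h]; exact (hN1 s₁ (by simp)).2
    · rw [h]; exact hrow j
  have hrowN₂ : ∀ i, D₂.row i ∈ N := by
    intro i
    rcases hrows₂ i with h | h | ⟨j, h⟩
    · rw [h]; exact (hN1 s₂ (by simp)).1
    · rw [h]; exact (hN1 s₂ (by simp)).2
    · rw [h]; exact hrowN₁ j
  refine ⟨_, inferInstance, D₂, none, some (some (some (some iu))), by simp,
    hsub₂.trans hsub₁, hF₂, ?_, ?_, hr₂, hrowN₂, ?_, hvF₂, fun h => hapex₂ (hstep₂.1 2 le_rfl h), ?_⟩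
  · rw [hpts₂ _ (by simp), hpts₁ _ hiu]
  · rw [hpt₂, ← hpt₁0]; simp
  · intro i
    exact ⟨some (some (some (some i))), by rw [hrowsD₂, hrowsD₁]⟩
  intro y₁ y₂ hy₁ hy₂ hy₃
  -- all but the last step are steps of the larger polygons
  have hy₁' := hstep₂.2 0 (by norm_num) _ (Set.mem_singleton _) _ hy₁
  have hy₁'' := hstep₁.2 0 (by norm_num) _ (Set.mem_singleton _) _ hy₁'
  have hy₂' := hstep₂.2 1 (by norm_num) _ (Or.inr ⟨_, Set.mem_singleton _, hy₁⟩) _ hy₂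
  have hy₂r : y₂ ∈ Reach D₁.carrier N (D.pt iu) 2 :=
    Or.inr ⟨y₁, Or.inr ⟨_, Set.mem_singleton _, hy₁'⟩, hy₂'⟩
  obtain ⟨n, hn, hn0⟩ := hy₃.2.2.2.1
  have hx : y₂ 0 = D.pt i₀ 0 := by rw [(hdot₂ y₂ hy₂r n hn hn0).2, hpt₁0]
  refine ⟨hy₁'', hx, ?_⟩
  have hne : y₂ ≠ D₁.pt none := fun h => hapex₁ (h ▸ hy₂r)
  have hmem₁ : y₂ ∈ cutSet D.carrier (D.pt i₀) s₁ t₁ := hcar₁ ▸ hy₂'.2.1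
  have hgt : D.pt i₀ 1 + t₁ < y₂ 1 := by
    have h := hmem₁.2
    rw [hx, sub_self, abs_zero, mul_zero, zero_add] at h
    refine lt_of_le_of_ne (by linarith) fun h' => hne ?_
    exact plane_ext (by rw [hx, hpt₁0]) (by rw [hpt₁1, h'])
  by_contra hcon
  push Not at hcon
  -- otherwise the second step could be prolonged
  have hint : y₂ ∈ interior D.carrier := by
    refine D.mem_interior_of_forall_lt fun i => ?_
    have h := hy₂'.2.1
    by_cases hi : i = i₀
    · have := D.tight i₀
      rw [hi, ← this, h1]
      simp only [dot, Matrix.cons_val_zero, Matrix.cons_val_one, hx]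
      push_cast
      linarith
    by_cases hi' : i = D.prev i₀
    · have := D.tight_prev i₀
      rw [hi', ← this, h2]
      simp only [dot, Matrix.cons_val_zero, Matrix.cons_val_one, hx]
      push_cast
      linarith
    exact lt_of_le_of_ne (hsub₁ h i) (hcon i hi hi')
  have hopen : IsOpen {z : Fin 2 → ℝ | (s₁ : ℝ) * |z 0 - D.pt i₀ 0| + t₁ < z 1 - D.pt i₀ 1} :=
    isOpen_lt (by fun_prop) (by fun_prop)
  refine hy₂'.notMem_interior (mem_interior.2 ⟨_, ?_, isOpen_interior.inter hopen, hint, ?_⟩)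
  · rw [hcar₁]
    exact fun z hz => ⟨interior_subset hz.1, le_of_lt hz.2⟩
  · change (s₁ : ℝ) * |y₂ 0 - D.pt i₀ 0| + t₁ < y₂ 1 - D.pt i₀ 1
    rw [hx, sub_self, abs_zero, mul_zero, zero_add]
    linarith

end TwoCuts

/-- A maximal walk of length at most `3` to a point that is not reached in two steps. -/
theorem CircuitWalk.exists_three_steps {ι : Type} [Fintype ι] [Nonempty ι] {D : PolygonData ι}
    {N : Set (Fin 2 → ℤ)} (hN : ∀ i, D.row i ∈ N) {u v : Fin 2 → ℝ}
    {W : CircuitWalk D.toHPolyhedron u v} (hf : W.IsFeasible) (hm : W.IsMaximal)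
    (hv : v ∈ D.carrier) (hv2 : v ∉ Reach D.carrier N u 2) (hl : W.length ≤ 3) :
    ∃ (i j : Fin W.length) (y₁ y₂ : Fin 2 → ℝ), i ≠ j ∧
      W.y i.succ - W.y i.castSucc = y₁ - u ∧ W.y j.succ - W.y j.castSucc = v - y₂ ∧
      Step D.carrier N u y₁ ∧ Step D.carrier N y₁ y₂ ∧ Step D.carrier N y₂ v := by
  have hlen : W.length = 3 := by
    by_contra hcon
    exact hv2 (reach_mono _ _ _ (by omega) (W.mem_reach hN hf hm hv))
  obtain ⟨c, hc0, hc3, hc⟩ := W.exists_seq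
  rw [hlen] at hc3
  have hstep : ∀ i : Fin W.length, Step D.carrier N (c i) (c (i + 1)) := fun i => by
    have := W.isStep hN hf hm hv i
    rwa [(hc i).1, (hc i).2] at this
  refine ⟨⟨0, by omega⟩, ⟨2, by omega⟩, c 1, c 2, by simp, ?_, ?_, ?_, hstep ⟨1, by omega⟩, ?_⟩
  · rw [(hc _).1, (hc _).2]; exact congrArg (c 1 - ·) hc0
  · rw [(hc _).1, (hc _).2]; exact congrArg (· - c 2) hc3
  · rw [← hc0]; exact hstep ⟨0, by omega⟩
  · rw [← hc3]; exact hstep ⟨2, by omega⟩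

theorem CircuitWalk.g_eq_up {u v : Fin 2 → ℝ} (W : CircuitWalk Q u v) (i : Fin W.length)
    {w : Fin 2 → ℝ} (h : W.y i.succ - W.y i.castSucc = w) (h0 : w 0 = 0) (h1 : 0 < w 1) :
    W.g i = ![0, 1] := by
  refine primitive_eq_of_smul_eq (W.circuit i).2.2.1 (by decide) (W.α_pos i) h1 ?_
  rw [← W.step i, h]
  apply plane_ext <;> simp [toReal, h0]

theorem CircuitWalk.g_eq_down {u v : Fin 2 → ℝ} (W : CircuitWalk Q u v) (i : Fin W.length)
    {w : Fin 2 → ℝ} (h : W.y i.succ - W.y i.castSucc = w) (h0 : w 0 = 0) (h1 : w 1 < 0) :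
    W.g i = ![0, -1] := by
  refine primitive_eq_of_smul_eq (W.circuit i).2.2.1 (by decide) (W.α_pos i) (neg_pos.2 h1) ?_
  rw [← W.step i, h]
  apply plane_ext <;> simp [toReal, h0]

/-- A maximal walk with three steps. -/
theorem CDfm_le_three {ι : Type} [Fintype ι] [Nonempty ι] {D : PolygonData ι} {i : ι}
    {u p q : Fin 2 → ℝ} (hu : u ∈ D.carrier) (hp : p ∈ D.carrier) (hq : q ∈ D.carrier)
    (hup : u ≠ p) (hpq : p ≠ q) (hqv : q ≠ D.pt i) (h1 : ∃ j, dot (D.row j) (p - u) = 0)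
    (h2 : ∃ j, dot (D.row j) (q - p) = 0) (h3 : ∃ j, dot (D.row j) (D.pt i - q) = 0)
    (m1 : ∀ a : ℝ, 1 < a → u + a • (p - u) ∉ D.carrier)
    (m2 : ∀ a : ℝ, 1 < a → p + a • (q - p) ∉ D.carrier) :
    D.toHPolyhedron.CDfm u (D.pt i) ≤ 3 := by
  set c : ℕ → Fin 2 → ℝ := fun k =>
    if k = 0 then u else if k = 1 then p else if k = 2 then q else D.pt i with hc
  have hi := D.pt_mem_vertices i
  obtain ⟨W, hW, -, hWf, hWm, -, -⟩ := exists_circuitWalk_of_seq (Q := D.toHPolyhedron)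
    (u := u) (v := D.pt i) 3 c rfl rfl (by
      intro k hk
      interval_cases k
      · obtain ⟨j, hj⟩ := h1; exact D.aligned_of_dot_eq_zero hj
      · obtain ⟨j, hj⟩ := h2; exact D.aligned_of_dot_eq_zero hj
      · obtain ⟨j, hj⟩ := h3; exact D.aligned_of_dot_eq_zero hj) (by
      intro k hk
      interval_cases k
      · exact hup
      · exact hpq
      · exact hqv)
  have e : (3 : ℕ∞) = (W.length : ℕ∞) := by rw [hW]; rfl
  rw [e]
  refine circuitDist_le W ⟨hWf fun k hk => ?_, hWm fun k hk a ha => ?_⟩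
  · rw [D.carrier_toHPolyhedron]
    interval_cases k
    · exact hu
    · exact hp
    · exact hq
  · interval_cases k
    · rw [D.carrier_toHPolyhedron]; exact m1 a ha
    · rw [D.carrier_toHPolyhedron]; exact m2 a ha
    · refine notMem_of_end_extreme (y := D.pt i) ?_ hi (sub_ne_zero.2 hqv.symm) one_pos
        (one_smul ℝ _).symm ha
      rw [D.carrier_toHPolyhedron]
      exact hq

theorem PolygonData.add_smul_notMem {ι : Type} (D : PolygonData ι) (i : ι) {x y : Fin 2 → ℝ}
    (h1 : dot (D.row i) y = D.rhs i) (h2 : dot (D.row i) x < D.rhs i) {a : ℝ} (ha : 1 < a) :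
    x + a • (y - x) ∉ D.carrier := by
  intro h
  have := h i
  rw [dot_add, dot_smul, dot_sub, h1] at this
  nlinarith

/-! ### A polygon where short maximal walks repeat a circuit -/

namespace Trapezoid

/-- The quadrilateral with vertices `(0, 0)`, `(1, -10)`, `(3, 10)` and `(0, 10)`. -/
noncomputable def data : PolygonData (Fin 4) := by
  refine PolygonData.ofFin ![![-10, -1], ![10, -1], ![0, 1], ![-1, 0]] ![0, 20, 10, 0]
    ![![0, 0], ![1, -10], ![3, 10], ![0, 10]] ?_ ?_ ?_
  · intro r
    fin_cases r <;> simp [dot]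
    norm_num
  · intro r
    fin_cases r <;> simp [dot]
    norm_num
  · intro r j h1 h2; fin_cases r <;> fin_cases j <;> simp [dot] at h1 h2 ⊢ <;> norm_num

/-- The normals of the quadrilateral and of the edges of slopes `± 9` and `± 8`. -/
def N : Set (Fin 2 → ℤ) :=
  {![-1, 0], ![0, 1], ![10, -1], ![-10, -1], ![9, -1], ![-9, -1], ![8, -1], ![-8, -1]}

theorem finite_N : N.Finite := by unfold N; exact Set.toFinite _

theorem mem_carrier {z : Fin 2 → ℝ} (h : z ∈ data.carrier) :
    -10 * z 0 - z 1 ≤ 0 ∧ 10 * z 0 - z 1 ≤ 20 ∧ z 1 ≤ 10 ∧ 0 ≤ z 0 := by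
  have h0 := h 0
  have h1 := h 1
  have h2 := h 2
  have h3 := h 3
  simp [data, PolygonData.ofFin, dot] at h0 h1 h2 h3
  exact ⟨by linarith, by linarith, by linarith, by linarith⟩

theorem mem_carrier_of {z : Fin 2 → ℝ} (h : -10 * z 0 - z 1 ≤ 0 ∧ 10 * z 0 - z 1 ≤ 20 ∧
    z 1 ≤ 10 ∧ 0 ≤ z 0) : z ∈ data.carrier := by
  intro i
  fin_cases i <;> simp [data, PolygonData.ofFin, dot] <;> linarith

theorem tight_cases {z : Fin 2 → ℝ} {i : Fin 4} (h : dot (data.row i) z = data.rhs i) :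
    (i = 0 ∧ -10 * z 0 - z 1 = 0) ∨ (i = 1 ∧ 10 * z 0 - z 1 = 20) ∨ (i = 2 ∧ z 1 = 10) ∨
      (i = 3 ∧ z 0 = 0) := by
  fin_cases i <;> simp [data, PolygonData.ofFin, dot] at h ⊢ <;> linarith

theorem dot_cases {n : Fin 2 → ℤ} (hn : n ∈ N) {w : Fin 2 → ℝ} (h : dot n w = 0) :
    w 0 = 0 ∨ w 1 = 0 ∨ w 1 = 10 * w 0 ∨ w 1 = -10 * w 0 ∨ w 1 = 9 * w 0 ∨ w 1 = -9 * w 0 ∨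
      w 1 = 8 * w 0 ∨ w 1 = -8 * w 0 := by
  simp only [N, Set.mem_insert_iff, Set.mem_singleton_iff] at hn
  rcases hn with rfl | rfl | rfl | rfl | rfl | rfl | rfl | rfl <;>
    simp [dot] at h
  · exact Or.inl h
  · exact Or.inr (Or.inl h)
  · exact Or.inr (Or.inr (Or.inl (by linarith)))
  · exact Or.inr (Or.inr (Or.inr (Or.inl (by linarith))))
  · exact Or.inr (Or.inr (Or.inr (Or.inr (Or.inl (by linarith)))))
  · exact Or.inr (Or.inr (Or.inr (Or.inr (Or.inr (Or.inl (by linarith))))))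
  · exact Or.inr (Or.inr (Or.inr (Or.inr (Or.inr (Or.inr (Or.inl (by linarith)))))))
  · exact Or.inr (Or.inr (Or.inr (Or.inr (Or.inr (Or.inr (Or.inr (by linarith)))))))

theorem pt_three : data.pt 3 = ![0, 10] := rfl

theorem pt_one : data.pt 1 = ![1, -10] := rfl

/-- No point above the lowest vertex is reached in one step from the upper left vertex. -/
theorem reach_one {x : Fin 2 → ℝ} (hx : x ∈ Reach data.carrier N (data.pt 3) 1) : x 0 ≠ 1 := by
  rcases hx with h | ⟨y, rfl, h⟩
  · rw [Set.mem_singleton_iff.1 h, pt_three]; simp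
  intro h1
  obtain ⟨n, hn, hn0⟩ := h.2.2.2.1
  have hd := dot_cases hn hn0
  obtain ⟨i, hi⟩ := h.exists_tight
  rw [pt_three] at hd h
  simp only [Pi.sub_apply, Matrix.cons_val_zero, Matrix.cons_val_one] at hd
  rcases tight_cases hi with ⟨-, h2⟩ | ⟨-, h2⟩ | ⟨-, h2⟩ | ⟨-, h2⟩
  · rcases hd with h | h | h | h | h | h | h | h <;> linarith
  · rcases hd with h | h | h | h | h | h | h | h <;> linarith
  · -- the horizontal step along the top can be prolonged
    refine h.2.2.2.2 2 one_lt_two (mem_carrier_of ?_)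
    simp only [Pi.add_apply, Pi.smul_apply, Pi.sub_apply, Matrix.cons_val_zero,
      Matrix.cons_val_one, smul_eq_mul, h1, h2]
    norm_num
  · linarith

/-- The first of two steps that lead from the upper left vertex to `(1, 10)` is vertical. -/
theorem first_step {P : Set (Fin 2 → ℝ)} (hP : data.pt 3 ∈ P) {y : Fin 2 → ℝ}
    (h1 : Step data.carrier N (data.pt 3) y) (h2 : Step P N y ![1, 10]) : y 0 = 0 := by
  obtain ⟨n, hn, hn0⟩ := h1.2.2.2.1
  obtain ⟨n', hn', hn0'⟩ := h2.2.2.2.1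
  have hd := dot_cases hn hn0
  have hd' := dot_cases hn' hn0'
  have hy1 : y 0 ≠ 1 := reach_one (Or.inr ⟨_, Set.mem_singleton _, h1⟩)
  obtain ⟨m0, m1, m2, m3⟩ := mem_carrier h1.2.1
  obtain ⟨i, hi⟩ := h1.exists_tight
  rw [pt_three] at hd h1 hP
  simp only [Pi.sub_apply, Matrix.cons_val_zero, Matrix.cons_val_one, sub_zero] at hd hd'
  by_contra hy0
  have hpos : 0 < y 0 := lt_of_le_of_ne m3 (Ne.symm hy0)
  by_cases htop : y 1 = 10
  · -- two steps along the top: one of them is not maximal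
    rcases lt_or_gt_of_ne hy1 with h | h
    · refine h1.2.2.2.2 (1 / y 0) ((one_lt_div hpos).2 h) (mem_carrier_of ?_)
      have : 1 / y 0 * y 0 = 1 := one_div_mul_cancel hpos.ne'
      simp only [Pi.add_apply, Pi.smul_apply, Pi.sub_apply, Matrix.cons_val_zero,
        Matrix.cons_val_one, htop, smul_eq_mul, sub_zero, sub_self, mul_zero, add_zero, zero_add,
        this]
      norm_num
    · refine h2.2.2.2.2 (y 0 / (y 0 - 1)) ((one_lt_div (by linarith)).2 (by linarith)) ?_
      convert hP using 1
      have : y 0 - 1 ≠ 0 := by linarith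
      apply plane_ext
      · simp only [Pi.add_apply, Pi.smul_apply, Pi.sub_apply, Matrix.cons_val_zero, smul_eq_mul]
        field_simp
        ring
      · simp only [Pi.add_apply, Pi.smul_apply, Pi.sub_apply, Matrix.cons_val_zero,
          Matrix.cons_val_one, smul_eq_mul, htop]
        ring
  · rcases tight_cases hi with ⟨-, h⟩ | ⟨-, h⟩ | ⟨-, h⟩ | ⟨-, h⟩
    · rcases hd with h' | h' | h' | h' | h' | h' | h' | h' <;> linarith
    · rcases hd with h' | h' | h' | h' | h' | h' | h' | h'
      · exact hy0 h'
      · exact htop (by linarith)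
      · linarith
      · rcases hd' with h'' | h'' | h'' | h'' | h'' | h'' | h'' | h'' <;> linarith
      · linarith
      · rcases hd' with h'' | h'' | h'' | h'' | h'' | h'' | h'' | h'' <;> linarith
      · linarith
      · rcases hd' with h'' | h'' | h'' | h'' | h'' | h'' | h'' | h'' <;> linarith
    · exact htop h
    · exact hy0 h

theorem isBounded : Bornology.IsBounded data.carrier := by
  refine isBounded_of_forall_abs_le (R := 30) fun z hz => ?_
  obtain ⟨h0, h1, h2, h3⟩ := mem_carrier hz
  exact ⟨abs_le.2 ⟨by linarith, by linarith⟩, abs_le.2 ⟨by linarith, by linarith⟩⟩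

/-- After two cuts at the lowest vertex of the quadrilateral, the shortest maximal walks from the
upper left to the lowest vertex go down twice. -/
theorem exists_CDfm_lt_CDfmr : ∃ (k : ℕ) (Q : HPolyhedron 2), Q.IsIrredundantPolygon k ∧
    ∃ u ∈ Q.vertices, ∃ v ∈ Q.vertices, u ≠ v ∧ Q.CDfm u v < Q.CDfmr u v := by
  obtain ⟨κ, _, D, k₀, ku, hne, hsub, hF, hpu, hpv, hrow₀, hrowN, hrowD, hvF, hv2, hsteps⟩ :=
    exists_polygon_of_two_cuts data isBounded (i₀ := 1) (iu := 3) (by decide) (s := 10) (s₁ := 9)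
      (s₂ := 8) (by norm_num) (by norm_num) (by norm_num) rfl rfl finite_N
      (by
        intro n hn
        simp only [N, Set.mem_insert_iff, Set.mem_singleton_iff] at hn
        rcases hn with rfl | rfl | rfl | rfl | rfl | rfl | rfl | rfl <;> simp)
      (by intro i; fin_cases i <;> simp [data, PolygonData.ofFin, N])
      (by simp [N])
      (fun x hx => by rw [pt_one]; exact reach_one hx)
      (F := {![0, 0], ![1, 10]}) (Set.toFinite _)
      (by
        rintro z (rfl | rfl) <;> refine mem_carrier_of ?_ <;> norm_num)
      (by
        rw [pt_one]
        rintro (h | h)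
        · simpa using congrFun h 0
        · have := congrFun h 1
          norm_num at this)
  have : Nonempty κ := ⟨k₀⟩
  rw [pt_one] at hpv
  simp only [Matrix.cons_val_zero] at hpv
  have hv := D.pt_mem k₀
  obtain ⟨m0, m1, m2, m3⟩ := mem_carrier (hsub hv)
  have hqne : (![1, 10] : Fin 2 → ℝ) ≠ D.pt k₀ := fun h => hvF (by simp [← h])
  have hb := isBounded.subset hsub
  refine ⟨_, D.toHPolyhedron, D.isIrredundantPolygon hb rfl, _, D.pt_mem_vertices ku, _,
    D.pt_mem_vertices k₀, fun h => hne (D.pt_injective h), ?_⟩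
  rw [hpu]
  have hu : data.pt 3 ∈ D.carrier := hpu ▸ D.pt_mem ku
  have hp : (![0, 0] : Fin 2 → ℝ) ∈ D.carrier := hF (by simp)
  have hq : (![1, 10] : Fin 2 → ℝ) ∈ D.carrier := hF (by simp)
  have hle : D.toHPolyhedron.CDfm (data.pt 3) (D.pt k₀) ≤ 3 := by
    refine CDfm_le_three hu hp hq ?_ ?_ hqne ?_ ?_ ?_
      (fun a ha h => data.add_smul_notMem 0 (by simp [data, PolygonData.ofFin, dot])
        (by simp [data, PolygonData.ofFin, dot]) ha (hsub h))
      (fun a ha h => data.add_smul_notMem 2 (by simp [data, PolygonData.ofFin, dot])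
        (by simp [data, PolygonData.ofFin, dot]) ha (hsub h))
    · rw [pt_three]; intro h; simpa using congrFun h 1
    · intro h; simpa using congrFun h 0
    · obtain ⟨j, hj⟩ := hrowD 3
      exact ⟨j, by rw [hj]; simp [data, PolygonData.ofFin, dot]⟩
    · obtain ⟨j, hj⟩ := hrowD 1
      exact ⟨j, by rw [hj]; simp [data, PolygonData.ofFin, dot]⟩
    · obtain ⟨j, hj⟩ := hrowD 3
      exact ⟨j, by rw [hj]; simp [data, PolygonData.ofFin, dot, hpv]⟩
  refine hle.trans_lt (lt_of_lt_of_le (b := 4) (by norm_num) (le_circuitDist fun W ⟨hf, hm, hr⟩ => ?_))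
  by_contra hcon
  have hl : W.length ≤ 3 := by
    have : ¬ 4 ≤ W.length := fun h => hcon (by exact_mod_cast h)
    omega
  obtain ⟨i, j, y₁, y₂, hij, hi, hj, s1, s2, s3⟩ := W.exists_three_steps hrowN hf hm hv hv2 hl
  obtain ⟨s1', hy2, l, hl0, hl1, hl2⟩ := hsteps y₁ y₂ s1 s2 s3
  rw [pt_one] at hy2
  simp only [Matrix.cons_val_zero] at hy2
  obtain rfl : y₂ = ![1, 10] := by
    rcases tight_cases hl2 with ⟨h, -⟩ | ⟨h, -⟩ | ⟨-, h⟩ | ⟨-, h⟩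
    · exact absurd h hl1
    · exact absurd h hl0
    · exact plane_ext hy2 h
    · linarith
  have hy1 := first_step hu s1' s2
  obtain ⟨n0, n1, n2, n3⟩ := mem_carrier s1'.2.1
  refine hr i j hij ((W.g_eq_down i hi ?_ ?_).trans (W.g_eq_down j hj ?_ ?_).symm)
  · rw [Pi.sub_apply, hy1, pt_three]; simp
  · have : y₁ 1 ≠ 10 := fun h => s1'.2.2.1 (plane_ext hy1 h)
    rw [Pi.sub_apply, pt_three]
    exact sub_neg.2 (lt_of_le_of_ne n2 this)
  · rw [Pi.sub_apply, hpv]; simp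
  · have : D.pt k₀ 1 ≠ 10 := fun h => hqne (plane_ext hpv.symm h.symm)
    rw [Pi.sub_apply]
    exact sub_neg.2 (lt_of_le_of_ne m2 this)

end Trapezoid

/-! ### A polygon where short maximal walks step backwards -/

namespace Hexagon

/-- The hexagon with vertices `(0, 0)`, `(1 / 2, -10)`, `(1, -15)`, `(53 / 20, 3 / 2)`,
`(9 / 10, 19)` and `(0, 10)`. -/
noncomputable def data : PolygonData (Fin 6) := by
  refine PolygonData.ofFin ![![-20, -1], ![-10, -1], ![10, -1], ![10, 1], ![-10, 1], ![-1, 0]]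
    ![0, 5, 25, 28, 10, 0]
    ![![0, 0], ![1 / 2, -10], ![1, -15], ![53 / 20, 3 / 2], ![9 / 10, 19], ![0, 10]] ?_ ?_ ?_
  · intro r; fin_cases r <;> simp [dot] <;> norm_num
  · intro r; fin_cases r <;> simp [dot] <;> norm_num
  · intro r j h1 h2; fin_cases r <;> fin_cases j <;> simp [dot] at h1 h2 ⊢ <;> norm_num

/-- The normals of the hexagon and of the edges of slopes `± 9` and `± 8`. -/
def N : Set (Fin 2 → ℤ) :=
  {![-20, -1], ![-10, -1], ![10, -1], ![10, 1], ![-10, 1], ![-1, 0], ![9, -1], ![-9, -1],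
    ![8, -1], ![-8, -1]}

theorem finite_N : N.Finite := by unfold N; exact Set.toFinite _

theorem mem_carrier {z : Fin 2 → ℝ} (h : z ∈ data.carrier) :
    -20 * z 0 - z 1 ≤ 0 ∧ -10 * z 0 - z 1 ≤ 5 ∧ 10 * z 0 - z 1 ≤ 25 ∧ 10 * z 0 + z 1 ≤ 28 ∧
      -10 * z 0 + z 1 ≤ 10 ∧ 0 ≤ z 0 := by
  have h0 := h 0
  have h1 := h 1
  have h2 := h 2
  have h3 := h 3
  have h4 := h 4
  have h5 := h 5
  simp [data, PolygonData.ofFin, dot] at h0 h1 h2 h3 h4 h5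
  exact ⟨by linarith, by linarith, by linarith, by linarith, by linarith, by linarith⟩

theorem mem_carrier_of {z : Fin 2 → ℝ} (h : -20 * z 0 - z 1 ≤ 0 ∧ -10 * z 0 - z 1 ≤ 5 ∧
    10 * z 0 - z 1 ≤ 25 ∧ 10 * z 0 + z 1 ≤ 28 ∧ -10 * z 0 + z 1 ≤ 10 ∧ 0 ≤ z 0) :
    z ∈ data.carrier := by
  intro i
  fin_cases i <;> simp [data, PolygonData.ofFin, dot] <;> linarith

theorem tight_cases {z : Fin 2 → ℝ} {i : Fin 6} (h : dot (data.row i) z = data.rhs i) :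
    (i = 0 ∧ -20 * z 0 - z 1 = 0) ∨ (i = 1 ∧ -10 * z 0 - z 1 = 5) ∨
      (i = 2 ∧ 10 * z 0 - z 1 = 25) ∨ (i = 3 ∧ 10 * z 0 + z 1 = 28) ∨
      (i = 4 ∧ -10 * z 0 + z 1 = 10) ∨ (i = 5 ∧ z 0 = 0) := by
  fin_cases i <;> simp [data, PolygonData.ofFin, dot] at h ⊢ <;> linarith

theorem dot_cases {n : Fin 2 → ℤ} (hn : n ∈ N) {w : Fin 2 → ℝ} (h : dot n w = 0) :
    w 0 = 0 ∨ w 1 = -20 * w 0 ∨ w 1 = 10 * w 0 ∨ w 1 = -10 * w 0 ∨ w 1 = 9 * w 0 ∨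
      w 1 = -9 * w 0 ∨ w 1 = 8 * w 0 ∨ w 1 = -8 * w 0 := by
  simp only [N, Set.mem_insert_iff, Set.mem_singleton_iff] at hn
  have e : (n 0 : ℝ) * w 0 + n 1 * w 1 = 0 := h
  rcases hn with rfl | rfl | rfl | rfl | rfl | rfl | rfl | rfl | rfl | rfl <;>
    simp only [Matrix.cons_val_zero, Matrix.cons_val_one] at e <;> push_cast at e
  · exact Or.inr (Or.inl (by linarith))
  · exact Or.inr (Or.inr (Or.inr (Or.inl (by linarith))))
  · exact Or.inr (Or.inr (Or.inl (by linarith)))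
  · exact Or.inr (Or.inr (Or.inr (Or.inl (by linarith))))
  · exact Or.inr (Or.inr (Or.inl (by linarith)))
  · exact Or.inl (by linarith)
  · exact Or.inr (Or.inr (Or.inr (Or.inr (Or.inl (by linarith)))))
  · exact Or.inr (Or.inr (Or.inr (Or.inr (Or.inr (Or.inl (by linarith))))))
  · exact Or.inr (Or.inr (Or.inr (Or.inr (Or.inr (Or.inr (Or.inl (by linarith)))))))
  · exact Or.inr (Or.inr (Or.inr (Or.inr (Or.inr (Or.inr (Or.inr (by linarith)))))))

theorem pt_zero : data.pt 0 = ![0, 0] := rfl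

theorem pt_two : data.pt 2 = ![1, -15] := rfl

/-- No point above the lowest vertex is reached in one step from the origin. -/
theorem reach_one {x : Fin 2 → ℝ} (hx : x ∈ Reach data.carrier N (data.pt 0) 1) : x 0 ≠ 1 := by
  rcases hx with h | ⟨y, rfl, h⟩
  · rw [Set.mem_singleton_iff.1 h, pt_zero]; simp
  intro h1
  obtain ⟨n, hn, hn0⟩ := h.2.2.2.1
  have hd := dot_cases hn hn0
  obtain ⟨i, hi⟩ := h.exists_tight
  obtain ⟨m0, m1, m2, m3, m4, m5⟩ := mem_carrier h.2.1
  rw [pt_zero] at hd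
  simp only [Pi.sub_apply, Matrix.cons_val_zero, Matrix.cons_val_one] at hd
  rcases tight_cases hi with ⟨-, h2⟩ | ⟨-, h2⟩ | ⟨-, h2⟩ | ⟨-, h2⟩ | ⟨-, h2⟩ | ⟨-, h2⟩ <;>
    first
    | linarith
    | rcases hd with h | h | h | h | h | h | h | h <;> linarith

/-- The first of two steps that lead from the origin to `(1, 18)` is vertical. -/
theorem first_step {P : Set (Fin 2 → ℝ)} (hP : ![9 / 10, 19] ∈ P) {y : Fin 2 → ℝ}
    (h1 : Step data.carrier N (data.pt 0) y) (h2 : Step P N y ![1, 18]) : y 0 = 0 := by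
  obtain ⟨n, hn, hn0⟩ := h1.2.2.2.1
  obtain ⟨n', hn', hn0'⟩ := h2.2.2.2.1
  have hd := dot_cases hn hn0
  have hd' := dot_cases hn' hn0'
  have hy1 : y 0 ≠ 1 := reach_one (Or.inr ⟨_, Set.mem_singleton _, h1⟩)
  obtain ⟨m0, m1, m2, m3, m4, m5⟩ := mem_carrier h1.2.1
  obtain ⟨i, hi⟩ := h1.exists_tight
  rw [pt_zero] at hd
  simp only [Pi.sub_apply, Matrix.cons_val_zero, Matrix.cons_val_one, sub_zero] at hd hd'
  by_contra hy0
  have hpos : 0 < y 0 := lt_of_le_of_ne m5 (Ne.symm hy0)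
  have hd' := hd'.resolve_left fun h => hy1 (by linarith)
  have hd := hd.resolve_left hy0
  rcases tight_cases hi with ⟨-, h⟩ | ⟨-, h⟩ | ⟨-, h⟩ | ⟨-, h⟩ | ⟨-, h⟩ | ⟨-, h⟩
  · rcases hd' with h' | h' | h' | h' | h' | h' | h' <;> linarith
  · rcases hd with h' | h' | h' | h' | h' | h' | h' <;>
      first
      | linarith
      | rcases hd' with h'' | h'' | h'' | h'' | h'' | h'' | h'' <;> linarith
  · rcases hd with h' | h' | h' | h' | h' | h' | h' <;>
      first
      | linarith
      | rcases hd' with h'' | h'' | h'' | h'' | h'' | h'' | h'' <;> linarith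
  · -- a second step along the top edge could be prolonged to `(9 / 10, 19)`
    have hgt : 1 < y 0 := by
      rcases hd with h' | h' | h' | h' | h' | h' | h' <;> linarith
    refine h2.2.2.2.2 ((y 0 - 9 / 10) / (y 0 - 1))
      ((one_lt_div (by linarith)).2 (by linarith)) ?_
    convert hP using 1
    have h0 : y 0 - 1 ≠ 0 := by linarith
    have e1 : y 1 = 28 - 10 * y 0 := by linarith
    apply plane_ext
    · simp only [Pi.add_apply, Pi.smul_apply, Pi.sub_apply, Matrix.cons_val_zero, smul_eq_mul]
      field_simp
      ring
    · simp only [Pi.add_apply, Pi.smul_apply, Pi.sub_apply, Matrix.cons_val_zero,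
        Matrix.cons_val_one, smul_eq_mul, e1]
      field_simp
      ring
  · rcases hd with h' | h' | h' | h' | h' | h' | h' <;> linarith
  · exact hy0 h

theorem isBounded : Bornology.IsBounded data.carrier := by
  refine isBounded_of_forall_abs_le (R := 30) fun z hz => ?_
  obtain ⟨h0, h1, h2, h3, h4, h5⟩ := mem_carrier hz
  exact ⟨abs_le.2 ⟨by linarith, by linarith⟩, abs_le.2 ⟨by linarith, by linarith⟩⟩

/-- After two cuts at the lowest vertex of the hexagon, the shortest maximal walks from the origin
to the lowest vertex go up and down. -/
theorem exists_CDfm_lt_CDfmb : ∃ (k : ℕ) (Q : HPolyhedron 2), Q.IsIrredundantPolygon k ∧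
    ∃ u ∈ Q.vertices, ∃ v ∈ Q.vertices, u ≠ v ∧ Q.CDfm u v < Q.CDfmb u v := by
  obtain ⟨κ, _, D, k₀, ku, hne, hsub, hF, hpu, hpv, hrow₀, hrowN, hrowD, hvF, hv2, hsteps⟩ :=
    exists_polygon_of_two_cuts data isBounded (i₀ := 2) (iu := 0) (by decide) (s := 10) (s₁ := 9)
      (s₂ := 8) (by norm_num) (by norm_num) (by norm_num) rfl rfl finite_N
      (by
        intro n hn
        simp only [N, Set.mem_insert_iff, Set.mem_singleton_iff] at hn
        rcases hn with rfl | rfl | rfl | rfl | rfl | rfl | rfl | rfl | rfl | rfl <;> simp)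
      (by intro i; fin_cases i <;> simp [data, PolygonData.ofFin, N])
      (by simp [N])
      (fun x hx => by rw [pt_two]; exact reach_one hx)
      (F := {![0, 10], ![1, 18], ![9 / 10, 19]}) (Set.toFinite _)
      (by
        rintro z (rfl | rfl | rfl) <;> refine mem_carrier_of ?_ <;> norm_num)
      (by
        rw [pt_two]
        rintro (h | h | h)
        · have := congrFun h 1
          norm_num at this
        · have := congrFun h 1
          norm_num at this
        · have := congrFun h 1
          norm_num at this)
  have : Nonempty κ := ⟨k₀⟩
  rw [pt_two] at hpv
  simp only [Matrix.cons_val_zero] at hpv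
  have hv := D.pt_mem k₀
  obtain ⟨m0, m1, m2, m3, m4, m5⟩ := mem_carrier (hsub hv)
  have hqne : (![1, 18] : Fin 2 → ℝ) ≠ D.pt k₀ := fun h => hvF (by simp [← h])
  have hb := isBounded.subset hsub
  refine ⟨_, D.toHPolyhedron, D.isIrredundantPolygon hb rfl, _, D.pt_mem_vertices ku, _,
    D.pt_mem_vertices k₀, fun h => hne (D.pt_injective h), ?_⟩
  rw [hpu]
  have hu : data.pt 0 ∈ D.carrier := hpu ▸ D.pt_mem ku
  have hp : (![0, 10] : Fin 2 → ℝ) ∈ D.carrier := hF (by simp)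
  have hq : (![1, 18] : Fin 2 → ℝ) ∈ D.carrier := hF (by simp)
  have hle : D.toHPolyhedron.CDfm (data.pt 0) (D.pt k₀) ≤ 3 := by
    refine CDfm_le_three hu hp hq ?_ ?_ hqne ?_ ⟨k₀, ?_⟩ ?_
      (fun a ha h => data.add_smul_notMem 4 (by simp [data, PolygonData.ofFin, dot])
        (by simp [data, PolygonData.ofFin, dot]) ha (hsub h))
      (fun a ha h => data.add_smul_notMem 3 (by simp [data, PolygonData.ofFin, dot]; norm_num)
        (by simp [data, PolygonData.ofFin, dot]; norm_num) ha (hsub h))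
    · rw [pt_zero]; intro h; simpa using congrFun h 1
    · intro h; simpa using congrFun h 0
    · obtain ⟨j, hj⟩ := hrowD 5
      exact ⟨j, by rw [hj]; simp [data, PolygonData.ofFin, dot]⟩
    · rw [hrow₀]; simp [dot]; norm_num
    · obtain ⟨j, hj⟩ := hrowD 5
      exact ⟨j, by rw [hj]; simp [data, PolygonData.ofFin, dot, hpv]⟩
  refine hle.trans_lt (lt_of_lt_of_le (b := 4) (by norm_num)
    (le_circuitDist fun W ⟨hf, hm, hbw⟩ => ?_))
  by_contra hcon
  have hl : W.length ≤ 3 := by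
    have : ¬ 4 ≤ W.length := fun h => hcon (by exact_mod_cast h)
    omega
  obtain ⟨i, j, y₁, y₂, -, hi, hj, s1, s2, s3⟩ := W.exists_three_steps hrowN hf hm hv hv2 hl
  obtain ⟨s1', hy2, l, hl0, hl1, hl2⟩ := hsteps y₁ y₂ s1 s2 s3
  rw [pt_two] at hy2
  simp only [Matrix.cons_val_zero] at hy2
  obtain rfl : y₂ = ![1, 18] := by
    obtain ⟨n0, n1, n2, n3, n4, n5⟩ := mem_carrier (hsub s2.2.1)
    rcases tight_cases hl2 with ⟨-, h⟩ | ⟨h, -⟩ | ⟨h, -⟩ | ⟨-, h⟩ | ⟨-, h⟩ | ⟨-, h⟩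
    · linarith
    · exact absurd h hl1
    · exact absurd h hl0
    · exact plane_ext hy2 (by simp only [Matrix.cons_val_one, Matrix.cons_val_zero]; linarith)
    · linarith
    · linarith
  have hy1 := first_step (hF (by simp)) s1' s2
  obtain ⟨n0, n1, n2, n3, n4, n5⟩ := mem_carrier s1'.2.1
  have hup : W.g i = ![0, 1] := by
    refine W.g_eq_up i hi ?_ ?_
    · rw [Pi.sub_apply, hy1, pt_zero]; simp
    · have : y₁ 1 ≠ 0 := fun h => s1'.2.2.1 (plane_ext hy1 h)
      rw [Pi.sub_apply, pt_zero]
      exact sub_pos.2 (lt_of_le_of_ne (by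
        simp only [Matrix.cons_val_one, Matrix.cons_val_zero]; linarith) (Ne.symm this))
  have hdown : W.g j = ![0, -1] := by
    refine W.g_eq_down j hj ?_ ?_
    · rw [Pi.sub_apply, hpv]; simp
    · have : D.pt k₀ 1 ≠ 18 := fun h => hqne (plane_ext hpv.symm h.symm)
      rw [Pi.sub_apply]
      exact sub_neg.2 (lt_of_le_of_ne (by
        simp only [Matrix.cons_val_one, Matrix.cons_val_zero]; linarith) this)
  exact hbw i j (by rw [hup, hdown]; decide)

end Hexagon

/-! ### The hierarchy, its strictness and its ranges -/

theorem IsPolygon.ranges {k : ℕ} (h : Q.IsPolygon k) {u v : Fin 2 → ℝ} (hu : u ∈ Q.vertices)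
    (hv : v ∈ Q.vertices) (huv : u ≠ v) :
    (5 ≤ k → Q.CDefmb u v ∈ Set.Icc (1 : ℕ∞) ((k - 3 : ℕ) : ℕ∞)) ∧
      Q.CDefm u v ∈ Set.Icc (1 : ℕ∞) ((k / 2 : ℕ) : ℕ∞) ∧
      Q.CDfm u v ∈ Set.Icc (1 : ℕ∞) ((k / 2 : ℕ) : ℕ∞) ∧
      Q.CDfmb u v ∈ Set.Icc (1 : ℕ∞) ((k / 2 : ℕ) : ℕ∞) ∧
      Q.CDfmr u v ∈ Set.Icc (1 : ℕ∞) ((k / 2 : ℕ) : ℕ∞) ∧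
      Q.CDfmbr u v ∈ Set.Icc (1 : ℕ∞) ((k / 2 : ℕ) : ℕ∞) := by
  have hle := CDfmbr_le h.1 h.2.2 hu hv huv
  refine ⟨fun hk => ⟨one_le_circuitDist huv _, CDefmb_le h.1 h.2.2 hk hu hv huv⟩,
    ⟨one_le_circuitDist huv _, CDefm_le h.1 h.2.2 hu hv huv⟩,
    ⟨one_le_circuitDist huv _, le_trans ?_ hle⟩, ⟨one_le_circuitDist huv _, le_trans ?_ hle⟩,
    ⟨one_le_circuitDist huv _, le_trans ?_ hle⟩, one_le_circuitDist huv _, hle⟩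
  · exact circuitDist_mono fun W hW => ⟨hW.1, hW.2.1⟩
  · exact circuitDist_mono fun W hW => ⟨hW.1, hW.2.1, hW.2.2.1⟩
  · exact circuitDist_mono fun W hW => ⟨hW.1, hW.2.1, hW.2.2.2⟩

theorem CDfmr_le_CDefm (u v : Fin 2 → ℝ) : Q.CDfmr u v ≤ Q.CDefm u v := by
  rw [CDefm_eq_CDefmr]
  exact circuitDist_mono fun W hW => ⟨hW.2.1, hW.2.2.1, hW.2.2.2⟩

end HPolyhedron

theorem theorem3 :
    -- The hierarchy of distances for `n = 2` and its collapse.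
    (∀ (Q : HPolyhedron 2) (u v : Fin 2 → ℝ), u ∈ Q.vertices → v ∈ Q.vertices → u ≠ v →
      (Q.CDefm u v = Q.CDefmr u v ∧
        Q.CDf u v = Q.CD u v ∧ Q.CDfr u v = Q.CD u v ∧ Q.CDfb u v = Q.CD u v ∧
        Q.CDfbr u v = Q.CD u v ∧ Q.CDfs u v = Q.CD u v ∧
        Q.CD u v ∈ ({1, 2} : Set ℕ∞)) ∧
      (Q.CDefm u v ≤ Q.CDefmb u v ∧
        Q.CDfmb u v ≤ Q.CDefmb u v ∧ Q.CDfm u v ≤ Q.CDefm u v ∧ Q.CDfmr u v ≤ Q.CDefm u v ∧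
        Q.CDfm u v ≤ Q.CDfmb u v ∧ Q.CDfm u v ≤ Q.CDfmr u v ∧
        Q.CD u v ≤ Q.CDfm u v)) ∧
    -- The inequalities of the hierarchy can all be strict.
    ((∃ (k : ℕ) (Q : HPolyhedron 2), Q.IsIrredundantPolygon k ∧
        ∃ u ∈ Q.vertices, ∃ v ∈ Q.vertices, u ≠ v ∧ Q.CDefm u v < Q.CDefmb u v) ∧
      (∃ (k : ℕ) (Q : HPolyhedron 2), Q.IsIrredundantPolygon k ∧
        ∃ u ∈ Q.vertices, ∃ v ∈ Q.vertices, u ≠ v ∧ Q.CDfmb u v < Q.CDefmb u v) ∧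
      (∃ (k : ℕ) (Q : HPolyhedron 2), Q.IsIrredundantPolygon k ∧
        ∃ u ∈ Q.vertices, ∃ v ∈ Q.vertices, u ≠ v ∧ Q.CDfm u v < Q.CDefm u v) ∧
      (∃ (k : ℕ) (Q : HPolyhedron 2), Q.IsIrredundantPolygon k ∧
        ∃ u ∈ Q.vertices, ∃ v ∈ Q.vertices, u ≠ v ∧ Q.CDfmr u v < Q.CDefm u v) ∧
      (∃ (k : ℕ) (Q : HPolyhedron 2), Q.IsIrredundantPolygon k ∧
        ∃ u ∈ Q.vertices, ∃ v ∈ Q.vertices, u ≠ v ∧ Q.CDfm u v < Q.CDfmb u v) ∧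
      (∃ (k : ℕ) (Q : HPolyhedron 2), Q.IsIrredundantPolygon k ∧
        ∃ u ∈ Q.vertices, ∃ v ∈ Q.vertices, u ≠ v ∧ Q.CDfm u v < Q.CDfmr u v) ∧
      (∃ (k : ℕ) (Q : HPolyhedron 2), Q.IsIrredundantPolygon k ∧
        ∃ u ∈ Q.vertices, ∃ v ∈ Q.vertices, u ≠ v ∧ Q.CD u v < Q.CDfm u v)) ∧
    -- The ranges for a polygon on `k` vertices.
    (∀ (k : ℕ) (Q : HPolyhedron 2), Q.IsPolygon k →
      ∀ u ∈ Q.vertices, ∀ v ∈ Q.vertices, u ≠ v →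
        (5 ≤ k → Q.CDefmb u v ∈ Set.Icc (1 : ℕ∞) ((k - 3 : ℕ) : ℕ∞)) ∧
        Q.CDefm u v ∈ Set.Icc (1 : ℕ∞) ((k / 2 : ℕ) : ℕ∞) ∧
        Q.CDfm u v ∈ Set.Icc (1 : ℕ∞) ((k / 2 : ℕ) : ℕ∞) ∧
        Q.CDfmb u v ∈ Set.Icc (1 : ℕ∞) ((k / 2 : ℕ) : ℕ∞) ∧
        Q.CDfmr u v ∈ Set.Icc (1 : ℕ∞) ((k / 2 : ℕ) : ℕ∞) ∧
        Q.CDfmbr u v ∈ Set.Icc (1 : ℕ∞) ((k / 2 : ℕ) : ℕ∞)) ∧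
    -- The maxima of the ranges are attained.
    (∀ k : ℕ, 5 ≤ k → ∃ Q : HPolyhedron 2, Q.IsIrredundantPolygon k ∧
      ∃ u ∈ Q.vertices, ∃ v ∈ Q.vertices, u ≠ v ∧ Q.CDefmb u v = ((k - 3 : ℕ) : ℕ∞)) ∧
    (∀ k : ℕ, 3 ≤ k → ∃ Q : HPolyhedron 2, Q.IsIrredundantPolygon k ∧
      ∃ u ∈ Q.vertices, ∃ v ∈ Q.vertices, u ≠ v ∧
        Q.CDefm u v = ((k / 2 : ℕ) : ℕ∞) ∧ Q.CDfm u v = ((k / 2 : ℕ) : ℕ∞) ∧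
        Q.CDfmb u v = ((k / 2 : ℕ) : ℕ∞) ∧ Q.CDfmr u v = ((k / 2 : ℕ) : ℕ∞) ∧
        Q.CDfmbr u v = ((k / 2 : ℕ) : ℕ∞)) ∧
    (∀ k : ℕ, 4 ≤ k → ∃ Q : HPolyhedron 2, Q.IsIrredundantPolygon k ∧
      ∃ u ∈ Q.vertices, ∃ v ∈ Q.vertices, u ≠ v ∧ Q.CD u v = 2) := by
  -- four of the strict inequalities occur in the bowl with `7` vertices
  have h4 : 2 ≤ 4 := by norm_num
  let data := HPolyhedron.Bowl.data 4 h4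
  let bowl := data.toHPolyhedron
  have hbowl : bowl.IsIrredundantPolygon 7 :=
    data.isIrredundantPolygon (HPolyhedron.Bowl.isBounded h4) (Fintype.card_fin _)
  let u := data.pt ⟨0, by norm_num⟩
  let v := data.pt ⟨4, by norm_num⟩
  have hu : u ∈ bowl.vertices := data.pt_mem_vertices _
  have hv : v ∈ bowl.vertices := data.pt_mem_vertices _
  have huv : u ≠ v := HPolyhedron.Bowl.pt_ne h4
  have hrange := hbowl.1.ranges hu hv huv
  have hefmb : bowl.CDefmb u v = 4 := HPolyhedron.Bowl.CDefmb_eq h4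
  have hefm : 2 ≤ bowl.CDefm u v := HPolyhedron.Bowl.two_le_CDefm h4
  have hchord := HPolyhedron.Bowl.exists_circuit h4
  refine ⟨fun Q u v hu hv huv => ⟨⟨Q.CDefm_eq_CDefmr u v, ?_, ?_, ?_, ?_, ?_, ?_⟩,
    ?_, ?_, ?_, HPolyhedron.CDfmr_le_CDefm u v, ?_, ?_, ?_⟩, ⟨?_, ?_, ?_, ?_,
    HPolyhedron.Hexagon.exists_CDfm_lt_CDfmb, HPolyhedron.Trapezoid.exists_CDfm_lt_CDfmr, ?_⟩,
    fun k Q hQ u hu v hv huv => hQ.ranges hu hv huv, fun k hk => ?_, fun k hk => ?_,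
    fun k hk => ?_⟩
  · exact (HPolyhedron.circuitDist_eq_CD hu hv huv _ fun W hf _ _ _ => hf).1
  · exact (HPolyhedron.circuitDist_eq_CD hu hv huv _ fun W hf _ hr _ => ⟨hf, hr⟩).1
  · exact (HPolyhedron.circuitDist_eq_CD hu hv huv _ fun W hf hb _ _ => ⟨hf, hb⟩).1
  · exact (HPolyhedron.circuitDist_eq_CD hu hv huv _ fun W hf hb hr _ => ⟨hf, hb, hr⟩).1
  · exact (HPolyhedron.circuitDist_eq_CD hu hv huv _ fun W hf _ _ hs => ⟨hf, hs⟩).1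
  · exact (HPolyhedron.circuitDist_eq_CD hu hv huv _ fun W hf _ _ _ => hf).2
  · exact HPolyhedron.circuitDist_mono fun W hW => ⟨hW.1, hW.2.1, hW.2.2.1⟩
  · exact HPolyhedron.circuitDist_mono fun W hW => ⟨hW.2.1, hW.2.2.1, hW.2.2.2⟩
  · exact HPolyhedron.circuitDist_mono fun W hW => ⟨hW.2.1, hW.2.2⟩
  · exact HPolyhedron.circuitDist_mono fun W hW => ⟨hW.1, hW.2.1⟩
  · exact HPolyhedron.circuitDist_mono fun W hW => ⟨hW.1, hW.2.1⟩
  · exact HPolyhedron.circuitDist_mono fun W _ => trivial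
  · refine ⟨7, bowl, hbowl, u, hu, v, hv, huv, ?_⟩
    rw [hefmb]
    exact (hrange.2.1.2).trans_lt (by norm_num)
  · refine ⟨7, bowl, hbowl, u, hu, v, hv, huv, ?_⟩
    rw [hefmb]
    exact (HPolyhedron.circuitDist_le_one hu hv hchord _
      fun W _ h1 h2 h3 _ _ => ⟨h1, h2, h3⟩).trans_lt (by norm_num)
  · refine ⟨7, bowl, hbowl, u, hu, v, hv, huv, lt_of_lt_of_le ?_ hefm⟩
    exact (HPolyhedron.circuitDist_le_one hu hv hchord _
      fun W _ h1 h2 _ _ _ => ⟨h1, h2⟩).trans_lt (by norm_num)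
  · refine ⟨7, bowl, hbowl, u, hu, v, hv, huv, lt_of_lt_of_le ?_ hefm⟩
    exact (HPolyhedron.circuitDist_le_one hu hv hchord _
      fun W _ h1 h2 _ h4 _ => ⟨h1, h2, h4⟩).trans_lt (by norm_num)
  · obtain ⟨Q, hQ, u, hu, v, hv, huv, h⟩ := HPolyhedron.exists_polygon_le_CDfm (k := 6) (by norm_num)
    refine ⟨6, Q, hQ, u, hu, v, hv, huv, lt_of_lt_of_le ?_ h⟩
    rw [HPolyhedron.CD_eq_two hu hv huv (le_trans (by norm_num) h)]
    norm_num
  · obtain ⟨m, rfl⟩ : ∃ m, k = m + 3 := ⟨k - 3, by omega⟩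
    have hm : 2 ≤ m := by omega
    exact ⟨_, HPolyhedron.PolygonData.isIrredundantPolygon _ (HPolyhedron.Bowl.isBounded hm)
      (Fintype.card_fin _), _, HPolyhedron.PolygonData.pt_mem_vertices _ _, _,
      HPolyhedron.PolygonData.pt_mem_vertices _ _, HPolyhedron.Bowl.pt_ne hm,
      HPolyhedron.Bowl.CDefmb_eq hm⟩
  · obtain ⟨Q, hQ, u, hu, v, hv, huv, h⟩ := HPolyhedron.exists_polygon_le_CDfm hk
    obtain ⟨-, r1, r2, r3, r4, r5⟩ := hQ.1.ranges hu hv huv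
    refine ⟨Q, hQ, u, hu, v, hv, huv, le_antisymm r1.2 (h.trans ?_), le_antisymm r2.2 h,
      le_antisymm r3.2 (h.trans ?_), le_antisymm r4.2 (h.trans ?_), le_antisymm r5.2 (h.trans ?_)⟩
    · exact HPolyhedron.circuitDist_mono fun W hW => ⟨hW.2.1, hW.2.2⟩
    · exact HPolyhedron.circuitDist_mono fun W hW => ⟨hW.1, hW.2.1⟩
    · exact HPolyhedron.circuitDist_mono fun W hW => ⟨hW.1, hW.2.1⟩
    · exact HPolyhedron.circuitDist_mono fun W hW => ⟨hW.1, hW.2.1⟩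
  · obtain ⟨Q, hQ, u, hu, v, hv, huv, h⟩ := HPolyhedron.exists_polygon_le_CDfm (by omega : 3 ≤ k)
    refine ⟨Q, hQ, u, hu, v, hv, huv, HPolyhedron.CD_eq_two hu hv huv (le_trans ?_ h)⟩
    have : 2 ≤ k / 2 := by omega
    exact_mod_cast this
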